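/- Let $0<q<1$, $a\in\mathbb R$, $t=q^a-q^{-a}$ and $[x]=\frac{q^x-q^{-x}}{q-q^{-1}}$. Let $A=\mathcal O_q(SU(2))$ be the Hopf $*$-algebra generated by $\alpha,\gamma$ with $\alpha^*\alpha+\gamma^*\gamma=1$, $\alpha\alpha^*+q^2\gamma\gamma^*=1$, $\gamma^*\gamma=\gamma\gamma^*$, $\alpha\gamma=q\gamma\alpha$, $\alpha\gamma^*=q\gamma^*\alpha$, $\Delta(\alpha)=\alpha\otimes\alpha-q\gamma^*\otimes\gamma$, $\Delta(\gamma)=\gamma\otimes\alpha+\alpha^*\otimes\gamma$, $S(\alpha)=\alpha^*$, $S(\gamma)=-q\gamma$. Let $\mathcal U=\mathrm{Hom}(A,\mathbb C)$, with the convolution product and $\omega^*(x)=\overline{\omega(S(x)^*)}$. The algebra $U_q(\mathfrak{su}(2))$, with $\Delta(k)=k\otimes k$, $\Delta(e)=e\otimes1+k\otimes e$, $\Delta(f)=1\otimes f+f\otimes k^{-1}$, is viewed in $\mathcal U$ through the pairing for which $k$, $e$, $f$ take on the matrix $\begin{pmatrix}\alpha&-q\gamma^*\\ \gamma&\alpha^*\end{pmatrix}$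 the values $\begin{pmatrix}q&0\\0&q^{-1}\end{pmatrix}$, $\begin{pmatrix}0&q^{1/2}\\0&0\end{pmatrix}$, $\begin{pmatrix}0&0\\q^{-1/2}&0\end{pmatrix}$. Put $$B_t=q^{-1/2}(e-fk)-\sqrt{-1}\,(q-q^{-1})^{-1}t\,k,\qquad \mathcal O_q(S_t^2)=\{x\in A: (x_{(1)},B_t)\,x_{(2)}=\varepsilon(B_t)\,x\},$$ let $\mathcal O_q(S_t^2)_+=\mathcal O_q(S_t^2)\cap\ker\varepsilon$, and let $\mathcal I=\{\omega\in\mathcal U:\omega(A\,\mathcal O_q(S_t^2)_+)=0\}$. For $n\in\mathbb Z$ let $\mathbb B(\mathbb C_n)=\{\omega\in\mathcal I:\sqrt{-1}B_t\,\omega=[a+n]\,\omega\}$ and let $\mathcal I_c$ be the linear span of these spaces. Let $C_c(SL_q(2,\mathbb R)_t)=\mathcal O_q(S_t^2)\bowtie\mathcal I_c$ be the $*$-subalgebra generated by the products $b\,\omega$ $(b\in\mathcal O_q(S_t^2),\ \omega\in\mathcal I_c)$ of the $*$-algebra which is $A\otimes\mathcal U$ as a vector space, contains $A$ and $\mathcal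 U$ as $*$-subalgebras, and has the interchange relation $\omega\, b=b_{(1)}\,\omega(b_{(2)}\,\cdot\,)$. **Theorem.** 1. Each $\mathbb B(\mathbb C_n)$ is one-dimensional and is spanned by a unique nonzero idempotent $\Phi_n$, and every element of $C_c(SL_q(2,\mathbb R)_t)$ is a finite sum of products $b\,\omega$ with $b\in\mathcal O_q(S_t^2)$, $\omega\in\mathcal I_c$. 2. The formula $\|f\|_u=\sup\{\|\pi(f)\|:\pi \text{ an irreducible } *\text{-representation of } C_c(SL_q(2,\mathbb R)_t) \text{ by bounded operators on a Hilbert space}\}$ defines a finite C*-norm on $C_c(SL_q(2,\mathbb R)_t)$. Hence the full group C*-algebra $C^*_u(SL_q(2,\mathbb R)_t)$, the completion of $C_c(SL_q(2,\mathbb R)_t)$ in $\|\cdot\|_u$, exists. 3. $C^*_u(SL_q(2,\mathbb R)_t)$ is liminal: for every irreducible $*$-representation $(\pi,H)$ of it on a Hilbert space, $\pi(C^*_u(SL_q(2,\mathbb R)_t))\subset\mathbb K(H)$. Moreover each $\pi(\Phi_n)$ is an orthogonal projection of rank at most one. -/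

import Mathlib

open scoped TensorProduct ComplexConjugate
open Coalgebra HopfAlgebra

set_option linter.unusedSimpArgs false
set_option linter.unnecessarySeqFocus false

noncomputable section

namespace QSL2

/-- A Hopf `*`-algebra over `ℂ`. -/
class HopfStarAlgebra (A : Type*) [Ring A] [HopfAlgebra ℂ A] [StarRing A] [StarModule ℂ A] :
    Prop where
  comul_star : ∀ a : A, comul (R := ℂ) (star a) = star (comul (R := ℂ) a)
  counit_star : ∀ a : A, counit (R := ℂ) (star a) = conj (counit (R := ℂ) a)
  star_antipode : ∀ a : A, star (antipode ℂ (star (antipode ℂ a))) = a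
  comul_antipode : ∀ a : A, comul (R := ℂ) (antipode ℂ a) =
    TensorProduct.map (antipode ℂ) (antipode ℂ) (TensorProduct.comm ℂ A A (comul (R := ℂ) a))

/-- The full linear dual `Hom(A, ℂ)` with the convolution product
`(ω * θ)(x) = ω(x₍₁₎) θ(x₍₂₎)`; its unit is the counit of `A`. -/
abbrev FullDual (A : Type*) [Ring A] [HopfAlgebra ℂ A] : Type _ := WithConv (A →ₗ[ℂ] ℂ)

section Alg

variable {A : Type*} [Ring A] [HopfAlgebra ℂ A]

/-- The right action of `A` on its full dual: `(ω ◁ c)(x) = ω(c x)`, as a bilinear map. -/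
def dualAct : A →ₗ[ℂ] FullDual A →ₗ[ℂ] FullDual A :=
  LinearMap.mk₂ ℂ (fun c ω => WithConv.toConv (ω.ofConv ∘ₗ LinearMap.mulLeft ℂ c))
    (fun c d ω => by ext x; simp [add_mul])
    (fun r c ω => by ext x; simp)
    (fun c ω θ => by ext x; simp)
    (fun r c ω => by ext x; simp)

@[simp] lemma dualAct_apply (c : A) (ω : FullDual A) (x : A) : (dualAct c ω) x = ω (c * x) := rfl

lemma dualAct_mul (c d : A) (ω : FullDual A) : dualAct (c * d) ω = dualAct d (dualAct c ω) := by
  ext x; simp [mul_assoc]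

lemma dualAct_one (ω : FullDual A) : dualAct (1 : A) ω = ω := by
  ext x; simp

lemma dualAct_counit (c : A) : dualAct c (1 : FullDual A) = counit (R := ℂ) c • (1 : FullDual A) := by
  ext x; simp

lemma dualAct_conv (c : A) {ι : Type*} (r : Coalgebra.Repr ℂ c ι) (ω θ : FullDual A) :
    dualAct c (ω * θ) = ∑ i ∈ r.index, dualAct (r.left i) ω * dualAct (r.right i) θ := by
  ext x
  have h1 : ∀ i, (dualAct (r.left i) ω * dualAct (r.right i) θ) x =
      ∑ j ∈ (ℛ ℂ x).index, ω (r.left i * (ℛ ℂ x).left j) * θ (r.right i * (ℛ ℂ x).right j) := by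
    intro i; rw [(ℛ ℂ x).convMul_apply]; rfl
  have h2 : (∑ i ∈ r.index, dualAct (r.left i) ω * dualAct (r.right i) θ) x =
      ∑ i ∈ r.index, (dualAct (r.left i) ω * dualAct (r.right i) θ) x := by
    simp
  rw [h2]
  simp only [h1]
  simp only [dualAct_apply, LinearMap.convMul_apply, Bialgebra.comul_mul]
  rw [← r.eq, ← (ℛ ℂ x).eq]
  simp [Finset.sum_mul_sum]

/-- The underlying space `A ⊗ Hom(A, ℂ)` of the smash product. -/
abbrev SmashSpace (A : Type*) [Ring A] [HopfAlgebra ℂ A] : Type _ := A ⊗[ℂ] FullDual A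

/-- Right multiplication by `θ ∈ Hom(A, ℂ)`:  `a ⊗ ω ↦ a ⊗ ω * θ`. -/
def rightDual : FullDual A →ₗ[ℂ] Module.End ℂ (SmashSpace A) where
  toFun θ := LinearMap.lTensor A (LinearMap.mulRight ℂ θ)
  map_add' θ θ' := by
    ext a ω; simp [mul_add, TensorProduct.tmul_add]
  map_smul' r θ := by
    ext a ω : 3
    simp only [TensorProduct.AlgebraTensorModule.curry_apply, TensorProduct.curry_apply,
      LinearMap.restrictScalars_self, LinearMap.lTensor_tmul, LinearMap.mulRight_apply,
      mul_smul_comm, TensorProduct.tmul_smul, RingHom.id_apply, LinearMap.smul_apply]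

/-- `c ⊗ d` sends `a ⊗ ω` to `a c ⊗ (ω ◁ d)`. -/
def rightPair : A ⊗[ℂ] A →ₗ[ℂ] Module.End ℂ (SmashSpace A) :=
  TensorProduct.lift (LinearMap.mk₂ ℂ
    (fun c d => TensorProduct.map (LinearMap.mulRight ℂ c) (dualAct d))
    (fun c c' d => by ext a ω; simp [mul_add, TensorProduct.add_tmul])
    (fun r c d => by ext a ω; simp [TensorProduct.smul_tmul'])
    (fun c d d' => by ext a ω; simp [TensorProduct.tmul_add])
    (fun r c d => by ext a ω; simp))

/-- Right multiplication by `b ∈ A`:  `a ⊗ ω ↦ a b₍₁₎ ⊗ (ω ◁ b₍₂₎)`. -/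
def rightAlg : A →ₗ[ℂ] Module.End ℂ (SmashSpace A) := rightPair ∘ₗ comul

/-- Right multiplication by `b ⊗ θ`:  `a ⊗ ω ↦ a b₍₁₎ ⊗ (ω ◁ b₍₂₎) * θ`. -/
def smashMul : SmashSpace A →ₗ[ℂ] Module.End ℂ (SmashSpace A) :=
  TensorProduct.lift (LinearMap.mk₂ ℂ (fun b θ => rightDual θ * rightAlg b)
    (fun b b' θ => by simp [mul_add])
    (fun r b θ => by simp)
    (fun b θ θ' => by simp [add_mul])
    (fun r b θ => by simp))

@[simp] lemma rightDual_tmul (θ : FullDual A) (a : A) (ω : FullDual A) :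
    rightDual θ (a ⊗ₜ[ℂ] ω) = a ⊗ₜ[ℂ] (ω * θ) := rfl

@[simp] lemma rightPair_tmul (c d : A) (a : A) (ω : FullDual A) :
    rightPair (c ⊗ₜ[ℂ] d) (a ⊗ₜ[ℂ] ω) = (a * c) ⊗ₜ[ℂ] dualAct d ω := rfl

@[simp] lemma smashMul_tmul (b : A) (θ : FullDual A) :
    smashMul (b ⊗ₜ[ℂ] θ) = rightDual θ * rightAlg b := rfl

lemma rightAlg_tmul (b : A) {ι : Type*} (r : Coalgebra.Repr ℂ b ι) (a : A) (ω : FullDual A) :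
    rightAlg b (a ⊗ₜ[ℂ] ω) = ∑ i ∈ r.index, (a * r.left i) ⊗ₜ[ℂ] dualAct (r.right i) ω := by
  simp [rightAlg, ← r.eq]

lemma rightDual_mul (θ τ : FullDual A) : rightDual (θ * τ) = rightDual τ * rightDual θ := by
  ext a ω : 3
  simp [mul_assoc]

lemma rightDual_one : rightDual (1 : FullDual A) = 1 := by
  ext a ω : 3
  simp

lemma rightPair_mul (u v : A ⊗[ℂ] A) : rightPair (u * v) = rightPair v * rightPair u := by
  induction u using TensorProduct.induction_on with
  | zero => simp
  | add u u' h h' => simp [add_mul, mul_add, h, h']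
  | tmul c d =>
    induction v using TensorProduct.induction_on with
    | zero => simp
    | add v v' h h' => simp [add_mul, mul_add, h, h']
    | tmul c' d' =>
      ext a ω : 3
      simp [mul_assoc, dualAct_mul]

lemma rightAlg_mul (b c : A) : rightAlg (b * c) = rightAlg c * rightAlg b := by
  simp [rightAlg, rightPair_mul]

lemma rightAlg_one : rightAlg (1 : A) = 1 := by
  ext a ω : 3
  simp [rightAlg, Algebra.TensorProduct.one_def, dualAct_one]

lemma rightAlg_rightDual (c : A) {ι : Type*} (r : Coalgebra.Repr ℂ c ι) (θ : FullDual A) :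
    rightAlg c * rightDual θ =
      ∑ i ∈ r.index, rightDual (dualAct (r.right i) θ) * rightAlg (r.left i) := by
  ext a ω : 3
  simp only [TensorProduct.AlgebraTensorModule.curry_apply, TensorProduct.curry_apply,
    LinearMap.restrictScalars_self, Module.End.mul_apply, rightDual_tmul, LinearMap.sum_apply]
  let F : A ⊗[ℂ] (A ⊗[ℂ] A) →ₗ[ℂ] SmashSpace A :=
    TensorProduct.map (LinearMap.mulLeft ℂ a)
      (LinearMap.mul' ℂ (FullDual A) ∘ₗ TensorProduct.map (dualAct.flip ω) (dualAct.flip θ))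
  have key := congrArg F (Coalgebra.sum_tmul_tmul_eq r (fun i => ℛ ℂ (r.left i))
    (fun i => ℛ ℂ (r.right i)))
  simp only [map_sum, F, TensorProduct.map_tmul, LinearMap.mulLeft_apply, LinearMap.comp_apply,
    LinearMap.mul'_apply, LinearMap.flip_apply] at key
  rw [rightAlg_tmul c r]
  simp only [dualAct_conv _ (ℛ ℂ (r.right _)), TensorProduct.tmul_sum]
  rw [← key]
  refine Finset.sum_congr rfl fun i _ => ?_
  rw [rightAlg_tmul _ (ℛ ℂ (r.left i))]
  simp

lemma smashMul_assoc (y z : SmashSpace A) :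
    smashMul (smashMul z y) = smashMul z * smashMul y := by
  induction z using TensorProduct.induction_on with
  | zero => simp
  | add z z' h h' => simp [add_mul, h, h']
  | tmul c τ =>
    induction y using TensorProduct.induction_on with
    | zero => simp
    | add y y' h h' => simp only [map_add, mul_add, h, h']
    | tmul b θ =>
      have r := ℛ ℂ c
      rw [smashMul_tmul, smashMul_tmul, mul_assoc, ← mul_assoc (rightAlg c),
        rightAlg_rightDual c r, Module.End.mul_apply, rightAlg_tmul c r, map_sum, map_sum]
      rw [Finset.sum_mul, Finset.mul_sum]
      refine Finset.sum_congr rfl fun i _ => ?_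
      simp [rightDual_mul, rightAlg_mul, mul_assoc]


end Alg

section Star

variable {A : Type*} [Ring A] [HopfAlgebra ℂ A] [StarRing A] [StarModule ℂ A]

/-- The involution `ω^*(x) = conj (ω (S(x)^*))` of the full dual of a Hopf `*`-algebra. -/
def dualStar (ω : FullDual A) : FullDual A :=
  WithConv.toConv
    { toFun := fun x => conj (ω (star (antipode ℂ x)))
      map_add' := fun x y => by simp
      map_smul' := fun c x => by simp }

@[simp] lemma dualStar_apply (ω : FullDual A) (x : A) :
    (dualStar ω) x = conj (ω (star (antipode ℂ x))) := rfl

lemma dualStar_add (ω θ : FullDual A) : dualStar (ω + θ) = dualStar ω + dualStar θ := by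
  ext x; simp

lemma dualStar_smul (r : ℂ) (ω : FullDual A) : dualStar (r • ω) = conj r • dualStar ω := by
  ext x; simp

lemma dualStar_mul [HopfStarAlgebra A] (ω θ : FullDual A) :
    dualStar (ω * θ) = dualStar θ * dualStar ω := by
  ext x
  have r := ℛ ℂ x
  rw [r.convMul_apply]
  simp only [dualStar_apply, LinearMap.convMul_apply, HopfStarAlgebra.comul_star,
    HopfStarAlgebra.comul_antipode]
  rw [← r.eq]
  simp [mul_comm]

lemma dualStar_one [HopfStarAlgebra A] : dualStar (1 : FullDual A) = 1 := by
  ext x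
  simp [HopfStarAlgebra.counit_star]

lemma dualStar_dualStar [HopfStarAlgebra A] (ω : FullDual A) : dualStar (dualStar ω) = ω := by
  ext x
  simp [HopfStarAlgebra.star_antipode]

lemma dualStar_act [HopfStarAlgebra A] (c : A) (ω : FullDual A) :
    dualStar (dualAct c ω) = dualAct (star (antipode ℂ c)) (dualStar ω) := by
  ext x
  simp [antipode_mul_antidistrib, HopfStarAlgebra.star_antipode]

end Star

/-- The smash product `A ⋊ Hom(A, ℂ)` of a Hopf `*`-algebra with its full dual: the vector space
`A ⊗ Hom(A, ℂ)`, in which `a ⊗ ω` stands for `a ω`, with the interchange relation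
`ω b = b₍₁₎ (ω ◁ b₍₂₎)` and the involution `(a ω)^* = ω^* a^*`. -/
def Smash (A : Type*) [Ring A] [HopfAlgebra ℂ A] : Type _ := SmashSpace A

namespace Smash

variable {A : Type*} [Ring A] [HopfAlgebra ℂ A]

instance : AddCommGroup (Smash A) := inferInstanceAs (AddCommGroup (SmashSpace A))
instance : Module ℂ (Smash A) := inferInstanceAs (Module ℂ (SmashSpace A))

/-- The element `a ω`. -/
def mk (a : A) (ω : FullDual A) : Smash A := a ⊗ₜ[ℂ] ω

instance : Mul (Smash A) where
  mul x y := (smashMul (y : SmashSpace A) (x : SmashSpace A) : SmashSpace A)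

lemma mul_eq (x y : Smash A) :
    x * y = (smashMul (y : SmashSpace A) (x : SmashSpace A) : SmashSpace A) := rfl

/-- `a ω b θ = a b₍₁₎ (ω ◁ b₍₂₎) θ`. -/
lemma mk_mul_mk (a b : A) (ω θ : FullDual A) {ι : Type*} (r : Coalgebra.Repr ℂ b ι) :
    mk a ω * mk b θ = ∑ i ∈ r.index, mk (a * r.left i) (dualAct (r.right i) ω * θ) := by
  have h := congrArg (rightDual θ) (rightAlg_tmul b r a ω)
  simp only [map_sum, rightDual_tmul] at h
  exact h

lemma induction_on' {p : Smash A → Prop} (x : Smash A) (zero : p 0)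
    (add : ∀ x y, p x → p y → p (x + y)) (mk : ∀ a ω, p (mk a ω)) : p x :=
  TensorProduct.induction_on (R := ℂ) (M := A) (N := FullDual A) (motive := p) x zero mk add

protected lemma mul_add' (x y z : Smash A) : x * (y + z) = x * y + x * z :=
  congrArg (fun f : Module.End ℂ (SmashSpace A) => f x) (map_add (smashMul (A := A)) y z)

protected lemma mul_zero' (x : Smash A) : x * 0 = 0 :=
  congrArg (fun f : Module.End ℂ (SmashSpace A) => f x) (map_zero (smashMul (A := A)))

protected lemma one_mul' (x : Smash A) : mk 1 1 * x = x := by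
  refine induction_on' (p := fun x => mk 1 1 * x = x) x (Smash.mul_zero' _) (fun x y hx hy => ?_) (fun b θ => ?_)
  · rw [Smash.mul_add', hx, hy]
  · rw [mk_mul_mk _ _ _ _ (ℛ ℂ b)]
    have h := congrArg (TensorProduct.map (LinearMap.id (R := ℂ) (M := A))
      (LinearMap.toSpanSingleton ℂ (FullDual A) θ)) (Coalgebra.sum_tmul_counit_eq (ℛ ℂ b))
    simp only [map_sum, TensorProduct.map_tmul, LinearMap.id_apply,
      LinearMap.toSpanSingleton_apply, one_smul] at h
    simp only [one_mul, dualAct_counit, smul_mul_assoc]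
    exact h

protected lemma mul_one' (x : Smash A) : x * mk 1 1 = x := by
  have : smashMul (A := A) ((1 : A) ⊗ₜ[ℂ] (1 : FullDual A)) = 1 := by
    simp [rightDual_one, rightAlg_one]
  exact congrArg (fun f : Module.End ℂ (SmashSpace A) => f x) this

instance : Ring (Smash A) :=
  { (inferInstance : AddCommGroup (Smash A)), (inferInstance : Mul (Smash A)) with
    one := mk 1 1
    left_distrib := Smash.mul_add'
    right_distrib := fun x y z => map_add (smashMul (A := A) z) x y
    zero_mul := fun x => map_zero (smashMul (A := A) x)
    mul_zero := Smash.mul_zero'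
    mul_assoc := fun x y z => (congrArg (fun f : Module.End ℂ (SmashSpace A) => f x)
        (smashMul_assoc (A := A) y z)).symm
    one_mul := Smash.one_mul'
    mul_one := Smash.mul_one' }

lemma one_def : (1 : Smash A) = mk 1 1 := rfl

instance : Algebra ℂ (Smash A) :=
  Algebra.ofModule (fun r x y => map_smul (smashMul (A := A) y) r x)
    (fun r x y => congrArg (fun f : Module.End ℂ (SmashSpace A) => f x)
      (map_smul (smashMul (A := A)) r y))

lemma mk_one_mul (a b : A) (θ : FullDual A) : mk a 1 * mk b θ = mk (a * b) θ := by
  have h := rightAlg_tmul b (ℛ ℂ b) a 1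
  rw [mk_mul_mk _ _ _ _ (ℛ ℂ b)]
  have h := congrArg (TensorProduct.map (LinearMap.mulLeft ℂ a)
      (LinearMap.toSpanSingleton ℂ (FullDual A) θ)) (Coalgebra.sum_tmul_counit_eq (ℛ ℂ b))
  simp only [map_sum, TensorProduct.map_tmul, LinearMap.mulLeft_apply,
    LinearMap.toSpanSingleton_apply, one_smul] at h
  simp only [dualAct_counit, smul_mul_assoc, one_mul]
  exact h

lemma mk_mul_one (a : A) (ω θ : FullDual A) : mk a ω * mk 1 θ = mk a (ω * θ) := by
  have : smashMul (A := A) ((1 : A) ⊗ₜ[ℂ] θ) = rightDual θ := by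
    simp [rightAlg_one]
  exact congrArg (fun f : Module.End ℂ (SmashSpace A) => f (a ⊗ₜ[ℂ] ω)) this

lemma mk_eq (a : A) (ω : FullDual A) : mk a ω = mk a 1 * mk 1 ω := by
  rw [mk_mul_one, one_mul]

section Star

variable [StarRing A] [StarModule ℂ A]

/-- `(a ω)^* = ω^* a^*`, as a conjugate linear map. -/
def starMap : SmashSpace A →ₛₗ[starRingEnd ℂ] SmashSpace A :=
  TensorProduct.lift (LinearMap.mk₂'ₛₗ (starRingEnd ℂ) (starRingEnd ℂ)
    (fun a ω => rightAlg (star a) ((1 : A) ⊗ₜ[ℂ] dualStar ω))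
    (fun a b ω => by simp)
    (fun r a ω => by simp)
    (fun a ω θ => by simp [dualStar_add, TensorProduct.tmul_add])
    (fun r a ω => by simp [dualStar_smul]))

instance : Star (Smash A) where
  star x := (starMap (x : SmashSpace A) : SmashSpace A)

lemma star_mk' (a : A) (ω : FullDual A) {ι : Type*} (r : Coalgebra.Repr ℂ (star a) ι) :
    star (mk a ω) = ∑ i ∈ r.index, mk (r.left i) (dualAct (r.right i) (dualStar ω)) := by
  have h := rightAlg_tmul (star a) r 1 (dualStar ω)
  simp only [one_mul] at h
  exact h

lemma star_mk (a : A) (ω : FullDual A) : star (mk a ω) = mk 1 (dualStar ω) * mk (star a) 1 := by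
  rw [star_mk' a ω (ℛ ℂ _), mk_mul_mk _ _ _ _ (ℛ ℂ _)]
  simp

protected lemma star_add' (x y : Smash A) : star (x + y) = star x + star y :=
  map_add (starMap (A := A)) x y

protected lemma star_zero' : star (0 : Smash A) = 0 := map_zero (starMap (A := A))

protected lemma star_sum' {ι : Type*} (s : Finset ι) (f : ι → Smash A) :
    star (∑ i ∈ s, f i) = ∑ i ∈ s, star (f i) := map_sum (starMap (A := A)) f s

protected lemma star_smul' (r : ℂ) (x : Smash A) : star (r • x) = conj r • star x :=
  LinearMap.map_smulₛₗ (starMap (A := A)) r x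

lemma star_alg_mul (a : A) (x : Smash A) :
    star (mk a 1 * x) = star x * mk (star a) 1 := by
  refine induction_on' (p := fun x => star (mk a 1 * x) = star x * mk (star a) 1) x ?_ ?_ ?_
  · rw [mul_zero, Smash.star_zero', zero_mul]
  · intro x y hx hy
    rw [mul_add, Smash.star_add', hx, hy, Smash.star_add', add_mul]
  · intro b θ
    rw [mk_one_mul, star_mk, star_mk, star_mul, mul_assoc, mk_one_mul]

variable [HopfStarAlgebra A]

/-- The interchange relation is compatible with the involution: `(ω b)^* = b^* ω^*`. -/
lemma star_dual_mul_alg (b : A) (ω : FullDual A) :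
    star (mk 1 ω * mk b 1) = mk (star b) (dualStar ω) := by
  let F : A ⊗[ℂ] (A ⊗[ℂ] A) →ₛₗ[starRingEnd ℂ] SmashSpace A :=
    TensorProduct.lift (LinearMap.mk₂'ₛₗ (starRingEnd ℂ) (starRingEnd ℂ)
      (fun x u => star x ⊗ₜ[ℂ] dualAct (star (LinearMap.mul' ℂ A ((antipode ℂ).lTensor A u)))
        (dualStar ω))
      (fun x y u => by simp [TensorProduct.add_tmul])
      (fun r x u => by simp [TensorProduct.smul_tmul'])
      (fun x u v => by simp [TensorProduct.tmul_add])
      (fun r x u => by simp))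
  have hF : ∀ x u, F (x ⊗ₜ[ℂ] u) = star x ⊗ₜ[ℂ] dualAct
      (star (LinearMap.mul' ℂ A ((antipode ℂ).lTensor A u))) (dualStar ω) := fun _ _ => rfl
  have r := ℛ ℂ b
  let sr : ∀ i, Coalgebra.Repr ℂ (star (r.left i)) (A × A) := fun i =>
    { index := (ℛ ℂ (r.left i)).index
      left := fun j => star ((ℛ ℂ (r.left i)).left j)
      right := fun j => star ((ℛ ℂ (r.left i)).right j)
      eq := by
        rw [HopfStarAlgebra.comul_star, ← (ℛ ℂ (r.left i)).eq]
        simp }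
  have key := congrArg F (Coalgebra.sum_tmul_tmul_eq r (fun i => ℛ ℂ (r.left i))
    (fun i => ℛ ℂ (r.right i)))
  simp only [map_sum] at key
  have h1 : ∀ i, star (mk (r.left i) (dualAct (r.right i) ω)) =
      ∑ j ∈ (ℛ ℂ (r.left i)).index, (F ((ℛ ℂ (r.left i)).left j ⊗ₜ[ℂ]
        ((ℛ ℂ (r.left i)).right j ⊗ₜ[ℂ] r.right i)) : SmashSpace A) := by
    intro i
    rw [star_mk' _ _ (sr i)]
    refine Finset.sum_congr rfl fun j _ => ?_
    simp only [sr, hF, dualStar_act, ← dualAct_mul, ← star_mul, mk,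
      LinearMap.lTensor_tmul, LinearMap.mul'_apply]
    rfl
  have h2 : ∀ i, ∑ j ∈ (ℛ ℂ (r.right i)).index, F (r.left i ⊗ₜ[ℂ]
        ((ℛ ℂ (r.right i)).left j ⊗ₜ[ℂ] (ℛ ℂ (r.right i)).right j)) =
      star (counit (R := ℂ) (r.right i) • r.left i) ⊗ₜ[ℂ] dualStar ω := by
    intro i
    rw [← map_sum, ← TensorProduct.tmul_sum, (ℛ ℂ (r.right i)).eq]
    simp only [hF, mul_antipode_lTensor_comul_apply, Algebra.algebraMap_eq_smul_one, star_smul, star_one,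
      map_smul, LinearMap.smul_apply, dualAct_one, TensorProduct.tmul_smul,
      TensorProduct.smul_tmul']
  rw [mk_mul_mk _ _ _ _ r, Smash.star_sum']
  simp only [one_mul, mul_one, h1]
  refine key.trans ?_
  simp only [h2]
  rw [← TensorProduct.sum_tmul, ← star_sum]
  have h3 := congrArg (TensorProduct.rid ℂ A) (Coalgebra.sum_tmul_counit_eq r)
  simp only [map_sum, TensorProduct.rid_tmul, one_smul] at h3
  rw [h3]
  rfl

lemma star_mk_mul_one (a : A) (ω θ : FullDual A) :
    star (mk a ω * mk 1 θ) = mk 1 (dualStar θ) * star (mk a ω) := by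
  rw [mk_mul_one, star_mk, star_mk, dualStar_mul, ← mul_assoc, mk_mul_one]

lemma star_mul_dual (x : Smash A) (θ : FullDual A) :
    star (x * mk 1 θ) = mk 1 (dualStar θ) * star x := by
  refine induction_on' (p := fun x => star (x * mk 1 θ) = mk 1 (dualStar θ) * star x) x ?_ ?_ ?_
  · rw [zero_mul, Smash.star_zero', mul_zero]
  · intro x y hx hy
    rw [add_mul, Smash.star_add', hx, hy, Smash.star_add', mul_add]
  · intro a ω
    exact star_mk_mul_one a ω θ

protected lemma star_mul' (x y : Smash A) : star (x * y) = star y * star x := by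
  refine induction_on' (p := fun y => star (x * y) = star y * star x) y ?_ ?_ ?_
  · rw [mul_zero, Smash.star_zero', zero_mul]
  · intro y z hy hz
    rw [mul_add, Smash.star_add', hy, hz, Smash.star_add', add_mul]
  intro b θ
  refine induction_on' (p := fun x => star (x * mk b θ) = star (mk b θ) * star x) x ?_ ?_ ?_
  · rw [zero_mul, Smash.star_zero', mul_zero]
  · intro x y hx hy
    rw [add_mul, Smash.star_add', hx, hy, Smash.star_add', mul_add]
  intro a ω
  rw [mk_eq b θ, ← mul_assoc, star_mul_dual, mk_eq a ω, mul_assoc, star_alg_mul,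
    star_dual_mul_alg, star_mul_dual, star_alg_mul, star_mk b 1, star_mk 1 ω, dualStar_one,
    star_one, ← one_def, one_mul, mul_one, mk_eq (star b)]
  simp only [mul_assoc]

protected lemma star_star' (x : Smash A) : star (star x) = x := by
  refine induction_on' (p := fun x => star (star x) = x) x ?_ ?_ ?_
  · rw [Smash.star_zero', Smash.star_zero']
  · intro x y hx hy
    rw [Smash.star_add', Smash.star_add', hx, hy]
  · intro a ω
    rw [star_mk, star_dual_mul_alg, star_star, dualStar_dualStar]

instance : StarRing (Smash A) where
  star_involutive := Smash.star_star'
  star_mul := Smash.star_mul'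
  star_add := Smash.star_add'

instance : StarModule ℂ (Smash A) where
  star_smul := Smash.star_smul'

end Star

end Smash

/-- The generators `α, α^*, γ, γ^*`. -/
inductive Gen : Type
  | al | als | ga | gas

/-- Four elements of an algebra satisfying the defining relations of `O_q(SU(2))`, as relations
of a `*`-algebra (hence including the adjoints of the last two). -/
structure IsSUq2 (q : ℂ) {B : Type*} [Ring B] [Algebra ℂ B] (x : Gen → B) : Prop where
  rel1 : x .als * x .al + x .gas * x .ga = 1
  rel2 : x .al * x .als + q ^ 2 • (x .ga * x .gas) = 1
  rel3 : x .gas * x .ga = x .ga * x .gas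
  rel4 : x .al * x .ga = q • (x .ga * x .al)
  rel5 : x .al * x .gas = q • (x .gas * x .al)
  rel6 : x .gas * x .als = q • (x .als * x .gas)
  rel7 : x .ga * x .als = q • (x .als * x .ga)

/-- The defining relations of `O_q(SU(2))` in the free algebra. -/
inductive Rel (q : ℂ) : FreeAlgebra ℂ Gen → FreeAlgebra ℂ Gen → Prop
  | rel1 : Rel q (.ι ℂ .als * .ι ℂ .al + .ι ℂ .gas * .ι ℂ .ga) 1
  | rel2 : Rel q (.ι ℂ .al * .ι ℂ .als + q ^ 2 • (.ι ℂ .ga * .ι ℂ .gas)) 1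
  | rel3 : Rel q (.ι ℂ .gas * .ι ℂ .ga) (.ι ℂ .ga * .ι ℂ .gas)
  | rel4 : Rel q (.ι ℂ .al * .ι ℂ .ga) (q • (.ι ℂ .ga * .ι ℂ .al))
  | rel5 : Rel q (.ι ℂ .al * .ι ℂ .gas) (q • (.ι ℂ .gas * .ι ℂ .al))
  | rel6 : Rel q (.ι ℂ .gas * .ι ℂ .als) (q • (.ι ℂ .als * .ι ℂ .gas))
  | rel7 : Rel q (.ι ℂ .ga * .ι ℂ .als) (q • (.ι ℂ .als * .ι ℂ .ga))

/-- The algebra `O_q(SU(2))`, `0 < q < 1`. -/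
def Oq (q : Set.Ioo (0 : ℝ) 1) : Type := RingQuot (Rel ((q : ℝ) : ℂ))

namespace Oq

variable (q : Set.Ioo (0 : ℝ) 1)

instance : Ring (Oq q) := inferInstanceAs (Ring (RingQuot (Rel ((q : ℝ) : ℂ))))
instance : Algebra ℂ (Oq q) := inferInstanceAs (Algebra ℂ (RingQuot (Rel ((q : ℝ) : ℂ))))

/-- The generators `α, α^*, γ, γ^*` of `O_q(SU(2))`. -/
def gen (i : Gen) : Oq q := RingQuot.mkAlgHom ℂ (Rel ((q : ℝ) : ℂ)) (.ι ℂ i)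

lemma isSUq2_gen : IsSUq2 ((q : ℝ) : ℂ) (gen q) := by
  have h := fun {x y} (h : Rel ((q : ℝ) : ℂ) x y) => RingQuot.mkAlgHom_rel ℂ h
  constructor
  · have := h .rel1; simp only [map_mul, map_add, map_smul, map_one] at this; exact this
  · have := h .rel2; simp only [map_mul, map_add, map_smul, map_one] at this; exact this
  · have := h .rel3; simp only [map_mul, map_add, map_smul, map_one] at this; exact this
  · have := h .rel4; simp only [map_mul, map_add, map_smul, map_one] at this; exact this
  · have := h .rel5; simp only [map_mul, map_add, map_smul, map_one] at this; exact this
  · have := h .rel6; simp only [map_mul, map_add, map_smul, map_one] at this; exact this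
  · have := h .rel7; simp only [map_mul, map_add, map_smul, map_one] at this; exact this

variable {q} {B : Type*} [Ring B] [Algebra ℂ B]

lemma lift_rel {x : Gen → B} (hx : IsSUq2 ((q : ℝ) : ℂ) x) ⦃u v : FreeAlgebra ℂ Gen⦄
    (h : Rel ((q : ℝ) : ℂ) u v) : FreeAlgebra.lift ℂ x u = FreeAlgebra.lift ℂ x v := by
  cases h <;>
    simp only [map_mul, map_add, map_smul, map_one, FreeAlgebra.lift_ι_apply]
  · exact hx.rel1
  · exact hx.rel2
  · exact hx.rel3
  · exact hx.rel4
  · exact hx.rel5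
  · exact hx.rel6
  · exact hx.rel7

/-- The universal property of `O_q(SU(2))`. -/
def lift (x : Gen → B) (hx : IsSUq2 ((q : ℝ) : ℂ) x) : Oq q →ₐ[ℂ] B :=
  RingQuot.liftAlgHom ℂ ⟨FreeAlgebra.lift ℂ x, lift_rel hx⟩

@[simp] lemma lift_gen (x : Gen → B) (hx : IsSUq2 ((q : ℝ) : ℂ) x) (i : Gen) :
    lift x hx (gen q i) = x i := by
  have := RingQuot.liftAlgHom_mkAlgHom_apply ℂ (FreeAlgebra.lift ℂ x) (lift_rel hx) (.ι ℂ i)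
  rw [FreeAlgebra.lift_ι_apply] at this
  exact this

protected lemma induction {p : Oq q → Prop} (scalar : ∀ r : ℂ, p (algebraMap ℂ (Oq q) r))
    (gen : ∀ i, p (gen q i)) (mul : ∀ x y, p x → p y → p (x * y))
    (add : ∀ x y, p x → p y → p (x + y)) (x : Oq q) : p x := by
  obtain ⟨u, rfl⟩ := RingQuot.mkAlgHom_surjective ℂ (Rel ((q : ℝ) : ℂ)) x
  induction u using FreeAlgebra.induction with
  | grade0 r => rw [AlgHom.commutes]; exact scalar r
  | grade1 i => exact gen i
  | mul a b ha hb => rw [map_mul]; exact mul _ _ ha hb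
  | add a b ha hb => rw [map_add]; exact add _ _ ha hb

lemma hom_ext {f g : Oq q →ₐ[ℂ] B} (h : ∀ i, f (gen q i) = g (gen q i)) : f = g := by
  ext x
  refine Oq.induction (p := fun x => f x = g x) (fun r => ?_) h (fun x y hx hy => ?_)
    (fun x y hx hy => ?_) x
  · simp
  · simp [hx, hy]
  · simp [hx, hy]

lemma q_ne_zero (q : Set.Ioo (0 : ℝ) 1) : ((q : ℝ) : ℂ) ≠ 0 :=
  Complex.ofReal_ne_zero.2 q.2.1.ne'

variable (q)

/-- `Δ` on generators. -/
def comulGen : Gen → Oq q ⊗[ℂ] Oq q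
  | .al => gen q .al ⊗ₜ gen q .al - ((q : ℝ) : ℂ) • (gen q .gas ⊗ₜ gen q .ga)
  | .als => gen q .als ⊗ₜ gen q .als - ((q : ℝ) : ℂ) • (gen q .ga ⊗ₜ gen q .gas)
  | .ga => gen q .ga ⊗ₜ gen q .al + gen q .als ⊗ₜ gen q .ga
  | .gas => gen q .gas ⊗ₜ gen q .als + gen q .al ⊗ₜ gen q .gas

/-- `ε` on generators. -/
def counitGen : Gen → ℂ
  | .al => 1
  | .als => 1
  | .ga => 0
  | .gas => 0

/-- `S` on generators. -/
def antipodeGen : Gen → (Oq q)ᵐᵒᵖ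
  | .al => .op (gen q .als)
  | .als => .op (gen q .al)
  | .ga => .op (-((q : ℝ) : ℂ) • gen q .ga)
  | .gas => .op (-((q : ℝ) : ℂ)⁻¹ • gen q .gas)

/-- The opposite algebra with complex conjugate scalars, so that an algebra homomorphism to it is
a conjugate linear antihomomorphism. -/
def ConjOp : Type := (Oq q)ᵐᵒᵖ

instance : Ring (ConjOp q) := inferInstanceAs (Ring (Oq q)ᵐᵒᵖ)
instance : Algebra ℂ (ConjOp q) := Algebra.compHom (Oq q)ᵐᵒᵖ (starRingEnd ℂ)

/-- The involution on generators. -/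
def starGen : Gen → ConjOp q
  | .al => MulOpposite.op (gen q .als)
  | .als => MulOpposite.op (gen q .al)
  | .ga => MulOpposite.op (gen q .gas)
  | .gas => MulOpposite.op (gen q .ga)

lemma relα : gen q .als * gen q .al = 1 - gen q .ga * gen q .gas := by
  rw [← (isSUq2_gen q).rel1, (isSUq2_gen q).rel3]; abel

lemma relα' : gen q .al * gen q .als = 1 - ((q : ℝ) : ℂ) ^ 2 • (gen q .ga * gen q .gas) := by
  rw [← (isSUq2_gen q).rel2]; abel

lemma isSUq2_comul : IsSUq2 ((q : ℝ) : ℂ) (comulGen q) := by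
  have h := isSUq2_gen q
  constructor <;>
  · simp only [comulGen, mul_sub, sub_mul, mul_add, add_mul, smul_mul_assoc, mul_smul_comm,
      Algebra.TensorProduct.tmul_mul_tmul, relα, relα', h.rel3, h.rel4, h.rel5, h.rel6, h.rel7,
      TensorProduct.tmul_sub, TensorProduct.sub_tmul, TensorProduct.tmul_smul,
      ← TensorProduct.smul_tmul', Algebra.TensorProduct.one_def]
    module

lemma isSUq2_counit : IsSUq2 ((q : ℝ) : ℂ) counitGen := by
  constructor <;> simp [counitGen]

lemma isSUq2_antipode : IsSUq2 ((q : ℝ) : ℂ) (antipodeGen q) := by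
  have h := isSUq2_gen q
  have hq := q_ne_zero q
  constructor <;>
  · simp only [antipodeGen]
    apply MulOpposite.unop_injective
    simp only [MulOpposite.unop_add, MulOpposite.unop_mul, MulOpposite.unop_smul,
      MulOpposite.unop_op, MulOpposite.unop_one, smul_mul_assoc, mul_smul_comm, relα, relα',
      h.rel3, h.rel4, h.rel5, h.rel6, h.rel7]
    match_scalars <;> field_simp <;> ring

lemma conjOp_smul (r : ℂ) (x : ConjOp q) :
    (MulOpposite.unop (r • x : ConjOp q) : Oq q) = conj r • (MulOpposite.unop x : Oq q) := rfl

lemma isSUq2_star : IsSUq2 ((q : ℝ) : ℂ) (starGen q) := by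
  have h := isSUq2_gen q
  have e : conj (((q : ℝ) : ℂ)) = ((q : ℝ) : ℂ) := Complex.conj_ofReal _
  constructor <;> apply MulOpposite.unop_injective
  · exact h.rel1
  · change gen q .al * gen q .als + conj (((q : ℝ) : ℂ) ^ 2) • (gen q .ga * gen q .gas) = 1
    rw [map_pow, e, h.rel2]
  · exact h.rel3
  · change gen q .gas * gen q .als = conj (((q : ℝ) : ℂ)) • (gen q .als * gen q .gas)
    rw [e, h.rel6]
  · change gen q .ga * gen q .als = conj (((q : ℝ) : ℂ)) • (gen q .als * gen q .ga)
    rw [e, h.rel7]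
  · change gen q .al * gen q .ga = conj (((q : ℝ) : ℂ)) • (gen q .ga * gen q .al)
    rw [e, h.rel4]
  · change gen q .al * gen q .gas = conj (((q : ℝ) : ℂ)) • (gen q .gas * gen q .al)
    rw [e, h.rel5]

/-- The bialgebra structure of `O_q(SU(2))`. -/
instance : Bialgebra ℂ (Oq q) :=
  Bialgebra.ofAlgHom (lift (comulGen q) (isSUq2_comul q)) (lift counitGen (isSUq2_counit q))
    (by
      refine hom_ext fun i => ?_
      cases i <;>
      · simp [comulGen, TensorProduct.tmul_add, TensorProduct.add_tmul, TensorProduct.tmul_sub,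
          TensorProduct.sub_tmul, ← TensorProduct.smul_tmul', -Complex.coe_smul]
        module)
    (by
      refine hom_ext fun i => ?_
      cases i <;> simp [comulGen, counitGen, -Complex.coe_smul])
    (by
      refine hom_ext fun i => ?_
      cases i <;> simp [comulGen, counitGen, -Complex.coe_smul])

lemma comul_gen (i : Gen) : comul (R := ℂ) (gen q i) = comulGen q i :=
  lift_gen (comulGen q) (isSUq2_comul q) i

lemma counit_gen (i : Gen) : counit (R := ℂ) (gen q i) = counitGen i :=
  lift_gen counitGen (isSUq2_counit q) i

/-- The antipode, as an antihomomorphism. -/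
def antipodeHom : Oq q →ₐ[ℂ] (Oq q)ᵐᵒᵖ := lift (antipodeGen q) (isSUq2_antipode q)

/-- The antipode as a linear map. -/
def antipodeLin : Oq q →ₗ[ℂ] Oq q where
  toFun x := (antipodeHom q x).unop
  map_add' x y := by simp
  map_smul' r x := by simp

lemma antipodeLin_mul (x y : Oq q) :
    antipodeLin q (x * y) = antipodeLin q y * antipodeLin q x := by
  simp [antipodeLin]

lemma antipodeLin_scalar (r : ℂ) :
    antipodeLin q (algebraMap ℂ (Oq q) r) = algebraMap ℂ (Oq q) r := by
  simp [antipodeLin, -AlgHom.map_algebraMap, AlgHom.commutes]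

lemma antipodeLin_gen (i : Gen) : antipodeLin q (gen q i) = (antipodeGen q i).unop := by
  simp [antipodeLin, antipodeHom]

lemma antipode_left_aux (u : Oq q ⊗[ℂ] Oq q) (r : ℂ)
    (hu : LinearMap.mul' ℂ (Oq q) ((antipodeLin q).rTensor (Oq q) u) = algebraMap ℂ _ r)
    (v : Oq q ⊗[ℂ] Oq q) :
    LinearMap.mul' ℂ (Oq q) ((antipodeLin q).rTensor (Oq q) (u * v)) =
      r • LinearMap.mul' ℂ (Oq q) ((antipodeLin q).rTensor (Oq q) v) := by
  induction v using TensorProduct.induction_on with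
  | zero => simp
  | add v v' h h' => rw [mul_add, map_add, map_add, h, h', map_add, map_add, smul_add]
  | tmul c d =>
    have key : ∀ u : Oq q ⊗[ℂ] Oq q,
        LinearMap.mul' ℂ (Oq q) ((antipodeLin q).rTensor (Oq q) (u * c ⊗ₜ[ℂ] d)) =
        antipodeLin q c * LinearMap.mul' ℂ (Oq q) ((antipodeLin q).rTensor (Oq q) u) * d := by
      intro u
      induction u using TensorProduct.induction_on with
      | zero => simp
      | add u u' h h' => simp only [add_mul, map_add, h, h', mul_add]
      | tmul a b => simp [antipodeLin_mul, mul_assoc]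
    rw [key, hu, ← Algebra.commutes, mul_assoc, ← Algebra.smul_def]
    simp

lemma antipode_right_aux (v : Oq q ⊗[ℂ] Oq q) (r : ℂ)
    (hv : LinearMap.mul' ℂ (Oq q) ((antipodeLin q).lTensor (Oq q) v) = algebraMap ℂ _ r)
    (u : Oq q ⊗[ℂ] Oq q) :
    LinearMap.mul' ℂ (Oq q) ((antipodeLin q).lTensor (Oq q) (u * v)) =
      r • LinearMap.mul' ℂ (Oq q) ((antipodeLin q).lTensor (Oq q) u) := by
  induction u using TensorProduct.induction_on with
  | zero => simp
  | add v v' h h' => rw [add_mul, map_add, map_add, h, h', map_add, map_add, smul_add]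
  | tmul c d =>
    have key : ∀ u : Oq q ⊗[ℂ] Oq q,
        LinearMap.mul' ℂ (Oq q) ((antipodeLin q).lTensor (Oq q) (c ⊗ₜ[ℂ] d * u)) =
        c * LinearMap.mul' ℂ (Oq q) ((antipodeLin q).lTensor (Oq q) u) * antipodeLin q d := by
      intro u
      induction u using TensorProduct.induction_on with
      | zero => simp
      | add u u' h h' => simp only [add_mul, map_add, h, h', mul_add]
      | tmul a b => simp [antipodeLin_mul, mul_assoc]
    rw [key, hv, ← Algebra.commutes, mul_assoc, ← Algebra.smul_def]
    simp

/-- The Hopf algebra structure of `O_q(SU(2))`. -/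
instance : HopfAlgebra ℂ (Oq q) where
  antipode := antipodeLin q
  mul_antipode_rTensor_comul := by
    have h := isSUq2_gen q
    have hq := q_ne_zero q
    ext x
    refine Oq.induction (p := fun x => LinearMap.mul' ℂ (Oq q) ((antipodeLin q).rTensor (Oq q)
      (comul x)) = algebraMap ℂ (Oq q) (counit x)) (fun r => ?_) (fun i => ?_) (fun x y hx hy => ?_)
      (fun x y hx hy => ?_) x
    · simp [Algebra.TensorProduct.algebraMap_apply, antipodeLin_scalar]
    · rw [comul_gen, counit_gen]
      cases i <;>
      · simp only [comulGen, counitGen, map_add, map_sub, map_smul, LinearMap.rTensor_tmul,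
          LinearMap.mul'_apply, antipodeLin_gen, antipodeGen, MulOpposite.unop_op,
          smul_mul_assoc, map_one, map_zero, relα, relα', h.rel3, h.rel4, h.rel5, h.rel6, h.rel7]
        match_scalars <;> field_simp <;> ring
    · rw [Bialgebra.comul_mul, antipode_left_aux q _ _ hx, hy, Bialgebra.counit_mul, map_mul,
        Algebra.smul_def]
    · simp only [map_add, hx, hy]
  mul_antipode_lTensor_comul := by
    have h := isSUq2_gen q
    have hq := q_ne_zero q
    ext x
    refine Oq.induction (p := fun x => LinearMap.mul' ℂ (Oq q) ((antipodeLin q).lTensor (Oq q)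
      (comul x)) = algebraMap ℂ (Oq q) (counit x)) (fun r => ?_) (fun i => ?_) (fun x y hx hy => ?_)
      (fun x y hx hy => ?_) x
    · have h1 : antipodeLin q 1 = 1 := by simpa using antipodeLin_scalar q 1
      simp [Algebra.TensorProduct.algebraMap_apply, h1]
    · rw [comul_gen, counit_gen]
      cases i <;>
      · simp only [comulGen, counitGen, map_add, map_sub, map_smul, LinearMap.lTensor_tmul,
          LinearMap.mul'_apply, antipodeLin_gen, antipodeGen, MulOpposite.unop_op,
          mul_smul_comm, map_one, map_zero, relα, relα', h.rel3, h.rel4, h.rel5, h.rel6, h.rel7]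
        match_scalars <;> field_simp <;> ring
    · rw [Bialgebra.comul_mul, antipode_right_aux q _ _ hy, hx, Bialgebra.counit_mul, map_mul,
        Algebra.smul_def, Algebra.commutes]
    · simp only [map_add, hx, hy]

lemma antipode_def (x : Oq q) : antipode ℂ x = antipodeLin q x := rfl

/-- The involution, as a homomorphism to the conjugate opposite algebra. -/
def starHom : Oq q →ₐ[ℂ] ConjOp q := lift (starGen q) (isSUq2_star q)

instance : Star (Oq q) where
  star x := MulOpposite.unop (starHom q x : (Oq q)ᵐᵒᵖ)

lemma star_gen (i : Gen) : star (gen q i) = MulOpposite.unop (starGen q i : (Oq q)ᵐᵒᵖ) :=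
  congrArg MulOpposite.unop (lift_gen (starGen q) (isSUq2_star q) i)

protected lemma star_mul' (x y : Oq q) : star (x * y) = star y * star x :=
  congrArg MulOpposite.unop (map_mul (starHom q) x y)

protected lemma star_add' (x y : Oq q) : star (x + y) = star x + star y :=
  congrArg MulOpposite.unop (map_add (starHom q) x y)

protected lemma star_smul' (r : ℂ) (x : Oq q) : star (r • x) = conj r • star x :=
  congrArg MulOpposite.unop (map_smul (starHom q) r x)

protected lemma star_one' : star (1 : Oq q) = 1 :=
  congrArg MulOpposite.unop (map_one (starHom q))

protected lemma star_star' (x : Oq q) : star (star x) = x := by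
  refine Oq.induction (p := fun x => star (star x) = x) (fun r => ?_) (fun i => ?_)
    (fun x y hx hy => ?_) (fun x y hx hy => ?_) x
  · rw [Algebra.algebraMap_eq_smul_one, Oq.star_smul', Oq.star_smul', Oq.star_one',
      Oq.star_one', Complex.conj_conj]
  · cases i <;>
    · rw [star_gen]
      exact star_gen q _
  · rw [Oq.star_mul', Oq.star_mul', hx, hy]
  · rw [Oq.star_add', Oq.star_add', hx, hy]

instance : StarRing (Oq q) where
  star_involutive := Oq.star_star' q
  star_mul := Oq.star_mul' q
  star_add := Oq.star_add' q

instance : StarModule ℂ (Oq q) where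
  star_smul := Oq.star_smul' q

lemma star_al : star (gen q .al) = gen q .als := star_gen q _
lemma star_als : star (gen q .als) = gen q .al := star_gen q _
lemma star_ga : star (gen q .ga) = gen q .gas := star_gen q _
lemma star_gas : star (gen q .gas) = gen q .ga := star_gen q _

lemma map_antipode_comm_mul (u v : Oq q ⊗[ℂ] Oq q) :
    TensorProduct.map (antipode ℂ) (antipode ℂ) (TensorProduct.comm ℂ (Oq q) (Oq q) (u * v)) =
    TensorProduct.map (antipode ℂ) (antipode ℂ) (TensorProduct.comm ℂ (Oq q) (Oq q) v) *
    TensorProduct.map (antipode ℂ) (antipode ℂ) (TensorProduct.comm ℂ (Oq q) (Oq q) u) := by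
  induction u using TensorProduct.induction_on with
  | zero => simp
  | add u u' h h' => simp only [add_mul, mul_add, map_add, h, h']
  | tmul a b =>
    induction v using TensorProduct.induction_on with
    | zero => simp
    | add v v' h h' => simp only [add_mul, mul_add, map_add, h, h']
    | tmul c d => simp [antipode_mul_antidistrib]

/-- `O_q(SU(2))` is a Hopf `*`-algebra. -/
instance : HopfStarAlgebra (Oq q) where
  comul_star x := by
    have e : conj (((q : ℝ) : ℂ)) = ((q : ℝ) : ℂ) := Complex.conj_ofReal _
    refine Oq.induction (p := fun x => comul (R := ℂ) (star x) = star (comul (R := ℂ) x))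
      (fun r => ?_) (fun i => ?_) (fun x y hx hy => ?_) (fun x y hx hy => ?_) x
    · simp [Algebra.algebraMap_eq_smul_one]
    · cases i <;>
      · simp only [star_al, star_als, star_ga, star_gas, comul_gen, comulGen, star_add, star_sub,
          star_smul, TensorProduct.star_tmul, Complex.star_def, e]
    · simp [hx, hy]
    · simp [hx, hy]
  counit_star x := by
    refine Oq.induction (p := fun x => counit (R := ℂ) (star x) = conj (counit (R := ℂ) x))
      (fun r => ?_) (fun i => ?_) (fun x y hx hy => ?_) (fun x y hx hy => ?_) x
    · simp [Algebra.algebraMap_eq_smul_one]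
    · cases i <;> simp [star_al, star_als, star_ga, star_gas, counit_gen, counitGen]
    · simp [hx, hy, mul_comm]
    · simp [hx, hy]
  star_antipode x := by
    have hq := q_ne_zero q
    refine Oq.induction (p := fun x => star (antipode ℂ (star (antipode ℂ x))) = x)
      (fun r => ?_) (fun i => ?_) (fun x y hx hy => ?_) (fun x y hx hy => ?_) x
    · simp [Algebra.algebraMap_eq_smul_one]
    · cases i <;> simp [antipode_def, antipodeLin_gen, antipodeGen, star_al, star_als, star_ga,
        star_gas, smul_smul, hq, -Complex.coe_smul]
    · simp [hx, hy, antipode_mul_antidistrib]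
    · simp [hx, hy]
  comul_antipode x := by
    refine Oq.induction (p := fun x => comul (R := ℂ) (antipode ℂ x) =
      TensorProduct.map (antipode ℂ) (antipode ℂ)
        (TensorProduct.comm ℂ (Oq q) (Oq q) (comul (R := ℂ) x)))
      (fun r => ?_) (fun i => ?_) (fun x y hx hy => ?_) (fun x y hx hy => ?_) x
    · simp [Algebra.algebraMap_eq_smul_one, Algebra.TensorProduct.one_def]
    · have hq := q_ne_zero q
      cases i <;>
      · simp only [antipode_def, antipodeLin_gen, antipodeGen, MulOpposite.unop_op, map_smul,
          comul_gen, comulGen, map_add, map_sub, TensorProduct.comm_tmul, TensorProduct.map_tmul,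
          TensorProduct.tmul_smul, ← TensorProduct.smul_tmul']
        match_scalars <;> field_simp
    · rw [antipode_mul_antidistrib, Bialgebra.comul_mul, Bialgebra.comul_mul, hx, hy,
        map_antipode_comm_mul]
    · simp only [map_add, hx, hy]

end Oq

/-! ### The pairing with `U_q(su(2))` and the coideals -/

section Coideals

variable (q : Set.Ioo (0 : ℝ) 1)

/-- `[x] = (q^x - q^{-x}) / (q - q^{-1})`. -/
def qNum (x : ℝ) : ℝ := ((q : ℝ) ^ x - (q : ℝ) ^ (-x)) / ((q : ℝ) - (q : ℝ)⁻¹)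

/-- `⟦x⟧ = q^x - q^{-x}`. -/
def qBra (x : ℝ) : ℝ := (q : ℝ) ^ x - (q : ℝ) ^ (-x)

/-- The character of `O_q(SU(2))` given by the pairing with `k`. -/
def pairKGen : Gen → ℂ
  | .al => ((q : ℝ) : ℂ)
  | .als => ((q : ℝ) : ℂ)⁻¹
  | .ga => 0
  | .gas => 0

/-- The representation `x ↦ [[(x, k), (x, e)], [0, ε(x)]]` on generators; it encodes
`Δ(e) = e ⊗ 1 + k ⊗ e`. -/
def pairEGen : Gen → Matrix (Fin 2) (Fin 2) ℂ
  | .al => !![((q : ℝ) : ℂ), 0; 0, 1]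
  | .als => !![((q : ℝ) : ℂ)⁻¹, 0; 0, 1]
  | .ga => 0
  | .gas => !![0, -(((q : ℝ) ^ (-(1 / 2) : ℝ) : ℝ) : ℂ); 0, 0]

/-- The representation `x ↦ [[ε(x), (x, f)], [0, (x, k⁻¹)]]` on generators; it encodes
`Δ(f) = 1 ⊗ f + f ⊗ k⁻¹`. -/
def pairFGen : Gen → Matrix (Fin 2) (Fin 2) ℂ
  | .al => !![1, 0; 0, ((q : ℝ) : ℂ)⁻¹]
  | .als => !![1, 0; 0, ((q : ℝ) : ℂ)]
  | .ga => !![0, (((q : ℝ) ^ (-(1 / 2) : ℝ) : ℝ) : ℂ); 0, 0]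
  | .gas => 0

lemma isSUq2_pairK : IsSUq2 ((q : ℝ) : ℂ) (pairKGen q) := by
  have hq := Oq.q_ne_zero q
  constructor <;> simp [pairKGen, hq]

lemma isSUq2_pairE : IsSUq2 ((q : ℝ) : ℂ) (pairEGen q) := by
  have hq := Oq.q_ne_zero q
  constructor <;>
  · ext i j
    fin_cases i <;> fin_cases j <;> simp [pairEGen, hq, -Complex.coe_smul]

lemma isSUq2_pairF : IsSUq2 ((q : ℝ) : ℂ) (pairFGen q) := by
  have hq := Oq.q_ne_zero q
  constructor <;>
  · ext i j
    fin_cases i <;> fin_cases j <;> simp [pairFGen, hq, mul_comm, -Complex.coe_smul]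

/-- The entry `(i, j)` of a two by two matrix representation, as a functional. -/
def matCoeff (ρ : Oq q →ₐ[ℂ] Matrix (Fin 2) (Fin 2) ℂ) (i j : Fin 2) : FullDual (Oq q) :=
  WithConv.toConv
    { toFun := fun x => ρ x i j
      map_add' := fun x y => by simp
      map_smul' := fun r x => by simp }

/-- The functional `(·, k)` on `O_q(SU(2))`. -/
def pairK : FullDual (Oq q) := WithConv.toConv (Oq.lift (pairKGen q) (isSUq2_pairK q)).toLinearMap

/-- The functional `(·, e)` on `O_q(SU(2))`. -/
def pairE : FullDual (Oq q) := matCoeff q (Oq.lift (pairEGen q) (isSUq2_pairE q)) 0 1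

/-- The functional `(·, f)` on `O_q(SU(2))`. -/
def pairF : FullDual (Oq q) := matCoeff q (Oq.lift (pairFGen q) (isSUq2_pairF q)) 0 1

/-- The element `B_t = q^{-1/2} (e - f k) - i (q - q⁻¹)⁻¹ t k` of `U_q(su(2)) ⊆ Hom(O_q(SU(2)), ℂ)`,
for `t = ⟦a⟧`. -/
def elemB (a : ℝ) : FullDual (Oq q) :=
  (((q : ℝ) ^ (-(1 / 2) : ℝ) : ℝ) : ℂ) • (pairE q - pairF q * pairK q) -
    (Complex.I * (((q : ℝ) : ℂ) - ((q : ℝ) : ℂ)⁻¹)⁻¹ * ((qBra q a : ℝ) : ℂ)) • pairK q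

/-- `x ◁ ω = ω(x₍₁₎) x₍₂₎`. -/
def slice (ω : FullDual (Oq q)) : Oq q →ₗ[ℂ] Oq q :=
  (TensorProduct.lid ℂ (Oq q)).toLinearMap ∘ₗ ω.ofConv.rTensor (Oq q) ∘ₗ comul

/-- The Podleś sphere `O_q(S_t^2) = {x | x ◁ B_t = ε(B_t) x}`, for `t = ⟦a⟧`; the counit of
`U_q(su(2))` is evaluation at `1`. -/
def podles (a : ℝ) : Submodule ℂ (Oq q) :=
  LinearMap.eqLocus (slice q (elemB q a)) (elemB q a 1 • LinearMap.id)

/-- The algebra `𝓘 = Hom(A / A B₊, ℂ)`, where `A = O_q(SU(2))` and `B₊` is the kernel of the counit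
on `B = O_q(S_t^2)`. -/
def coidealI (a : ℝ) : Submodule ℂ (FullDual (Oq q)) where
  carrier := {ω | ∀ x, ∀ b ∈ podles q a, counit (R := ℂ) b = 0 → ω (x * b) = 0}
  zero_mem' := fun x b _ _ => rfl
  add_mem' := fun {ω θ} hω hθ x b hb h0 => by
    change ω (x * b) + θ (x * b) = 0
    rw [hω x b hb h0, hθ x b hb h0, add_zero]
  smul_mem' := fun r ω hω x b hb h0 => by
    change r • ω (x * b) = 0
    rw [hω x b hb h0, smul_zero]

/-- The block `𝔹(ℂ_n)` of `𝓘 ≅ ∏_n 𝔹(ℂ_n)`, on which `i B_t` acts as `[a + n]`. -/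
def block (a : ℝ) (n : ℤ) : Submodule ℂ (FullDual (Oq q)) :=
  coidealI q a ⊓ LinearMap.eqLocus (LinearMap.mulLeft ℂ (Complex.I • elemB q a))
    (((qNum q (a + n) : ℝ) : ℂ) • LinearMap.id)

/-- The algebra `𝓘_c = ⨁_n 𝔹(ℂ_n)`. -/
def coidealIc (a : ℝ) : Submodule ℂ (FullDual (Oq q)) := ⨆ n : ℤ, block q a n

/-- `p` is the unit `Φ_n` of the one dimensional block `𝔹(ℂ_n)`. -/
structure IsPhi (a : ℝ) (n : ℤ) (p : FullDual (Oq q)) : Prop where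
  mem : p ∈ block q a n
  idem : p * p = p
  ne_zero : p ≠ 0

/-- The elements `b ω` with `b ∈ O_q(S_t^2)` and `ω ∈ 𝓘_c`. -/
def ccGen (a : ℝ) : Set (Smash (Oq q)) :=
  {x | ∃ b ∈ podles q a, ∃ ω ∈ coidealIc q a, x = Smash.mk b ω}

/-- The convolution algebra `C_c(SL_q(2, ℝ)_t) = O_q(S_t^2) ⋈ 𝓘_c`: the `*`-subalgebra of
`O_q(SU(2)) ⋊ Hom(O_q(SU(2)), ℂ)` generated by the products `b ω`. -/
def Cc (a : ℝ) : NonUnitalStarSubalgebra ℂ (Smash (Oq q)) :=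
  NonUnitalStarAlgebra.adjoin ℂ (ccGen q a)

lemma one_mem_podles (a : ℝ) : (1 : Oq q) ∈ podles q a := by
  simp [podles, slice, Algebra.TensorProduct.one_def]

/-- `Φ_n` as an element of `C_c(SL_q(2, ℝ)_t)`. -/
def phiElt {a : ℝ} {n : ℤ} {p : FullDual (Oq q)} (hp : IsPhi q a n p) : Cc q a :=
  ⟨Smash.mk 1 p, NonUnitalStarAlgebra.subset_adjoin ℂ _
    ⟨1, one_mem_podles q a, p, (le_iSup (block q a) n) hp.mem, rfl⟩⟩

end Coideals

/-! ### Representations -/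

section Representations

universe u v w

variable {A : Type u} [NonUnitalRing A] [StarRing A] [Module ℂ A]

/-- A (topologically) irreducible `*`-representation by bounded operators on a Hilbert space. -/
structure IsIrreducibleRep {H : Type v} [NormedAddCommGroup H] [InnerProductSpace ℂ H]
    [CompleteSpace H] (π : A →⋆ₙₐ[ℂ] (H →L[ℂ] H)) : Prop where
  ne_zero : ∃ x, π x ≠ 0
  eq_bot_or_eq_top : ∀ K : Submodule ℂ H, IsClosed (K : Set H) →
    (∀ x, ∀ ξ ∈ K, π x ξ ∈ K) → K = ⊥ ∨ K = ⊤

/-- A C*-algebra is liminal if it acts by compact operators in every irreducible representation. -/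
def IsLiminal (𝔄 : Type u) [NonUnitalCStarAlgebra 𝔄] : Prop :=
  ∀ (H : Type v) [NormedAddCommGroup H] [InnerProductSpace ℂ H] [CompleteSpace H]
    (π : 𝔄 →⋆ₙₐ[ℂ] (H →L[ℂ] H)), IsIrreducibleRep π → ∀ x, IsCompactOperator (π x)

/-- The norms `‖π(f)‖` for the irreducible `*`-representations `π` of a `*`-algebra. -/
def irrepNorms (f : A) : Set ℝ :=
  {r | ∃ (H : Type) (_ : NormedAddCommGroup H) (_ : InnerProductSpace ℂ H) (_ : CompleteSpace H)
    (π : A →⋆ₙₐ[ℂ] (H →L[ℂ] H)), IsIrreducibleRep π ∧ r = ‖π f‖}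

/-- `‖f‖_u = sup ‖π(f)‖` over the irreducible `*`-representations `π`. -/
def uNorm (f : A) : ℝ := sSup (irrepNorms f)

/-- A C*-norm on a `*`-algebra. -/
structure IsCStarNorm (N : A → ℝ) : Prop where
  eq_zero_iff : ∀ f, N f = 0 ↔ f = 0
  add_le : ∀ f g, N (f + g) ≤ N f + N g
  smul : ∀ (r : ℂ) f, N (r • f) = ‖r‖ * N f
  mul_le : ∀ f g, N (f * g) ≤ N f * N g
  star_mul_self : ∀ f, N (star f * f) = N f ^ 2

/-- `ι : A → 𝔄` is a completion of the `*`-algebra `A` in the norm `N`. -/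
structure IsCStarCompletion {𝔄 : Type v} [NonUnitalCStarAlgebra 𝔄] (N : A → ℝ)
    (ι : A →⋆ₙₐ[ℂ] 𝔄) : Prop where
  norm_eq : ∀ f, ‖ι f‖ = N f
  dense : DenseRange ι

end Representations

end QSL2

end

noncomputable section

namespace QSL2

/-! ### The basic module -/

section BasicModule

variable (q : Set.Ioo (0 : ℝ) 1) (a : ℝ)

/-! Write A for `Oq q` and B for the Podleś sphere. The module M with basis c_n plays the role of A
/ A B₊, with c_0 the class of 1. The generators of A move c_n to c_{n+1} and c_{n-1}, the c_n are
group-like, and Φ_n(x) is the coefficient of c_n in x c_0. On M the functional i B_t becomes the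
weight [a+n], so i B_t = Σ [a+n] Φ_n pointwise (`basicWt_basicRep`).

Moving c_l to c_k through the first leg of Δ grades A from the left; the second leg grades it from
the right. The numbers [a+n] are distinct, so B is exactly the part of left degree (0, 0)
(`podles_eq`). Every left degree contains a frame, a finite family y_i with Σ y_i y_i^* a positive
scalar C. Frames make the blocks one-dimensional (`block_eq`). For frames of degree (0, 0) the
elements h_i = y_i^* Φ_n also satisfy Σ h_i^* h_i = C Φ_n, which bounds their norm in every bounded
representation independently of the representation (`span_dominated`,
`IsCornerSystem.exists_norm_le`). Hence ‖·‖_u is finite.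

Elements homogeneous on both sides are built from four kinds of steps, and a step followed by its
reverse is affine in a Casimir element Ω. Paths in this grid can be straightened
(`gridStep_mul_gridElt`), so B is spanned by elements T_i p(Ω), with T_i a path from (0, n) to (0,
n+2i). Consequently Φ_n C_c Φ_n lies in ℂ[Ω]Φ_n and is commutative. Moreover (T_i Φ_n)^* T_i Φ_n =
p_i(Ω) Φ_n with p_i > 0 on (-2q, 2q). Evaluating Ω at a point of that interval therefore gives a
positive functional that is a character of the corner. Its GNS representation is irreducible, and
these representations separate points because a nonzero polynomial has only finitely many roots
(`exists_state`). So ‖·‖_u is a norm.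

The rest is formal and is carried out for `IsCornerSystem`. In an irreducible representation a
commutative corner acts by scalars, so Φ_n becomes a projection of rank at most one. Every f is a
finite sum of the f Φ_n, hence acts by a compact operator, and compactness passes to the completion
by continuity. -/

/-- The point `q^{a+n}`, as a complex number. -/
def pt (n : ℤ) : ℂ := (((q : ℝ) ^ (a + n) : ℝ) : ℂ)

/-- The vector space with basis `c_n`, `n ∈ ℤ`. -/
abbrev BasicModule : Type := ℤ →₀ ℂ

/-- The basis vector `c_n`. -/
abbrev cvec (n : ℤ) : BasicModule := Finsupp.single n 1

lemma pt_eq (n : ℤ) : ∃ x : ℝ, 0 < x ∧ pt q a n = x :=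
  ⟨_, Real.rpow_pos_of_pos q.2.1 _, rfl⟩

lemma pt_ne_zero (n : ℤ) : pt q a n ≠ 0 := by
  obtain ⟨x, hx, h⟩ := pt_eq q a n
  rw [h]; exact_mod_cast hx.ne'

lemma pt_add_one (n : ℤ) : pt q a (n + 1) = ((q : ℝ) : ℂ) * pt q a n := by
  rw [pt, pt, ← Complex.ofReal_mul]
  congr 1
  push_cast
  rw [← add_assoc, Real.rpow_add q.2.1, Real.rpow_one, mul_comm]

lemma pt_sub_one (n : ℤ) : pt q a (n - 1) = ((q : ℝ) : ℂ)⁻¹ * pt q a n := by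
  have := pt_add_one q a (n - 1)
  rw [sub_add_cancel] at this
  rw [this, inv_mul_cancel_left₀ (Oq.q_ne_zero q)]

lemma ofReal_sq_add_one_ne_zero (x : ℝ) : ((x : ℂ) ^ 2 + 1) ≠ 0 := by
  have : x ^ 2 + 1 ≠ 0 := by positivity
  exact_mod_cast this

lemma pt_sq_add_one_ne_zero (n : ℤ) : pt q a n ^ 2 + 1 ≠ 0 := by
  obtain ⟨x, hx, h⟩ := pt_eq q a n
  rw [h]; exact ofReal_sq_add_one_ne_zero x

lemma q_sq_mul_pt_sq_add_one_ne_zero (n : ℤ) :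
    ((q : ℝ) : ℂ) ^ 2 * pt q a n ^ 2 + 1 ≠ 0 := by
  have := pt_sq_add_one_ne_zero q a (n + 1)
  rwa [pt_add_one, mul_pow] at this

lemma pt_sq_add_q_sq_ne_zero (n : ℤ) :
    pt q a n ^ 2 + ((q : ℝ) : ℂ) ^ 2 ≠ 0 := by
  have h := pt_sq_add_one_ne_zero q a (n - 1)
  have hq := Oq.q_ne_zero q
  rw [pt_sub_one, mul_pow] at h
  contrapose! h
  field_simp
  rw [h, mul_zero]

/-- The images of the basis vectors under the generators. -/
def basicGen (n : ℤ) : Gen → BasicModule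
  | .al => (pt q a n ^ 2 + 1)⁻¹ • (pt q a n ^ 2 • cvec (n + 1) + cvec (n - 1))
  | .als => (pt q a n ^ 2 + 1)⁻¹ • (cvec (n + 1) + pt q a n ^ 2 • cvec (n - 1))
  | .ga => (-Complex.I * pt q a n * (pt q a n ^ 2 + 1)⁻¹) • (cvec (n + 1) - cvec (n - 1))
  | .gas => (-Complex.I * pt q a n * (pt q a n ^ 2 + 1)⁻¹ * ((q : ℝ) : ℂ)⁻¹) •
      (cvec (n + 1) - cvec (n - 1))

/-- The action of the generators. -/
def basicOp (i : Gen) : Module.End ℂ BasicModule :=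
  Finsupp.linearCombination ℂ (fun n => basicGen q a n i)

lemma basicOp_cvec (i : Gen) (n : ℤ) : basicOp q a i (cvec n) = basicGen q a n i := by
  simp [basicOp]

/-- Each relation is checked on c_n, where it becomes an identity between rational functions of X =
q^{a+n}. The denominators X²+1, q²X²+1 and X²+q² do not vanish because X is real. -/
lemma isSUq2_basicOp : IsSUq2 ((q : ℝ) : ℂ) (basicOp q a) := by
  have hq := Oq.q_ne_zero q
  have hI : Complex.I ^ 2 = -1 := Complex.I_sq
  constructor <;>
  · refine Finsupp.lhom_ext' fun n => LinearMap.ext_ring ?_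
    have h1 := pt_sq_add_one_ne_zero q a n
    have h2 := q_sq_mul_pt_sq_add_one_ne_zero q a n
    have h3 := pt_sq_add_q_sq_ne_zero q a n
    have e1 : n + 1 - 1 = n := by ring
    have e2 : n - 1 + 1 = n := by ring
    have h3' : ((q : ℝ) : ℂ)⁻¹ ^ 2 * pt q a n ^ 2 + 1 ≠ 0 := by
      field_simp; exact div_ne_zero h3 (pow_ne_zero 2 hq)
    have h2' : pt q a n ^ 2 * ((q : ℝ) : ℂ) ^ 2 + 1 ≠ 0 := by rwa [mul_comm]
    simp only [LinearMap.comp_apply, Finsupp.lsingle_apply, Module.End.mul_apply,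
      LinearMap.add_apply, LinearMap.smul_apply, Module.End.one_apply, basicOp_cvec, basicGen,
      map_add, map_sub, map_smul, pt_add_one, pt_sub_one, e1, e2, mul_pow]
    match_scalars <;> field_simp <;> (try simp only [hI]) <;> ring

/-- The action of `O_q(SU(2))` on the basic module. -/
def basicRep : Oq q →ₐ[ℂ] Module.End ℂ BasicModule := Oq.lift (basicOp q a) (isSUq2_basicOp q a)

lemma basicRep_gen (i : Gen) (n : ℤ) : basicRep q a (Oq.gen q i) (cvec n) = basicGen q a n i := by
  rw [basicRep, Oq.lift_gen, basicOp_cvec]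

end BasicModule

/-! ### The functional i B_t as the weight on the basic module. -/

section Pairing

variable (q : Set.Ioo (0 : ℝ) 1) (a : ℝ)

/-- The number `[a+n]`, expressed through `q^{a+n}`. -/
def wt (n : ℤ) : ℂ := (pt q a n - (pt q a n)⁻¹) / (((q : ℝ) : ℂ) - ((q : ℝ) : ℂ)⁻¹)

lemma qNum_eq_wt (n : ℤ) : ((qNum q (a + n) : ℝ) : ℂ) = wt q a n := by
  rw [qNum, wt, pt, Real.rpow_neg q.2.1.le]
  push_cast
  rfl

lemma q_sq_sub_one_ne_zero : ((q : ℝ) : ℂ) ^ 2 - 1 ≠ 0 := by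
  have h1 := q.2.1
  have h2 := q.2.2
  have : (q : ℝ) ^ 2 - 1 ≠ 0 := by nlinarith
  exact_mod_cast this

/-- The function x ↦ q^x - q^{-x} is strictly monotone. Distinctness of the weights is what
separates the blocks and the graded components. -/
lemma wt_injective : Function.Injective (wt q a) := by
  have hq : (q : ℝ) - (q : ℝ)⁻¹ < 0 := by
    have := (one_lt_inv₀ q.2.1).2 q.2.2
    linarith [q.2.2]
  have key : StrictAnti fun n : ℤ =>
      (q : ℝ) ^ (a + n) - ((q : ℝ) ^ (a + n))⁻¹ := by
    intro m n hmn
    have h1 : (q : ℝ) ^ (a + n) < (q : ℝ) ^ (a + m) :=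
      Real.rpow_lt_rpow_of_exponent_gt q.2.1 q.2.2 (by simpa using hmn)
    have h2 := inv_strictAnti₀ (Real.rpow_pos_of_pos q.2.1 (a + n)) h1
    simp only
    linarith
  intro m n h
  rw [wt, wt, div_left_inj' (by exact_mod_cast hq.ne)] at h
  simp only [pt] at h
  exact key.injective (by exact_mod_cast h)

/-- The functional taking the value `1` on all basis vectors. -/
def basicSum : BasicModule →ₗ[ℂ] ℂ := Finsupp.linearCombination ℂ (fun _ => (1 : ℂ))

lemma basicSum_cvec (n : ℤ) : basicSum (cvec n) = 1 := by simp [basicSum]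

/-- This sum is the counit of M when the c_n are taken group-like; M is a module coalgebra. -/
lemma basicSum_basicRep (x : Oq q) (m : BasicModule) :
    basicSum (basicRep q a x m) = counit (R := ℂ) x * basicSum m := by
  refine Oq.induction (p := fun x => ∀ m, basicSum (basicRep q a x m) =
    counit (R := ℂ) x * basicSum m) (fun r m => ?_) (fun i m => ?_) (fun x y hx hy m => ?_)
    (fun x y hx hy m => ?_) x m
  · simp [Algebra.algebraMap_eq_smul_one]
  · rw [Oq.counit_gen]
    revert m
    refine fun m => LinearMap.congr_fun (f := basicSum ∘ₗ basicRep q a (Oq.gen q i))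
      (g := Oq.counitGen i • basicSum) (Finsupp.lhom_ext' fun n => LinearMap.ext_ring ?_) m
    have h := pt_sq_add_one_ne_zero q a n
    cases i <;>
    · simp only [LinearMap.comp_apply, Finsupp.lsingle_apply, basicRep_gen, basicGen, map_smul,
        map_add, map_sub, basicSum_cvec, LinearMap.smul_apply, Oq.counitGen, smul_eq_mul]
      field_simp
      try ring
  · rw [map_mul, Module.End.mul_apply, hx, hy, Bialgebra.counit_mul, mul_assoc]
  · rw [map_add, LinearMap.add_apply, map_add, hx, hy, map_add, add_mul]

/-- The functional taking the value `[a+n]` on `c_n`. -/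
def basicWt : BasicModule →ₗ[ℂ] ℂ := Finsupp.linearCombination ℂ (wt q a)

lemma basicWt_cvec (n : ℤ) : basicWt q a (cvec n) = wt q a n := by simp [basicWt]

/-- The representation with upper right entry `(·, e)`. -/
def repE : Oq q →ₐ[ℂ] Matrix (Fin 2) (Fin 2) ℂ := Oq.lift (pairEGen q) (isSUq2_pairE q)

/-- The character `(·, k)`. -/
def charK : Oq q →ₐ[ℂ] ℂ := Oq.lift (pairKGen q) (isSUq2_pairK q)

/-- The character `(·, k)`, with values in scalar matrices. -/
def scalarK : Oq q →ₐ[ℂ] Matrix (Fin 2) (Fin 2) ℂ :=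
  (Algebra.ofId ℂ (Matrix (Fin 2) (Fin 2) ℂ)).comp (charK q)

lemma commute_scalarK (M : Matrix (Fin 2) (Fin 2) ℂ) (y : Oq q) : Commute M (scalarK q y) :=
  Algebra.commute_algebraMap_right (charK q y) M

/-- The representation with upper right entry `(·, f k)`. -/
def repFK : Oq q →ₐ[ℂ] Matrix (Fin 2) (Fin 2) ℂ :=
  (Algebra.TensorProduct.lift (Oq.lift (pairFGen q) (isSUq2_pairF q))
    (scalarK q) (fun _ y => commute_scalarK q _ y)).comp (Bialgebra.comulAlgHom ℂ (Oq q))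

lemma repFK_gen (i : Gen) : repFK q (Oq.gen q i) =
    match i with
    | .al => !![((q : ℝ) : ℂ), 0; 0, 1]
    | .als => !![((q : ℝ) : ℂ)⁻¹, 0; 0, 1]
    | .ga => !![0, (((q : ℝ) ^ (-(1 / 2) : ℝ) : ℝ) : ℂ) * ((q : ℝ) : ℂ); 0, 0]
    | .gas => 0 := by
  have hq := Oq.q_ne_zero q
  rw [repFK, AlgHom.comp_apply, Bialgebra.comulAlgHom_apply, Oq.comul_gen]
  cases i <;>
  · simp only [Oq.comulGen, map_add, map_sub, map_smul, Algebra.TensorProduct.lift_tmul,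
      AlgHom.comp_apply, scalarK, charK, Oq.lift_gen, pairKGen, pairFGen, Algebra.ofId_apply, map_zero,
      mul_zero, smul_zero, sub_zero, add_zero, zero_mul]
    try
      ext i j
      fin_cases i <;> fin_cases j <;> simp [Matrix.algebraMap_eq_diagonal, hq]

lemma repFK_apply_zero_one (x : Oq q) : repFK q x 0 1 = (pairF q * pairK q) x := by
  rw [(ℛ ℂ x).convMul_apply, repFK, AlgHom.comp_apply, Bialgebra.comulAlgHom_apply,
    ← (ℛ ℂ x).eq, map_sum, Matrix.sum_apply]
  refine Finset.sum_congr rfl fun i _ => ?_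
  rw [Algebra.TensorProduct.lift_tmul, scalarK, AlgHom.comp_apply, Algebra.ofId_apply, ← Algebra.commutes,
    ← Algebra.smul_def, Matrix.smul_apply, smul_eq_mul, mul_comm]
  rfl

lemma triangular_of_gen (ρ : Oq q →ₐ[ℂ] Matrix (Fin 2) (Fin 2) ℂ)
    (h00 : ∀ i, ρ (Oq.gen q i) 0 0 = charK q (Oq.gen q i)) (h10 : ∀ i, ρ (Oq.gen q i) 1 0 = 0)
    (h11 : ∀ i, ρ (Oq.gen q i) 1 1 = counit (R := ℂ) (Oq.gen q i)) (x : Oq q) :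
    ρ x 0 0 = charK q x ∧ ρ x 1 0 = 0 ∧ ρ x 1 1 = counit (R := ℂ) x := by
  refine Oq.induction (p := fun x => ρ x 0 0 = charK q x ∧ ρ x 1 0 = 0 ∧
    ρ x 1 1 = counit (R := ℂ) x) (fun r => ?_) (fun i => ⟨h00 i, h10 i, h11 i⟩)
    (fun x y hx hy => ?_) (fun x y hx hy => ?_) x
  · simp [Algebra.algebraMap_eq_smul_one]
  · simp [Matrix.mul_apply, Fin.sum_univ_two, hx, hy]
  · simp [hx, hy]

lemma repE_triangular (x : Oq q) : repE q x 0 0 = charK q x ∧ repE q x 1 0 = 0 ∧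
    repE q x 1 1 = counit (R := ℂ) x := by
  refine triangular_of_gen q _ (fun i => ?_) (fun i => ?_) (fun i => ?_) x <;>
  · simp only [repE, charK, Oq.lift_gen, Oq.counit_gen]
    cases i <;> simp [pairEGen, pairKGen, Oq.counitGen]

/-- The diagonal (k, ε) is the same as for e. Thus e and f k obey the same rule Δ(y) = y ⊗ 1 + k ⊗
y, and so does their difference. -/
lemma repFK_triangular (x : Oq q) : repFK q x 0 0 = charK q x ∧ repFK q x 1 0 = 0 ∧
    repFK q x 1 1 = counit (R := ℂ) x := by
  refine triangular_of_gen q _ (fun i => ?_) (fun i => ?_) (fun i => ?_) x <;>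
  · simp only [repFK_gen, charK, Oq.lift_gen, Oq.counit_gen]
    cases i <;> simp [pairKGen, Oq.counitGen]

lemma elemB_eq (x : Oq q) : elemB q a x =
    (((q : ℝ) ^ (-(1 / 2) : ℝ) : ℝ) : ℂ) * (repE q x 0 1 - repFK q x 0 1) -
    (Complex.I * (((q : ℝ) : ℂ) - ((q : ℝ) : ℂ)⁻¹)⁻¹ * ((qBra q a : ℝ) : ℂ)) * charK q x := by
  rw [repFK_apply_zero_one]
  rfl

lemma I_mul_elemB_one : Complex.I * elemB q a 1 = wt q a 0 := by
  rw [elemB_eq, wt, pt, qBra, Real.rpow_neg q.2.1.le a]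
  simp only [map_one, Matrix.one_apply, Int.cast_zero, add_zero]
  push_cast
  simp
  ring_nf
  simp
  ring

/-- For b = i B_t this is Δ(b) = b ⊗ 1 + k ⊗ (b - ε(b)), with ε(b) = [a] the weight of c_0. -/
lemma I_mul_elemB_mul (x y : Oq q) : Complex.I * elemB q a (x * y) =
    Complex.I * elemB q a x * counit (R := ℂ) y +
      charK q x * (Complex.I * elemB q a y - wt q a 0 * counit (R := ℂ) y) := by
  rw [← I_mul_elemB_one]
  simp only [elemB_eq, map_mul, Matrix.mul_apply, Fin.sum_univ_two, (repE_triangular q x).1,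
    (repE_triangular q y).2.2, (repFK_triangular q x).1, (repFK_triangular q y).2.2, map_one,
    Matrix.one_apply]
  simp
  ring

/-- For m = c_0 the second term vanishes, and the weight of x c_0 is the value of i B_t at x. A
general m is needed for the induction on products in x. -/
lemma basicWt_basicRep (x : Oq q) (m : BasicModule) :
    basicWt q a (basicRep q a x m) = Complex.I * elemB q a x * basicSum m +
      charK q x * (basicWt q a m - wt q a 0 * basicSum m) := by
  refine Oq.induction (p := fun x => ∀ m, basicWt q a (basicRep q a x m) =
    Complex.I * elemB q a x * basicSum m + charK q x * (basicWt q a m - wt q a 0 * basicSum m))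
    (fun r m => ?_) (fun i m => ?_) (fun x y hx hy m => ?_) (fun x y hx hy m => ?_) x m
  · have h : elemB q a (r • (1 : Oq q)) = r * elemB q a 1 := map_smul (elemB q a).ofConv r 1
    rw [Algebra.algebraMap_eq_smul_one, h, mul_left_comm, I_mul_elemB_one]
    simp
    ring
  · refine LinearMap.congr_fun (f := basicWt q a ∘ₗ basicRep q a (Oq.gen q i))
      (g := (Complex.I * elemB q a (Oq.gen q i)) • basicSum +
        (charK q (Oq.gen q i)) • (basicWt q a - wt q a 0 • basicSum))
      (Finsupp.lhom_ext' fun n => LinearMap.ext_ring ?_) m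
    have hq := Oq.q_ne_zero q
    have hq' := q_sq_sub_one_ne_zero q
    have h := pt_sq_add_one_ne_zero q a n
    have hn := pt_ne_zero q a n
    have h0 := pt_ne_zero q a 0
    have hs : (((q : ℝ) ^ (-(1 / 2) : ℝ) : ℝ) : ℂ) * (((q : ℝ) ^ (-(1 / 2) : ℝ) : ℝ) : ℂ) =
        ((q : ℝ) : ℂ)⁻¹ := by
      rw [← Complex.ofReal_mul, ← Real.rpow_add q.2.1, ← Complex.ofReal_inv]
      norm_num [Real.rpow_neg_one]
    have ht : ((qBra q a : ℝ) : ℂ) = pt q a 0 - (pt q a 0)⁻¹ := by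
      rw [qBra, pt, Real.rpow_neg q.2.1.le]
      push_cast
      simp
    have hI : Complex.I ^ 2 = -1 := Complex.I_sq
    have hd : ((q : ℝ) : ℂ) - ((q : ℝ) : ℂ)⁻¹ ≠ 0 := by
      field_simp
      exact div_ne_zero hq' hq
    cases i <;>
    · simp only [LinearMap.comp_apply, Finsupp.lsingle_apply, basicRep_gen, basicGen, map_smul,
        map_add, map_sub, basicSum_cvec, basicWt_cvec, LinearMap.smul_apply, LinearMap.add_apply,
        LinearMap.sub_apply, smul_eq_mul, elemB_eq, repE, repFK_gen, charK, Oq.lift_gen, pairEGen,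
        pairKGen, wt, pt_add_one, pt_sub_one, ht, Matrix.of_apply, Matrix.cons_val', Matrix.cons_val_zero,
        Matrix.cons_val_one, Matrix.zero_apply, sub_zero, zero_sub, mul_neg, neg_neg, mul_zero, ← mul_assoc,
        hs, Matrix.cons_val_fin_one, zero_mul]
      field_simp
      try simp only [hI]
      try ring
  · rw [map_mul, Module.End.mul_apply, hx, hy, basicSum_basicRep, I_mul_elemB_mul, map_mul]
    ring
  · rw [map_add, LinearMap.add_apply, map_add, hx, hy, map_add, map_add]
    ring

end Pairing

/-! ### The orthogonal self-adjoint idempotents Φ_n. -/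

section Functionals

variable (q : Set.Ioo (0 : ℝ) 1) (a : ℝ)

/-- The matrix coefficient `x ↦ ⟨c_m, x c_n⟩` of the basic module. -/
def basicCoeff (m n : ℤ) : FullDual (Oq q) :=
  WithConv.toConv (Finsupp.lapply m ∘ₗ (basicRep q a).toLinearMap.flip (cvec n))

lemma basicCoeff_apply (m n : ℤ) (x : Oq q) :
    basicCoeff q a m n x = basicRep q a x (cvec n) m := rfl

/-- The functional `Φ_n`. -/
def phi (n : ℤ) : FullDual (Oq q) := basicCoeff q a n 0

lemma phi_apply (n : ℤ) (x : Oq q) : phi q a n x = basicRep q a x (cvec 0) n := rfl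

lemma sum_phi_smul (x : Oq q) :
    ∑ k ∈ (basicRep q a x (cvec 0)).support, phi q a k x • cvec k = basicRep q a x (cvec 0) := by
  conv_rhs => rw [← Finsupp.sum_single (basicRep q a x (cvec 0))]
  simp [Finsupp.sum, phi_apply]

/-- The action of `End M ⊗ End N` on `M ⊗ N`. -/
def endTensor (M N : Type*) [AddCommGroup M] [AddCommGroup N] [Module ℂ M] [Module ℂ N] :
    Module.End ℂ M ⊗[ℂ] Module.End ℂ N →ₐ[ℂ] Module.End ℂ (M ⊗[ℂ] N) :=
  Module.endTensorEndAlgHom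

lemma endTensor_tmul {M N : Type*} [AddCommGroup M] [AddCommGroup N] [Module ℂ M] [Module ℂ N]
    (f : Module.End ℂ M) (g : Module.End ℂ N) (m : M) (n : N) :
    endTensor M N (f ⊗ₜ[ℂ] g) (m ⊗ₜ[ℂ] n) = f m ⊗ₜ[ℂ] g n := rfl

/-- The action on the tensor square of the basic module. -/
def basicSqRep : Oq q →ₐ[ℂ] Module.End ℂ (BasicModule ⊗[ℂ] BasicModule) :=
  (endTensor BasicModule BasicModule).comp
    ((Algebra.TensorProduct.map (basicRep q a) (basicRep q a)).comp
      (Bialgebra.comulAlgHom ℂ (Oq q)))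

/-- The comultiplication `c_n ↦ c_n ⊗ c_n`. -/
def basicComul : BasicModule →ₗ[ℂ] BasicModule ⊗[ℂ] BasicModule :=
  Finsupp.linearCombination ℂ (fun n => cvec n ⊗ₜ[ℂ] cvec n)

lemma basicComul_cvec (n : ℤ) : basicComul (cvec n) = cvec n ⊗ₜ[ℂ] cvec n := by
  simp [basicComul]

lemma basicSqRep_tmul (x : Oq q) {ι : Type*} (r : Coalgebra.Repr ℂ x ι) (m m' : BasicModule) :
    basicSqRep q a x (m ⊗ₜ[ℂ] m') =
      ∑ i ∈ r.index, basicRep q a (r.left i) m ⊗ₜ[ℂ] basicRep q a (r.right i) m' := by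
  simp [basicSqRep, ← r.eq, LinearMap.sum_apply, endTensor_tmul]

/-- The coproduct c_n ↦ c_n ⊗ c_n is A-linear, so M is a module coalgebra. Products of the Φ_n can
then be computed from it. -/
lemma basicSqRep_comul (x : Oq q) (m : BasicModule) :
    basicSqRep q a x (basicComul m) = basicComul (basicRep q a x m) := by
  refine Oq.induction (p := fun x => ∀ m, basicSqRep q a x (basicComul m) =
    basicComul (basicRep q a x m)) (fun r m => ?_) (fun i m => ?_) (fun x y hx hy m => ?_)
    (fun x y hx hy m => ?_) x m
  · rw [AlgHom.commutes, AlgHom.commutes, Module.algebraMap_end_apply,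
      Module.algebraMap_end_apply, map_smul]
  · refine LinearMap.congr_fun (f := basicSqRep q a (Oq.gen q i) ∘ₗ basicComul)
      (g := basicComul ∘ₗ basicRep q a (Oq.gen q i))
      (Finsupp.lhom_ext' fun n => LinearMap.ext_ring ?_) m
    have hq := Oq.q_ne_zero q
    have h := pt_sq_add_one_ne_zero q a n
    have hI : Complex.I ^ 2 = -1 := Complex.I_sq
    simp only [LinearMap.comp_apply, Finsupp.lsingle_apply, basicComul_cvec, basicRep_gen]
    rw [basicSqRep, AlgHom.comp_apply, AlgHom.comp_apply, Bialgebra.comulAlgHom_apply,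
      Oq.comul_gen]
    cases i <;>
    · simp only [Oq.comulGen, sub_eq_add_neg, ← neg_smul]
      simp only [map_add, map_sub, map_smul, Algebra.TensorProduct.map_tmul,
        endTensor_tmul, LinearMap.add_apply, LinearMap.sub_apply,
        LinearMap.smul_apply, basicRep_gen, basicGen,
        basicComul_cvec, TensorProduct.tmul_smul, ← TensorProduct.smul_tmul',
        TensorProduct.tmul_add, TensorProduct.add_tmul, TensorProduct.tmul_sub,
        TensorProduct.sub_tmul, TensorProduct.tmul_neg, TensorProduct.neg_tmul, map_neg, smul_neg]
      match_scalars <;> field_simp <;> (try simp only [hI]) <;> ring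
  · rw [map_mul, Module.End.mul_apply, hy, hx, map_mul, Module.End.mul_apply]
  · rw [map_add, LinearMap.add_apply, hx, hy, map_add, LinearMap.add_apply, map_add]

/-- `(⟨c_k, · c_m⟩ ◁ c) Φ_n = ⟨c_k, c c_n⟩ Φ_n`, where `m = 0`. -/
lemma dualAct_phi_mul_phi (c : Oq q) (m n : ℤ) :
    dualAct c (phi q a m) * phi q a n = basicCoeff q a m n c • phi q a n := by
  ext x
  -- Both sides of A-linearity of the coproduct at c_0 are paired with u ⊗ v ↦ ⟨c_m, c u⟩ ⟨c_n, v⟩.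
  -- On the group-like side only the term with c_n survives.
  have key := congrArg (TensorProduct.lift (LinearMap.mk₂ ℂ
      (fun u v : BasicModule => basicRep q a c u m * v n)
      (fun u u' v => by simp [add_mul]) (fun r u v => by simp [mul_assoc])
      (fun u v v' => by simp [mul_add]) (fun r u v => by simp; ring)))
    (basicSqRep_comul q a x (cvec 0))
  rw [basicComul_cvec, basicSqRep_tmul q a x (ℛ ℂ x), ← sum_phi_smul q a x] at key
  simp only [map_sum, map_smul, basicComul_cvec, TensorProduct.lift.tmul, LinearMap.mk₂_apply] at key
  rw [(ℛ ℂ x).convMul_apply]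
  simp only [dualAct_apply, phi_apply, map_mul, Module.End.mul_apply]
  refine key.trans ?_
  change _ = basicCoeff q a m n c * phi q a n x
  simp only [Finsupp.single_apply, smul_eq_mul, mul_ite, mul_one, mul_zero]
  rw [Finset.sum_ite_eq']
  split_ifs with h
  · rw [mul_comm, basicCoeff_apply]
  · rw [Finsupp.notMem_support_iff] at h
    rw [phi_apply, h, mul_zero]

lemma basicCoeff_one (m n : ℤ) : basicCoeff q a m n 1 = if m = n then 1 else 0 := by
  rw [basicCoeff_apply, map_one, Module.End.one_apply, Finsupp.single_apply]
  simp [eq_comm]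

lemma phi_mul_phi (m n : ℤ) : phi q a m * phi q a n = if m = n then phi q a n else 0 := by
  have := dualAct_phi_mul_phi q a 1 m n
  rw [dualAct_one, basicCoeff_one] at this
  rw [this]
  split_ifs <;> simp

/-- The complex conjugation fixing the basis vectors. -/
def basicConj : BasicModule →ₛₗ[starRingEnd ℂ] BasicModule where
  toFun m := m.mapRange (starRingEnd ℂ) (map_zero _)
  map_add' m m' := by ext; simp
  map_smul' r m := by ext; simp

lemma basicConj_apply (m : BasicModule) (n : ℤ) : basicConj m n = conj (m n) := rfl

lemma basicConj_cvec (n : ℤ) : basicConj (cvec n) = cvec n := by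
  ext k
  simp [basicConj_apply, Finsupp.single_apply, apply_ite]

/-- The map x ↦ S(x)^* is conjugate linear and multiplicative, so generators suffice. For them it
reflects that their matrix entries on M are real or purely imaginary in a compatible way. This is
why Φ_n is self-adjoint. -/
lemma basicRep_star_antipode (x : Oq q) (m : BasicModule) :
    basicRep q a (star (antipode ℂ x)) (basicConj m) = basicConj (basicRep q a x m) := by
  refine Oq.induction (p := fun x => ∀ m, basicRep q a (star (antipode ℂ x)) (basicConj m) =
    basicConj (basicRep q a x m)) (fun r m => ?_) (fun i m => ?_) (fun x y hx hy m => ?_)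
    (fun x y hx hy m => ?_) x m
  · simp [Algebra.algebraMap_eq_smul_one]
  · have key : ∀ n, basicRep q a (star (antipode ℂ (Oq.gen q i))) (cvec n) =
        basicConj (basicRep q a (Oq.gen q i) (cvec n)) := by
      intro n
      have hq := Oq.q_ne_zero q
      have hX : conj (pt q a n) = pt q a n := Complex.conj_ofReal _
      have hq' : conj ((q : ℝ) : ℂ) = ((q : ℝ) : ℂ) := Complex.conj_ofReal _
      have h := pt_sq_add_one_ne_zero q a n
      rw [Oq.antipode_def, Oq.antipodeLin_gen]
      cases i <;>
      · simp only [Oq.antipodeGen, MulOpposite.unop_op, star_smul, Oq.star_al, Oq.star_als,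
          Oq.star_ga, Oq.star_gas, map_smul, LinearMap.smul_apply, basicRep_gen, basicGen,
          LinearMap.map_smulₛₗ, map_add, map_sub, basicConj_cvec, map_mul, map_inv₀, map_pow, map_neg,
          Complex.conj_I, hX, Complex.star_def, hq', map_one]
        try (match_scalars <;> field_simp)
    induction m using Finsupp.induction_linear with
    | zero => simp
    | add f g hf hg => simp only [map_add, hf, hg]
    | single n r =>
      have e : (Finsupp.single n r : BasicModule) = r • cvec n := by simp
      rw [e, LinearMap.map_smulₛₗ, basicConj_cvec, map_smul, key, map_smul, LinearMap.map_smulₛₗ]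
  · rw [antipode_mul_antidistrib, star_mul, map_mul, Module.End.mul_apply, hy, hx, map_mul,
      Module.End.mul_apply]
  · simp only [map_add, star_add, LinearMap.add_apply, hx, hy]

lemma dualStar_phi (n : ℤ) : dualStar (phi q a n) = phi q a n := by
  ext x
  rw [dualStar_apply, phi_apply]
  have := basicRep_star_antipode q a x (cvec 0)
  rw [basicConj_cvec] at this
  rw [this, basicConj_apply, Complex.conj_conj]
  rfl

end Functionals

/-! ### The left grading of O_q(SU(2)), frames, and the Podleś sphere. -/

section LeftGrading

variable (q : Set.Ioo (0 : ℝ) 1) (a : ℝ)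

/-- The action of `O_q(SU(2))` on the tensor product of the basic module with the left regular
module. -/
def leftRep : Oq q →ₐ[ℂ] Module.End ℂ (BasicModule ⊗[ℂ] Oq q) :=
  (endTensor BasicModule (Oq q)).comp
    ((Algebra.TensorProduct.map (basicRep q a) (Algebra.lmul ℂ (Oq q))).comp
      (Bialgebra.comulAlgHom ℂ (Oq q)))

lemma leftRep_tmul (x : Oq q) {ι : Type*} (r : Coalgebra.Repr ℂ x ι) (m : BasicModule) (y : Oq q) :
    leftRep q a x (m ⊗ₜ[ℂ] y) =
      ∑ i ∈ r.index, basicRep q a (r.left i) m ⊗ₜ[ℂ] (r.right i * y) := by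
  simp [leftRep, ← r.eq, LinearMap.sum_apply, endTensor_tmul]

lemma leftRep_tmul_mul (x : Oq q) (m : BasicModule) (y z : Oq q) :
    leftRep q a x (m ⊗ₜ[ℂ] (y * z)) =
      (LinearMap.mulRight ℂ z).lTensor BasicModule (leftRep q a x (m ⊗ₜ[ℂ] y)) := by
  simp [leftRep_tmul q a x (ℛ ℂ x), mul_assoc]

/-- The elements `x` with `x₍₁₎ c_l ⊗ x₍₂₎ = c_k ⊗ x`. -/
def leftDeg (l k : ℤ) : Submodule ℂ (Oq q) :=
  LinearMap.eqLocus ((leftRep q a).toLinearMap.flip (cvec l ⊗ₜ[ℂ] 1))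
    (TensorProduct.mk ℂ BasicModule (Oq q) (cvec k))

lemma mem_leftDeg {l k : ℤ} {x : Oq q} :
    x ∈ leftDeg q a l k ↔ leftRep q a x (cvec l ⊗ₜ[ℂ] 1) = cvec k ⊗ₜ[ℂ] x := Iff.rfl

lemma one_mem_leftDeg (l : ℤ) : 1 ∈ leftDeg q a l l := by
  rw [mem_leftDeg, map_one, Module.End.one_apply]

/-- The action on M ⊗ A commutes with right multiplication on A, so degrees compose like arrows l →
k → h. -/
lemma mul_mem_leftDeg {l k h : ℤ} {x y : Oq q} (hx : x ∈ leftDeg q a k h)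
    (hy : y ∈ leftDeg q a l k) : x * y ∈ leftDeg q a l h := by
  rw [mem_leftDeg] at *
  have := leftRep_tmul_mul q a x (cvec k) 1 y
  rw [one_mul] at this
  rw [map_mul, Module.End.mul_apply, hy, this, hx]
  simp

/-- The map `x ↦ f(x₍₁₎ c_l) x₍₂₎`. -/
def leftSlice (f : BasicModule →ₗ[ℂ] ℂ) (l : ℤ) : Oq q →ₗ[ℂ] Oq q :=
  (TensorProduct.lid ℂ (Oq q)).toLinearMap ∘ₗ f.rTensor (Oq q) ∘ₗ
    (leftRep q a).toLinearMap.flip (cvec l ⊗ₜ[ℂ] 1)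

lemma leftSlice_of_mem (f : BasicModule →ₗ[ℂ] ℂ) {l k : ℤ} {x : Oq q}
    (hx : x ∈ leftDeg q a l k) : leftSlice q a f l x = f (cvec k) • x := by
  rw [mem_leftDeg] at hx
  simp [leftSlice, hx]

lemma leftSlice_apply (f : BasicModule →ₗ[ℂ] ℂ) (l : ℤ) (x : Oq q) {ι : Type*}
    (r : Coalgebra.Repr ℂ x ι) :
    leftSlice q a f l x = ∑ i ∈ r.index, f (basicRep q a (r.left i) (cvec l)) • r.right i := by
  simp [leftSlice, leftRep_tmul q a x r]

/-- The projection onto the component of degree `k`. -/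
abbrev leftComp (l k : ℤ) : Oq q →ₗ[ℂ] Oq q := leftSlice q a (Finsupp.lapply k) l

lemma leftComp_of_mem {l k k' : ℤ} {x : Oq q} (hx : x ∈ leftDeg q a l k) :
    leftComp q a l k' x = if k = k' then x else 0 := by
  rw [leftComp, leftSlice_of_mem q a _ hx, Finsupp.lapply_apply, Finsupp.single_apply]
  split_ifs <;> simp

lemma leftComp_sum {l k : ℤ} {F : Finset ℤ} {y : ℤ → Oq q} (hy : ∀ k, y k ∈ leftDeg q a l k)
    (hk : k ∉ F → y k = 0) : leftComp q a l k (∑ i ∈ F, y i) = y k := by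
  rw [map_sum, Finset.sum_congr rfl fun i _ => leftComp_of_mem q a (hy i)]
  rw [Finset.sum_ite_eq' F k y]
  split_ifs with h
  · rfl
  · rw [hk h]

/-- The point `q^{a+n}` or its image `-q^{-a-n}` under the reflection. -/
def spt (ε : Bool) (n : ℤ) : ℂ := if ε then pt q a n else -(pt q a n)⁻¹

/-- One step up or down. -/
def shift (ε : Bool) (n : ℤ) : ℤ := if ε then n + 1 else n - 1

lemma shift_not_shift (ε : Bool) (n : ℤ) : shift (!ε) (shift ε n) = n := by
  cases ε <;> simp [shift]

lemma spt_not (ε : Bool) (n : ℤ) : spt q a (!ε) n = -(spt q a ε n)⁻¹ := by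
  cases ε <;> simp [spt, inv_neg]

lemma spt_shift (ε : Bool) (n : ℤ) : spt q a ε (shift ε n) = ((q : ℝ) : ℂ) * spt q a ε n := by
  cases ε
  · simp [spt, shift, pt_sub_one, mul_comm]
  · simp [spt, shift, pt_add_one]

lemma spt_shift_not (ε : Bool) (n : ℤ) :
    spt q a ε (shift (!ε) n) = ((q : ℝ) : ℂ)⁻¹ * spt q a ε n := by
  cases ε
  · simp [spt, shift, pt_add_one, mul_comm]
  · simp [spt, shift, pt_sub_one]

/-- The parameter of the step that undoes a step with parameter X is -(qX)⁻¹, the form in which it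
appears in all relations below. -/
lemma spt_not_shift (ε : Bool) (n : ℤ) :
    spt q a (!ε) (shift ε n) = -(((q : ℝ) : ℂ) * spt q a ε n)⁻¹ := by
  rw [spt_not, spt_shift]

lemma spt_eq (ε : Bool) (n : ℤ) : ∃ x : ℝ, x ≠ 0 ∧ spt q a ε n = x := by
  obtain ⟨x, hx, h⟩ := pt_eq q a n
  cases ε
  · exact ⟨-x⁻¹, neg_ne_zero.2 (inv_ne_zero hx.ne'), by simp [spt, h]⟩
  · exact ⟨x, hx.ne', by simp [spt, h]⟩

lemma spt_ne_zero (ε : Bool) (n : ℤ) : spt q a ε n ≠ 0 := by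
  obtain ⟨x, hx, h⟩ := spt_eq q a ε n
  rw [h]; exact_mod_cast hx

/-- The difference is X + X⁻¹ with X > 0. Hence the two row vectors (X, i) for the up and down
directions are independent. -/
lemma spt_true_ne_spt_false (n : ℤ) : spt q a true n - spt q a false n ≠ 0 := by
  have h0 := pt_ne_zero q a n
  have h := pt_sq_add_one_ne_zero q a n
  simp only [spt, if_true, Bool.false_eq_true, if_false, sub_neg_eq_add]
  field_simp
  exact div_ne_zero h h0

/-- The two entries of the row vector `(X, i) u`, where `u` is the fundamental unitary; the second
one is divided by `i`. -/
def row (X : ℂ) (j : Bool) : Oq q :=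
  if j then X • Oq.gen q .al + Complex.I • Oq.gen q .ga
  else (Complex.I * ((q : ℝ) : ℂ) * X) • Oq.gen q .gas + Oq.gen q .als

/-- The vector (X, i) is an eigenvector for the action of the fundamental unitary on c_l: the value
X = q^{a+l} selects c_{l+1}, and its reflection -X⁻¹ selects c_{l-1}. -/
lemma row_mem_leftDeg (ε j : Bool) (l : ℤ) :
    row q (spt q a ε l) j ∈ leftDeg q a l (shift ε l) := by
  have hq := Oq.q_ne_zero q
  have h := pt_sq_add_one_ne_zero q a l
  have h0 := pt_ne_zero q a l
  have hI : Complex.I ^ 2 = -1 := Complex.I_sq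
  rw [mem_leftDeg, leftRep, AlgHom.comp_apply, AlgHom.comp_apply, Bialgebra.comulAlgHom_apply]
  cases ε <;> cases j <;>
  · simp only [row, spt, shift, if_true, Bool.false_eq_true, if_false, map_add, map_smul,
      Oq.comul_gen]
    simp only [Oq.comulGen, sub_eq_add_neg, ← neg_smul]
    simp only [map_add, map_smul, Algebra.TensorProduct.map_tmul, endTensor_tmul,
      LinearMap.add_apply, LinearMap.smul_apply, basicRep_gen, basicGen, Algebra.coe_lmul_eq_mul,
      LinearMap.mul_apply', mul_one, TensorProduct.tmul_smul, ← TensorProduct.smul_tmul',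
      TensorProduct.tmul_add, TensorProduct.add_tmul, TensorProduct.sub_tmul]
    simp only [sub_eq_add_neg]
    match_scalars <;> field_simp <;> (try simp only [hI]) <;> ring

/-- The adjoint of a step is a multiple of the return step, with the two columns exchanged. -/
lemma star_row {X : ℝ} (hX : X ≠ 0) (j : Bool) : ∃ r : ℂ,
    star (row q X j) = r • row q (-(((q : ℝ) : ℂ) * X)⁻¹) (!j) := by
  have hq := Oq.q_ne_zero q
  have hX' : (X : ℂ) ≠ 0 := by exact_mod_cast hX
  have hq' : conj ((q : ℝ) : ℂ) = ((q : ℝ) : ℂ) := Complex.conj_ofReal _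
  have hXc : conj (X : ℂ) = X := Complex.conj_ofReal _
  have hI : Complex.I ^ 2 = -1 := Complex.I_sq
  refine ⟨if j then X else -((q : ℝ) : ℂ) * X, ?_⟩
  cases j <;>
  · simp only [row, if_true, Bool.false_eq_true, if_false, Bool.not_true, Bool.not_false, star_add,
      star_smul, Oq.star_al, Oq.star_als, Oq.star_ga, Oq.star_gas, Complex.star_def, map_mul,
      Complex.conj_I, hq', hXc]
    match_scalars <;> field_simp

/-- The row is (X, i) times a unitary matrix, up to a phase in the second entry, so its square norm
is that of (X, i). -/
lemma row_mul_star_row (X : ℝ) :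
    ∑ j, row q X j * star (row q X j) = ((X ^ 2 + 1 : ℝ) : ℂ) • (1 : Oq q) := by
  have h := Oq.isSUq2_gen q
  have hq' : conj ((q : ℝ) : ℂ) = ((q : ℝ) : ℂ) := Complex.conj_ofReal _
  have hXc : conj (X : ℂ) = X := Complex.conj_ofReal _
  have hI : Complex.I ^ 2 = -1 := Complex.I_sq
  simp only [Fintype.sum_bool, row, if_true, Bool.false_eq_true, if_false, star_add,
    star_smul, Oq.star_al, Oq.star_als, Oq.star_ga, Oq.star_gas, Complex.star_def, map_mul,
    Complex.conj_I, hq', hXc, add_mul, mul_add, smul_mul_assoc, mul_smul_comm, Oq.relα, Oq.relα',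
    h.rel3, h.rel4, h.rel5, h.rel6, h.rel7, Complex.ofReal_add, Complex.ofReal_pow,
    Complex.ofReal_one]
  match_scalars <;> ring_nf <;> simp only [hI] <;> ring

/-- The vectors (X, i) and (Y, i) for the two directions form a basis of ℂ², which can be inverted
to recover the entries of the unitary. -/
lemma gen_eq_sum_row (i : Gen) (l : ℤ) : ∃ r : Bool → Bool → ℂ,
    Oq.gen q i = ∑ ε, ∑ j, r ε j • row q (spt q a ε l) j := by
  have hq := Oq.q_ne_zero q
  have hd := spt_true_ne_spt_false q a l
  set X := spt q a true l
  set Y := spt q a false l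
  have hI : Complex.I ^ 2 = -1 := Complex.I_sq
  have hI0 := Complex.I_ne_zero
  refine ⟨fun ε j => match i with
    | .al => if j then (if ε then (X - Y)⁻¹ else -(X - Y)⁻¹) else 0
    | .ga => if j then (if ε then Complex.I * Y * (X - Y)⁻¹ else -Complex.I * X * (X - Y)⁻¹) else 0
    | .gas => if j then 0 else (if ε then (Complex.I * (q : ℝ) * (X - Y))⁻¹
      else -(Complex.I * (q : ℝ) * (X - Y))⁻¹)
    | .als => if j then 0 else (if ε then -Y * (X - Y)⁻¹ else X * (X - Y)⁻¹), ?_⟩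
  cases i <;>
  · simp only [Fintype.sum_bool, row, if_true, Bool.false_eq_true, if_false]
    match_scalars <;> field_simp <;> (try simp only [hI]) <;> ring

/-- A finite family in a component of the grading, with a scalar sum of squares. -/
structure IsFrame (l k : ℤ) {ι : Type} [Fintype ι] (y : ι → Oq q) (C : ℝ) : Prop where
  mem : ∀ i, y i ∈ leftDeg q a l k
  star_mem : ∀ i, star (y i) ∈ leftDeg q a k l
  pos : 0 < C
  sum_eq : ∑ i, y i * star (y i) = (C : ℂ) • (1 : Oq q)

lemma isFrame_one (l : ℤ) : IsFrame q a l l (fun _ : Unit => 1) 1 where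
  mem _ := one_mem_leftDeg q a l
  star_mem _ := by rw [star_one]; exact one_mem_leftDeg q a l
  pos := one_pos
  sum_eq := by simp

variable {q a}

lemma star_row_mem_leftDeg (ε j : Bool) (k : ℤ) :
    star (row q (spt q a ε k) j) ∈ leftDeg q a (shift ε k) k := by
  obtain ⟨x, hx, h⟩ := spt_eq q a ε k
  obtain ⟨r, hr⟩ := star_row q hx j
  have := row_mem_leftDeg q a (!ε) (!j) (shift ε k)
  rw [spt_not_shift, shift_not_shift, h] at this
  rw [h, hr]
  exact Submodule.smul_mem _ _ this

/-- The inner sum Σ y_i y_i^* is the scalar C, so the double sum collapses to C times that of the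
row, C(x²+1). -/
lemma IsFrame.row_mul {l k : ℤ} {ι : Type} [Fintype ι] {y : ι → Oq q} {C : ℝ}
    (hy : IsFrame q a l k y C) (ε : Bool) : ∃ C' : ℝ, IsFrame q a l (shift ε k)
      (fun i : Bool × ι => row q (spt q a ε k) i.1 * y i.2) C' := by
  obtain ⟨x, hx, h⟩ := spt_eq q a ε k
  refine ⟨C * (x ^ 2 + 1), fun i => mul_mem_leftDeg q a (row_mem_leftDeg q a ε i.1 k) (hy.mem _),
    fun i => ?_, mul_pos hy.pos (by positivity), ?_⟩
  · rw [star_mul]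
    exact mul_mem_leftDeg q a (hy.star_mem _) (star_row_mem_leftDeg ε _ k)
  · rw [Fintype.sum_prod_type]
    simp only [star_mul, mul_assoc]
    simp only [← mul_assoc (y _), ← Finset.mul_sum, ← Finset.sum_mul, hy.sum_eq, smul_mul_assoc,
      one_mul, mul_smul_comm, ← Finset.smul_sum]
    rw [h, row_mul_star_row, smul_smul]
    push_cast
    rfl

variable (q a)

/-- The span of the members of frames. -/
def frameSpan (l k : ℤ) : Submodule ℂ (Oq q) :=
  Submodule.span ℂ {x | ∃ (ι : Type) (_ : Fintype ι) (y : ι → Oq q) (C : ℝ),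
    IsFrame q a l k y C ∧ ∃ i, y i = x}

lemma frameSpan_le (l k : ℤ) : frameSpan q a l k ≤ leftDeg q a l k := by
  refine Submodule.span_le.2 ?_
  rintro _ ⟨ι, _, y, C, hy, i, rfl⟩
  exact hy.mem i

lemma star_mem_of_mem_frameSpan {l k : ℤ} {x : Oq q} (hx : x ∈ frameSpan q a l k) :
    star x ∈ leftDeg q a k l := by
  refine Submodule.span_induction (p := fun x _ => star x ∈ leftDeg q a k l) ?_ ?_ ?_ ?_ hx
  · rintro _ ⟨ι, _, y, C, hy, i, rfl⟩
    exact hy.star_mem i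
  · rw [star_zero]; exact zero_mem _
  · intro x y _ _ hx hy
    rw [star_add]; exact add_mem hx hy
  · intro r x _ hx
    rw [star_smul]; exact Submodule.smul_mem _ _ hx

lemma row_mul_mem_frameSpan {l k : ℤ} {x : Oq q} (hx : x ∈ frameSpan q a l k) (ε j : Bool) :
    row q (spt q a ε k) j * x ∈ frameSpan q a l (shift ε k) := by
  refine Submodule.span_induction (p := fun x _ => row q (spt q a ε k) j * x ∈
    frameSpan q a l (shift ε k)) ?_ ?_ ?_ ?_ hx
  · rintro _ ⟨ι, _, y, C, hy, i, rfl⟩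
    obtain ⟨C', hC⟩ := hy.row_mul ε
    exact Submodule.subset_span ⟨_, inferInstance, _, C', hC, (j, i), rfl⟩
  · rw [mul_zero]; exact zero_mem _
  · intro x y _ _ hx hy
    rw [mul_add]; exact add_mem hx hy
  · intro r x _ hx
    rw [mul_smul_comm]; exact Submodule.smul_mem _ _ hx

/-- The sum is a left ideal: a generator times a member of degree k is a combination of steps out of
k. It contains 1, the trivial frame. -/
lemma iSup_frameSpan (l : ℤ) : ⨆ k, frameSpan q a l k = ⊤ := by
  have key : ∀ x y : Oq q, y ∈ ⨆ k, frameSpan q a l k → x * y ∈ ⨆ k, frameSpan q a l k := by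
    intro x
    refine Oq.induction (p := fun x => ∀ y ∈ ⨆ k, frameSpan q a l k,
      x * y ∈ ⨆ k, frameSpan q a l k) (fun r y hy => ?_) (fun i y hy => ?_)
      (fun x x' hx hx' y hy => ?_) (fun x x' hx hx' y hy => ?_) x
    · rw [← Algebra.smul_def]; exact Submodule.smul_mem _ _ hy
    · refine Submodule.iSup_induction _ (motive := fun y => Oq.gen q i * y ∈
        ⨆ k, frameSpan q a l k) hy (fun k y hy => ?_) ?_ ?_
      · obtain ⟨r, hr⟩ := gen_eq_sum_row q a i k
        rw [hr]
        simp only [Finset.sum_mul, smul_mul_assoc]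
        exact Submodule.sum_mem _ fun ε _ => Submodule.sum_mem _ fun j _ => Submodule.smul_mem _ _
          (Submodule.mem_iSup_of_mem _ (row_mul_mem_frameSpan q a hy ε j))
      · rw [mul_zero]; exact zero_mem _
      · intro y z hy hz
        rw [mul_add]; exact add_mem hy hz
    · rw [mul_assoc]; exact hx _ (hx' _ hy)
    · rw [add_mul]; exact add_mem (hx _ hy) (hx' _ hy)
  rw [eq_top_iff]
  intro x _
  rw [← mul_one x]
  refine key x 1 (Submodule.mem_iSup_of_mem l (Submodule.subset_span ?_))
  exact ⟨Unit, inferInstance, _, 1, isFrame_one q a l, (), rfl⟩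

lemma exists_frameSpan_sum (l : ℤ) (x : Oq q) : ∃ (F : Finset ℤ) (y : ℤ → Oq q),
    (∀ k, y k ∈ frameSpan q a l k) ∧ (∀ k, k ∉ F → y k = 0) ∧ x = ∑ k ∈ F, y k := by
  have : x ∈ ⨆ k, frameSpan q a l k := by rw [iSup_frameSpan]; trivial
  obtain ⟨f, hf, rfl⟩ := (Submodule.mem_iSup_iff_exists_finsupp _ _).1 this
  exact ⟨f.support, f, hf, fun k hk => by simpa using hk, rfl⟩

/-- A decomposition of x into members of frame spans is read off by the projections `leftComp`; for
x homogeneous the only component is x itself. -/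
lemma frameSpan_eq (l k : ℤ) : frameSpan q a l k = leftDeg q a l k := by
  refine le_antisymm (frameSpan_le q a l k) fun x hx => ?_
  obtain ⟨F, y, hy, h0, rfl⟩ := exists_frameSpan_sum q a l x
  have h1 := leftComp_sum q a (fun k => frameSpan_le q a l k (hy k)) (h0 k)
  rw [leftComp_of_mem q a hx, if_pos rfl] at h1
  rw [h1]
  exact hy k

/-- The definition of the grading does not show this. It holds because it holds for frames, and
frames span. -/
lemma star_mem_leftDeg {l k : ℤ} {x : Oq q} (hx : x ∈ leftDeg q a l k) :
    star x ∈ leftDeg q a k l :=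
  star_mem_of_mem_frameSpan q a (by rwa [frameSpan_eq])

lemma exists_frame (l k : ℤ) : ∃ (ι : Type) (_ : Fintype ι) (y : ι → Oq q) (C : ℝ),
    IsFrame q a l k y C := by
  induction k using Int.inductionOn' (b := l) with
  | zero => exact ⟨Unit, inferInstance, _, 1, isFrame_one q a l⟩
  | succ k _ ih =>
    obtain ⟨ι, _, y, C, hy⟩ := ih
    obtain ⟨C', h⟩ := hy.row_mul true
    exact ⟨_, inferInstance, _, C', h⟩
  | pred k _ ih =>
    obtain ⟨ι, _, y, C, hy⟩ := ih
    obtain ⟨C', h⟩ := hy.row_mul false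
    exact ⟨_, inferInstance, _, C', h⟩

/-- The weight of x₍₁₎ c_0 is the value of i B_t at x₍₁₎. -/
lemma I_smul_slice_elemB (x : Oq q) :
    Complex.I • slice q (elemB q a) x = leftSlice q a (basicWt q a) 0 x := by
  rw [leftSlice_apply q a _ 0 x (ℛ ℂ x)]
  simp only [basicWt_basicRep, basicWt_cvec, basicSum_cvec, mul_one, sub_self, mul_zero, add_zero]
  simp only [slice, LinearMap.comp_apply]
  rw [← (ℛ ℂ x).eq]
  simp [Finset.smul_sum, smul_smul]

/-- The slice by i B_t is diagonal for the left grading, with eigenvalue [a+k] on degree (0, k). The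
eigenvalues are distinct, so the eigenspace for [a] is degree (0, 0). -/
lemma podles_eq : podles q a = leftDeg q a 0 0 := by
  ext x
  have h1 : x ∈ podles q a ↔ leftSlice q a (basicWt q a) 0 x = wt q a 0 • x := by
    rw [← I_smul_slice_elemB, ← I_mul_elemB_one, mul_smul, smul_right_inj Complex.I_ne_zero]
    rfl
  rw [h1]
  constructor
  · intro h
    obtain ⟨F, y, hy, h0, rfl⟩ := exists_frameSpan_sum q a 0 x
    have hy' := fun k => frameSpan_le q a 0 k (hy k)
    have h2 : ∀ k, k ≠ 0 → y k = 0 := by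
      intro k hk
      have h3 := congrArg (leftComp q a 0 k) h
      rw [map_sum, Finset.sum_congr rfl fun i _ => leftSlice_of_mem q a (basicWt q a) (hy' i),
        leftComp_sum (y := fun i => basicWt q a (cvec i) • y i) q a
          (fun i => Submodule.smul_mem _ _ (hy' i)) (fun h => by rw [h0 k h, smul_zero]),
        map_smul, leftComp_sum q a hy' (h0 k), basicWt_cvec, ← sub_eq_zero, ← sub_smul,
        smul_eq_zero, sub_eq_zero] at h3
      exact h3.resolve_left fun h => hk (wt_injective q a h)
    have h4 : ∑ k ∈ F, y k = y 0 := by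
      refine Finset.sum_eq_single 0 (fun k _ hk => h2 k hk) (h0 0)
    rw [h4]
    exact hy' 0
  · intro h
    rw [leftSlice_of_mem q a _ h, basicWt_cvec]

end LeftGrading

/-! ### The blocks of 𝓘 are one-dimensional. -/

section Blocks

variable (q : Set.Ioo (0 : ℝ) 1) (a : ℝ)

/-- This is the definition of the degree with ε applied to the second leg. -/
lemma basicRep_of_mem {l k : ℤ} {x : Oq q} (hx : x ∈ leftDeg q a l k) :
    basicRep q a x (cvec l) = counit (R := ℂ) x • cvec k := by
  rw [mem_leftDeg, leftRep_tmul q a x (ℛ ℂ x)] at hx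
  have h1 := congrArg (TensorProduct.rid ℂ BasicModule)
    (congrArg ((counit (R := ℂ) (A := Oq q)).lTensor BasicModule) hx)
  simp only [mul_one, map_sum, LinearMap.lTensor_tmul, TensorProduct.rid_tmul] at h1
  rw [← h1]
  have h2 := congrArg (fun z => basicRep q a (TensorProduct.rid ℂ (Oq q) z) (cvec l))
    (Coalgebra.sum_tmul_counit_eq (ℛ ℂ x))
  simp only [map_sum, TensorProduct.rid_tmul, one_smul, map_smul, LinearMap.sum_apply,
    LinearMap.smul_apply] at h2
  exact h2.symm

lemma phi_of_mem {k : ℤ} {x : Oq q} (hx : x ∈ leftDeg q a 0 k) (n : ℤ) :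
    phi q a n x = if k = n then counit (R := ℂ) x else 0 := by
  rw [phi_apply, basicRep_of_mem q a hx, Finsupp.smul_apply, Finsupp.single_apply]
  split_ifs <;> simp

lemma elemB_mul_apply (ω : FullDual (Oq q)) (x : Oq q) :
    Complex.I * (elemB q a * ω) x = ω (leftSlice q a (basicWt q a) 0 x) := by
  rw [← I_smul_slice_elemB, map_smul, smul_eq_mul]
  congr 1
  rw [(ℛ ℂ x).convMul_apply]
  simp only [slice, LinearMap.comp_apply]
  rw [← (ℛ ℂ x).eq]
  simp

lemma mem_block {n : ℤ} {ω : FullDual (Oq q)} : ω ∈ block q a n ↔ ω ∈ coidealI q a ∧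
    ∀ x, ω (leftSlice q a (basicWt q a) 0 x) = wt q a n * ω x := by
  rw [block, Submodule.mem_inf, LinearMap.mem_eqLocus]
  refine and_congr_right fun _ => ?_
  rw [LinearMap.mulLeft_apply, LinearMap.smul_apply, LinearMap.id_apply, smul_mul_assoc,
    qNum_eq_wt]
  simp only [← elemB_mul_apply]
  constructor
  · intro h x
    exact congrArg (fun θ : FullDual (Oq q) => θ x) h
  · intro h
    ext x
    exact h x

lemma phi_mem_block (n : ℤ) : phi q a n ∈ block q a n := by
  rw [mem_block]
  constructor
  · intro x b hb h0
    rw [podles_eq] at hb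
    rw [phi_apply, map_mul, Module.End.mul_apply, basicRep_of_mem q a hb, h0, zero_smul, map_zero]
    rfl
  · intro x
    obtain ⟨F, y, hy, -, rfl⟩ := exists_frameSpan_sum q a 0 x
    have hy' := fun k => frameSpan_le q a 0 k (hy k)
    simp only [map_sum, Finset.mul_sum]
    refine Finset.sum_congr rfl fun k _ => ?_
    rw [leftSlice_of_mem q a _ (hy' k), map_smul, phi_of_mem q a (hy' k), basicWt_cvec, smul_eq_mul]
    split_ifs with h
    · rw [h]
    · simp

lemma coidealI_mul {ω : FullDual (Oq q)} (hω : ω ∈ coidealI q a) (x : Oq q) {b : Oq q}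
    (hb : b ∈ podles q a) : ω (x * b) = ω x * counit (R := ℂ) b := by
  have h := hω x (b - counit (R := ℂ) b • 1)
    (sub_mem hb (Submodule.smul_mem _ _ (one_mem_podles q a))) (by simp)
  rw [mul_sub, map_sub, mul_smul_comm, mul_one, map_smul, smul_eq_mul, sub_eq_zero] at h
  rw [h, mul_comm]

/-- The weights force ω to vanish on degrees (0, k) with k ≠ n. In degree n a frame writes y as C⁻¹
Σ e_i (e_i^* y) with e_i^* y in B, where ω is B-linear through ε; so ω(y) is a fixed multiple of
ε(y) = Φ_n(y). -/
lemma block_eq (n : ℤ) : block q a n = Submodule.span ℂ {phi q a n} := by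
  refine le_antisymm (fun ω hω => ?_)
    ((Submodule.span_singleton_le_iff_mem _ _).2 (phi_mem_block q a n))
  rw [mem_block] at hω
  obtain ⟨hI, hω⟩ := hω
  obtain ⟨ι, _, e, C, he⟩ := exists_frame q a 0 n
  rw [Submodule.mem_span_singleton]
  -- The multiple obtained by expanding an element of degree n along the frame.
  refine ⟨(C : ℂ)⁻¹ * ∑ i, ω (e i) * counit (R := ℂ) (star (e i)), ?_⟩
  ext x
  obtain ⟨F, y, hy, -, rfl⟩ := exists_frameSpan_sum q a 0 x
  have hy' := fun k => frameSpan_le q a 0 k (hy k)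
  simp only [map_sum]
  refine Finset.sum_congr rfl fun k _ => ?_
  change _ * phi q a n (y k) = _
  rw [phi_of_mem q a (hy' k)]
  split_ifs with h
  · subst h
    have hC : (C : ℂ) ≠ 0 := by exact_mod_cast he.pos.ne'
    have h1 : y k = (C : ℂ)⁻¹ • ∑ i, e i * (star (e i) * y k) := by
      simp only [← mul_assoc]
      rw [← Finset.sum_mul, he.sum_eq, smul_mul_assoc, one_mul, smul_smul, inv_mul_cancel₀ hC,
        one_smul]
    conv_rhs => rw [h1]
    rw [map_smul, map_sum, smul_eq_mul, mul_assoc, Finset.sum_mul]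
    congr 1
    refine Finset.sum_congr rfl fun i _ => ?_
    rw [coidealI_mul q a hI, Bialgebra.counit_mul, mul_assoc]
    rw [podles_eq]
    exact mul_mem_leftDeg q a (he.star_mem i) (hy' k)
  · have h1 := hω (y k)
    rw [leftSlice_of_mem q a _ (hy' k), map_smul, basicWt_cvec, ← sub_eq_zero, smul_eq_mul,
      ← sub_mul, mul_eq_zero, sub_eq_zero] at h1
    rw [mul_zero]
    exact (h1.resolve_left fun e => h (wt_injective q a e)).symm

/-- Otherwise ε would vanish on a frame of degree n, but ε of the sum of squares is C > 0. -/
lemma phi_ne_zero (n : ℤ) : phi q a n ≠ 0 := by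
  obtain ⟨ι, _, e, C, he⟩ := exists_frame q a 0 n
  intro h
  have h1 : ∀ i, counit (R := ℂ) (e i) = 0 := by
    intro i
    have := phi_of_mem q a (he.mem i) n
    rw [if_pos rfl, h] at this
    exact this.symm
  have h2 := congrArg (counit (R := ℂ)) he.sum_eq
  simp [h1] at h2
  exact he.pos.ne' (by exact_mod_cast h2.symm)

lemma isPhi_phi (n : ℤ) : IsPhi q a n (phi q a n) where
  mem := phi_mem_block q a n
  idem := by rw [phi_mul_phi, if_pos rfl]
  ne_zero := phi_ne_zero q a n

variable {q a} in
lemma IsPhi.eq_phi {n : ℤ} {p : FullDual (Oq q)} (hp : IsPhi q a n p) : p = phi q a n := by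
  have h := hp.mem
  rw [block_eq, Submodule.mem_span_singleton] at h
  obtain ⟨r, rfl⟩ := h
  have h1 := hp.idem
  rw [smul_mul_smul_comm, phi_mul_phi, if_pos rfl, ← sub_eq_zero, ← sub_smul, smul_eq_zero] at h1
  have h2 := h1.resolve_right (phi_ne_zero q a n)
  have h3 : r ≠ 0 := by
    rintro rfl
    exact hp.ne_zero (zero_smul _ _)
  have h4 : r = 1 := by
    have : r * (r - 1) = 0 := by linear_combination h2
    rcases mul_eq_zero.1 this with h | h
    · exact absurd h h3
    · exact sub_eq_zero.1 h
  rw [h4, one_smul]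

lemma existsUnique_isPhi (n : ℤ) :
    ∃! p, IsPhi q a n p ∧ block q a n = Submodule.span ℂ {p} :=
  ⟨phi q a n, ⟨isPhi_phi q a n, block_eq q a n⟩, fun _ hp => hp.1.eq_phi⟩

lemma coidealIc_eq : coidealIc q a = Submodule.span ℂ (Set.range (phi q a)) := by
  rw [coidealIc, Submodule.span_range_eq_iSup]
  simp only [block_eq]

end Blocks

/-! ### The right grading and elements homogeneous on both sides. -/

section RightGrading

variable (q : Set.Ioo (0 : ℝ) 1) (a : ℝ)

/-- The action of `O_q(SU(2))` on the tensor product of the left regular module with the basic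
module. -/
def rightRep : Oq q →ₐ[ℂ] Module.End ℂ (Oq q ⊗[ℂ] BasicModule) :=
  (endTensor (Oq q) BasicModule).comp
    ((Algebra.TensorProduct.map (Algebra.lmul ℂ (Oq q)) (basicRep q a)).comp
      (Bialgebra.comulAlgHom ℂ (Oq q)))

lemma rightRep_tmul (x : Oq q) {ι : Type*} (r : Coalgebra.Repr ℂ x ι) (m : BasicModule) (y : Oq q) :
    rightRep q a x (y ⊗ₜ[ℂ] m) =
      ∑ i ∈ r.index, (r.left i * y) ⊗ₜ[ℂ] basicRep q a (r.right i) m := by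
  simp [rightRep, ← r.eq, LinearMap.sum_apply, endTensor_tmul]

lemma rightRep_tmul_mul (x : Oq q) (m : BasicModule) (y z : Oq q) :
    rightRep q a x ((y * z) ⊗ₜ[ℂ] m) =
      (LinearMap.mulRight ℂ z).rTensor BasicModule (rightRep q a x (y ⊗ₜ[ℂ] m)) := by
  simp [rightRep_tmul q a x (ℛ ℂ x), mul_assoc]

/-- The elements `x` with `x₍₁₎ ⊗ x₍₂₎ c_n = x ⊗ c_m`. -/
def rightDeg (n m : ℤ) : Submodule ℂ (Oq q) :=
  LinearMap.eqLocus ((rightRep q a).toLinearMap.flip (1 ⊗ₜ[ℂ] cvec n))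
    ((TensorProduct.mk ℂ (Oq q) BasicModule).flip (cvec m))

lemma mem_rightDeg {n m : ℤ} {x : Oq q} :
    x ∈ rightDeg q a n m ↔ rightRep q a x (1 ⊗ₜ[ℂ] cvec n) = x ⊗ₜ[ℂ] cvec m := Iff.rfl

lemma one_mem_rightDeg (n : ℤ) : 1 ∈ rightDeg q a n n := by
  rw [mem_rightDeg, map_one, Module.End.one_apply]

lemma mul_mem_rightDeg {n m h : ℤ} {x y : Oq q} (hx : x ∈ rightDeg q a m h)
    (hy : y ∈ rightDeg q a n m) : x * y ∈ rightDeg q a n h := by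
  rw [mem_rightDeg] at *
  have := rightRep_tmul_mul q a x (cvec m) 1 y
  rw [one_mul] at this
  rw [map_mul, Module.End.mul_apply, hy, this, hx]
  simp

/-- The map `x ↦ x₍₁₎ ⟨c_m, x₍₂₎ c_n⟩`. -/
def rightComp (n m : ℤ) : Oq q →ₗ[ℂ] Oq q :=
  (TensorProduct.rid ℂ (Oq q)).toLinearMap ∘ₗ
    (Finsupp.lapply (R := ℂ) (M := ℂ) m).lTensor (Oq q) ∘ₗ
    (rightRep q a).toLinearMap.flip (1 ⊗ₜ[ℂ] cvec n)

lemma rightComp_apply (n m : ℤ) (x : Oq q) {ι : Type*} (r : Coalgebra.Repr ℂ x ι) :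
    rightComp q a n m x = ∑ i ∈ r.index, basicCoeff q a m n (r.right i) • r.left i := by
  simp [rightComp, rightRep_tmul q a x r, basicCoeff_apply]

lemma rightComp_of_mem {n m m' : ℤ} {x : Oq q} (hx : x ∈ rightDeg q a n m) :
    rightComp q a n m' x = if m = m' then x else 0 := by
  rw [mem_rightDeg] at hx
  simp only [rightComp, LinearMap.comp_apply, LinearMap.flip_apply, AlgHom.toLinearMap_apply, hx,
    LinearMap.lTensor_tmul, Finsupp.lapply_apply, Finsupp.single_apply, LinearEquiv.coe_coe,
    TensorProduct.rid_tmul]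
  split_ifs <;> simp

/-- By the interchange relation, multiplication by Φ_m on the left of x Φ_n cuts out the right
degree (n, m) component of x. -/
lemma phi_mul_mk (m n : ℤ) (x : Oq q) : Smash.mk 1 (phi q a m) * Smash.mk x (phi q a n) =
    Smash.mk (rightComp q a n m x) (phi q a n) := by
  rw [Smash.mk_mul_mk _ _ _ _ (ℛ ℂ x), rightComp_apply q a n m x (ℛ ℂ x)]
  simp only [one_mul, dualAct_phi_mul_phi]
  simp only [Smash.mk, TensorProduct.sum_tmul, TensorProduct.tmul_smul, TensorProduct.smul_tmul']
  rfl

lemma phi_mul_mk_of_mem {m m' n : ℤ} {x : Oq q} (hx : x ∈ rightDeg q a n m) :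
    Smash.mk 1 (phi q a m') * Smash.mk x (phi q a n) =
      if m = m' then Smash.mk x (phi q a n) else 0 := by
  rw [phi_mul_mk, rightComp_of_mem q a hx]
  split_ifs
  · rfl
  · exact TensorProduct.zero_tmul _ _

lemma mk_mul_mk_of_mem {m m' n : ℤ} {x : Oq q} (hx : x ∈ rightDeg q a n m) (y : Oq q) :
    Smash.mk y (phi q a m') * Smash.mk x (phi q a n) =
      if m = m' then Smash.mk (y * x) (phi q a n) else 0 := by
  rw [Smash.mk_eq y, mul_assoc, phi_mul_mk_of_mem q a hx, mul_ite, Smash.mk_one_mul, mul_zero]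

/-- `star (x Φ_n) = Φ_n star x Φ_m` for `x` of right degree `(n, m)`. -/
lemma star_mk_of_mem {m n : ℤ} {x : Oq q} (hx : x ∈ rightDeg q a n m) :
    star (Smash.mk x (phi q a n)) = Smash.mk (rightComp q a m n (star x)) (phi q a m) := by
  have h := phi_mul_mk_of_mem (m' := m) q a hx
  rw [if_pos rfl] at h
  rw [← h, star_mul, Smash.star_mk x, Smash.star_mk 1, dualStar_phi, dualStar_phi, star_one,
    ← Smash.one_def, mul_one, mul_assoc, ← Smash.mk_eq, phi_mul_mk]

/-- The element `X Y α + i q X γ^* + i Y γ + α^*`. -/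
def stepElt (X Y : ℂ) : Oq q :=
  (X * Y) • Oq.gen q .al + (Complex.I * ((q : ℝ) : ℂ) * X) • Oq.gen q .gas +
    (Complex.I * Y) • Oq.gen q .ga + Oq.gen q .als

lemma stepElt_eq_row (X Y : ℂ) : stepElt q X Y = Y • row q X true + row q X false := by
  simp only [stepElt, row, if_true, Bool.false_eq_true, if_false]
  module

lemma stepElt_mem_leftDeg (ε : Bool) (l : ℤ) (Y : ℂ) :
    stepElt q (spt q a ε l) Y ∈ leftDeg q a l (shift ε l) := by
  rw [stepElt_eq_row]
  exact add_mem (Submodule.smul_mem _ _ (row_mem_leftDeg q a ε _ l)) (row_mem_leftDeg q a ε _ l)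

/-- The mirror image of `row_mem_leftDeg`, with (Y, i) as a column vector. With both parameters
chosen from the spectrum, the element is homogeneous on both sides. -/
lemma stepElt_mem_rightDeg (δ : Bool) (n : ℤ) (X : ℂ) :
    stepElt q X (spt q a δ n) ∈ rightDeg q a n (shift δ n) := by
  have hq := Oq.q_ne_zero q
  have h := pt_sq_add_one_ne_zero q a n
  have h0 := pt_ne_zero q a n
  have hI : Complex.I ^ 2 = -1 := Complex.I_sq
  rw [mem_rightDeg, rightRep, AlgHom.comp_apply, AlgHom.comp_apply, Bialgebra.comulAlgHom_apply]
  cases δ <;>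
  · simp only [stepElt, spt, shift, if_true, Bool.false_eq_true, if_false, map_add, map_smul,
      Oq.comul_gen]
    simp only [Oq.comulGen, sub_eq_add_neg, ← neg_smul]
    simp only [map_add, map_smul, Algebra.TensorProduct.map_tmul, endTensor_tmul,
      LinearMap.add_apply, LinearMap.smul_apply, basicRep_gen, basicGen, Algebra.coe_lmul_eq_mul,
      LinearMap.mul_apply', mul_one, TensorProduct.tmul_smul, ← TensorProduct.smul_tmul',
      TensorProduct.tmul_add, TensorProduct.add_tmul, TensorProduct.tmul_sub]
    simp only [sub_eq_add_neg]
    match_scalars <;> field_simp <;> (try simp only [hI]) <;> ring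

lemma row_eq_stepElt (n : ℤ) (X : ℂ) (j : Bool) : ∃ r : Bool → ℂ,
    row q X j = ∑ δ, r δ • stepElt q X (spt q a δ n) := by
  have hd := spt_true_ne_spt_false q a n
  simp only [stepElt_eq_row, Fintype.sum_bool]
  set x := spt q a true n
  set y := spt q a false n
  refine ⟨fun δ => if j then (if δ then (x - y)⁻¹ else -(x - y)⁻¹)
    else (if δ then -y * (x - y)⁻¹ else x * (x - y)⁻¹), ?_⟩
  cases j <;>
  · simp only [if_true, Bool.false_eq_true, if_false]
    match_scalars <;> field_simp <;> ring

lemma gen_eq_sum_stepElt (i : Gen) (l n : ℤ) : ∃ r : Bool → Bool → ℂ,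
    Oq.gen q i = ∑ ε, ∑ δ, r ε δ • stepElt q (spt q a ε l) (spt q a δ n) := by
  obtain ⟨r, hr⟩ := gen_eq_sum_row q a i l
  choose s hs using fun ε j => row_eq_stepElt q a n (spt q a ε l) j
  refine ⟨fun ε δ => ∑ j, r ε j * s ε j δ, ?_⟩
  rw [hr]
  refine Finset.sum_congr rfl fun ε _ => ?_
  simp only [Finset.sum_smul, mul_smul]
  rw [Finset.sum_comm]
  refine Finset.sum_congr rfl fun j _ => ?_
  conv_lhs => rw [hs ε j]
  rw [Finset.smul_sum]

end RightGrading

/-! ### Relations between steps and the Casimir element. -/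

section Relations

variable (q : Set.Ioo (0 : ℝ) 1)

/-- The Casimir element. -/
def casimir (X Y : ℂ) : Oq q :=
  Oq.gen q .al * Oq.gen q .al + ((q : ℝ) : ℂ) ^ 2 • (Oq.gen q .als * Oq.gen q .als) +
  ((q : ℝ) : ℂ) • (Oq.gen q .ga * Oq.gen q .ga) +
  ((q : ℝ) : ℂ) ^ 3 • (Oq.gen q .gas * Oq.gen q .gas) +
  (Complex.I * (q : ℝ) * (X⁻¹ - X)) • (Oq.gen q .ga * Oq.gen q .al) -
  (Complex.I * ((q : ℝ) : ℂ) ^ 3 * (X⁻¹ - X)) • (Oq.gen q .als * Oq.gen q .gas) +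
  (Complex.I * ((q : ℝ) : ℂ) ^ 2 * (Y⁻¹ - Y)) • (Oq.gen q .gas * Oq.gen q .al) -
  (Complex.I * ((q : ℝ) : ℂ) ^ 2 * (Y⁻¹ - Y)) • (Oq.gen q .als * Oq.gen q .ga) -
  (((q : ℝ) : ℂ) ^ 2 * (X⁻¹ - X) * (Y⁻¹ - Y)) • (Oq.gen q .ga * Oq.gen q .gas)

/-- The constant term of a loop. -/
def loopConst (X Y : ℂ) : ℂ := (((q : ℝ) : ℂ) ^ 2 * X * Y)⁻¹ + X * Y

variable {q}

lemma casimir_neg_inv_left (X Y : ℂ) : casimir q (-X⁻¹) Y = casimir q X Y := by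
  have : (-X⁻¹)⁻¹ - -X⁻¹ = X⁻¹ - X := by rw [inv_neg, inv_inv]; ring
  simp only [casimir, this]

lemma casimir_neg_inv_right (X Y : ℂ) : casimir q X (-Y⁻¹) = casimir q X Y := by
  have : (-Y⁻¹)⁻¹ - -Y⁻¹ = Y⁻¹ - Y := by rw [inv_neg, inv_inv]; ring
  simp only [casimir, this]

/-- A direct computation in normally ordered monomials. The Casimir depends on X and Y only through
X⁻¹ - X and Y⁻¹ - Y, so it is unchanged by the reflections and hence the same for all four
directions. -/
lemma stepElt_loop {X Y : ℂ} (hX : X ≠ 0) (hY : Y ≠ 0) :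
    stepElt q (-(((q : ℝ) : ℂ) * X)⁻¹) (-(((q : ℝ) : ℂ) * Y)⁻¹) * stepElt q X Y =
      (((q : ℝ) : ℂ) ^ 2)⁻¹ • casimir q X Y + loopConst q X Y • 1 := by
  have h := Oq.isSUq2_gen q
  have hq := Oq.q_ne_zero q
  have hI : Complex.I ^ 2 = -1 := Complex.I_sq
  simp only [stepElt, casimir, loopConst, add_mul, mul_add, smul_mul_assoc, mul_smul_comm, Oq.relα,
    Oq.relα', h.rel3, h.rel4, h.rel5, h.rel6, h.rel7]
  match_scalars <;> field_simp <;> (try simp only [hI]) <;> ring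

/-- Associativity of T T' T, where T' is the return step: both bracketings contain a loop, and the
two loops have the same constant term, which cancels. -/
lemma stepElt_mul_casimir {X Y : ℂ} (hX : X ≠ 0) (hY : Y ≠ 0) : stepElt q X Y * casimir q X Y =
    casimir q (((q : ℝ) : ℂ) * X) (((q : ℝ) : ℂ) * Y) * stepElt q X Y := by
  have hq := Oq.q_ne_zero q
  have h1 := stepElt_loop (q := q) hX hY
  have h2 := stepElt_loop (q := q) (X := -(((q : ℝ) : ℂ) * X)⁻¹) (Y := -(((q : ℝ) : ℂ) * Y)⁻¹)
    (by simp [hq, hX]) (by simp [hq, hY])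
  have e : ∀ Z : ℂ, Z ≠ 0 → -(((q : ℝ) : ℂ) * -(((q : ℝ) : ℂ) * Z)⁻¹)⁻¹ = Z := by
    intro Z hZ
    field_simp
  have e' : loopConst q (-(((q : ℝ) : ℂ) * X)⁻¹) (-(((q : ℝ) : ℂ) * Y)⁻¹) = loopConst q X Y := by
    simp only [loopConst]
    field_simp
    ring
  rw [e X hX, e Y hY, casimir_neg_inv_left, casimir_neg_inv_right, e'] at h2
  have h3 := mul_assoc (stepElt q X Y)
    (stepElt q (-(((q : ℝ) : ℂ) * X)⁻¹) (-(((q : ℝ) : ℂ) * Y)⁻¹)) (stepElt q X Y)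
  rw [h1, h2, add_mul, mul_add, smul_mul_assoc, mul_smul_comm, smul_mul_assoc, mul_smul_comm,
    one_mul, mul_one, add_left_inj] at h3
  exact (smul_right_injective _ (inv_ne_zero (pow_ne_zero 2 hq)) h3).symm

/-- A square in the grid: two steps in the same left direction, with opposite right directions, may
be taken in either order. -/
lemma stepElt_mul_stepElt_right {X Y : ℂ} (hY : Y ≠ 0) :
    stepElt q (((q : ℝ) : ℂ) * X) (-(((q : ℝ) : ℂ) * Y)⁻¹) * stepElt q X Y =
      stepElt q (((q : ℝ) : ℂ) * X) (((q : ℝ) : ℂ)⁻¹ * Y) * stepElt q X (-Y⁻¹) := by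
  have h := Oq.isSUq2_gen q
  have hq := Oq.q_ne_zero q
  have hI : Complex.I ^ 2 = -1 := Complex.I_sq
  simp only [stepElt, add_mul, mul_add, smul_mul_assoc, mul_smul_comm, Oq.relα,
    Oq.relα', h.rel3, h.rel4, h.rel5, h.rel6, h.rel7]
  match_scalars <;> field_simp <;> (try simp only [hI]) <;> ring

/-- The same kind of square with the two gradings exchanged. -/
lemma stepElt_mul_stepElt_left {X Y : ℂ} (hX : X ≠ 0) :
    stepElt q (-(((q : ℝ) : ℂ) * X)⁻¹) (((q : ℝ) : ℂ) * Y) * stepElt q X Y =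
      stepElt q (((q : ℝ) : ℂ)⁻¹ * X) (((q : ℝ) : ℂ) * Y) * stepElt q (-X⁻¹) Y := by
  have h := Oq.isSUq2_gen q
  have hq := Oq.q_ne_zero q
  have hI : Complex.I ^ 2 = -1 := Complex.I_sq
  simp only [stepElt, add_mul, mul_add, smul_mul_assoc, mul_smul_comm, Oq.relα,
    Oq.relα', h.rel3, h.rel4, h.rel5, h.rel6, h.rel7]
  match_scalars <;> field_simp <;> (try simp only [hI]) <;> ring

/-- The adjoint respects the left grading but not the right one. It has a part returning in both
gradings and a part that returns on the left while going further on the right. -/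
lemma star_stepElt {X Y : ℝ} (hX : X ≠ 0) (hY : Y ≠ 0) : star (stepElt q X Y) =
    ((X * Y : ℝ) : ℂ) • ((((q : ℝ) ^ 2 * (1 + Y ^ 2) / (1 + (q : ℝ) ^ 2 * Y ^ 2) : ℝ) : ℂ) •
      stepElt q (-(((q : ℝ) : ℂ) * X)⁻¹) (-(((q : ℝ) : ℂ) * Y)⁻¹) +
      (((1 - (q : ℝ) ^ 2) / (1 + (q : ℝ) ^ 2 * Y ^ 2) : ℝ) : ℂ) •
      stepElt q (-(((q : ℝ) : ℂ) * X)⁻¹) (((q : ℝ) : ℂ) * Y)) := by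
  have hq := Oq.q_ne_zero q
  have hX' : (X : ℂ) ≠ 0 := by exact_mod_cast hX
  have hY' : (Y : ℂ) ≠ 0 := by exact_mod_cast hY
  have hq' : conj ((q : ℝ) : ℂ) = ((q : ℝ) : ℂ) := Complex.conj_ofReal _
  have hXc : conj (X : ℂ) = X := Complex.conj_ofReal _
  have hYc : conj (Y : ℂ) = Y := Complex.conj_ofReal _
  have hd : 1 + ((q : ℝ) : ℂ) ^ 2 * (Y : ℂ) ^ 2 ≠ 0 := by
    have : 1 + (q : ℝ) ^ 2 * Y ^ 2 ≠ 0 := by positivity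
    exact_mod_cast this
  have hd' : 1 + (Y : ℂ) ^ 2 * ((q : ℝ) : ℂ) ^ 2 ≠ 0 := by rwa [mul_comm]
  simp only [stepElt, star_add, star_smul, Oq.star_al, Oq.star_als, Oq.star_ga, Oq.star_gas,
    Complex.star_def, map_mul, Complex.conj_I, hq', hXc, hYc]
  push_cast
  match_scalars <;> field_simp <;> ring

end Relations

/-! ### Ladders of raising and lowering elements in a ring. -/

section Ladder

variable {R : Type*} [Ring R]

/-- The product of the raising, respectively lowering, elements from `0` to `k`. -/
def ladder (up dn : ℤ → R) (k : ℤ) : R :=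
  Int.inductionOn' (motive := fun _ => R) k 0 1 (fun k _ v => up k * v) (fun k _ v => dn k * v)

lemma ladder_zero (up dn : ℤ → R) : ladder up dn 0 = 1 := Int.inductionOn'_self ..

lemma ladder_add_one (up dn : ℤ → R) {k : ℤ} (hk : 0 ≤ k) :
    ladder up dn (k + 1) = up k * ladder up dn k := Int.inductionOn'_add_one hk

lemma ladder_sub_one (up dn : ℤ → R) {k : ℤ} (hk : k ≤ 0) :
    ladder up dn (k - 1) = dn k * ladder up dn k := Int.inductionOn'_sub_one hk

/-- A family w that intertwines each rung of two ladders can be carried through the whole product.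
-/
lemma mul_ladder_of_comm {up dn up' dn' w : ℤ → R} (hu : ∀ k, w (k + 1) * up k = up' k * w k)
    (hd : ∀ k, w (k - 1) * dn k = dn' k * w k) (k : ℤ) :
    w k * ladder up dn k = ladder up' dn' k * w 0 := by
  induction k using Int.inductionOn' (b := 0) with
  | zero => rw [ladder_zero, ladder_zero, one_mul, mul_one]
  | succ k hk ih =>
    rw [ladder_add_one _ _ hk, ladder_add_one _ _ hk, ← mul_assoc, hu, mul_assoc, ih, mul_assoc]
  | pred k hk ih =>
    rw [ladder_sub_one _ _ hk, ladder_sub_one _ _ hk, ← mul_assoc, hd, mul_assoc, ih, mul_assoc]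

variable [Algebra ℂ R]

lemma aeval_mul_of_mul_eq {x y T : R} (h : x * T = T * y) (p : Polynomial ℂ) :
    Polynomial.aeval x p * T = T * Polynomial.aeval y p := by
  induction p using Polynomial.induction_on' with
  | add p p' hp hp' => rw [map_add, map_add, add_mul, mul_add, hp, hp']
  | monomial n r =>
    have : x ^ n * T = T * y ^ n := by
      induction n with
      | zero => simp
      | succ n ih => rw [pow_succ, mul_assoc, h, ← mul_assoc, ih, mul_assoc, ← pow_succ]
    simp only [Polynomial.aeval_monomial, ← Algebra.smul_def, smul_mul_assoc, this, mul_smul_comm]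

/-- Raising and lowering elements which are inverse to each other up to polynomials in elements
`c k`, which they intertwine. -/
structure IsLadder (up dn c : ℤ → R) : Prop where
  dn_up : ∀ k, ∃ p : Polynomial ℂ, dn (k + 1) * up k = Polynomial.aeval (c k) p
  up_dn : ∀ k, ∃ p : Polynomial ℂ, up (k - 1) * dn k = Polynomial.aeval (c k) p
  up_c : ∀ k, c (k + 1) * up k = up k * c k
  dn_c : ∀ k, c (k - 1) * dn k = dn k * c k

namespace IsLadder

variable {up dn c : ℤ → R} (h : IsLadder up dn c)

lemma c_mul_ladder (h : IsLadder up dn c) (k : ℤ) :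
    c k * ladder up dn k = ladder up dn k * c 0 := by
  induction k using Int.inductionOn' (b := 0) with
  | zero => rw [ladder_zero, one_mul, mul_one]
  | succ k hk ih => rw [ladder_add_one _ _ hk, ← mul_assoc, h.up_c, mul_assoc, ih, mul_assoc]
  | pred k hk ih => rw [ladder_sub_one _ _ hk, ← mul_assoc, h.dn_c, mul_assoc, ih, mul_assoc]

/-- Away from 0 the ladder is extended. Towards 0 the new factor closes a loop, which is a
polynomial in c and can be carried to the right end of the ladder. -/
lemma up_mul_ladder (h : IsLadder up dn c) (k : ℤ) : ∃ p : Polynomial ℂ,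
    up k * ladder up dn k = ladder up dn (k + 1) * Polynomial.aeval (c 0) p := by
  rcases le_or_gt 0 k with hk | hk
  · exact ⟨1, by rw [ladder_add_one _ _ hk, map_one, mul_one]⟩
  · obtain ⟨p, hp⟩ := h.up_dn (k + 1)
    have h1 := ladder_sub_one up dn (k := k + 1) (by lia)
    rw [add_sub_cancel_right] at h1 hp
    exact ⟨p, by rw [h1, ← mul_assoc, hp, aeval_mul_of_mul_eq (h.c_mul_ladder _)]⟩

lemma dn_mul_ladder (h : IsLadder up dn c) (k : ℤ) : ∃ p : Polynomial ℂ,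
    dn k * ladder up dn k = ladder up dn (k - 1) * Polynomial.aeval (c 0) p := by
  rcases le_or_gt k 0 with hk | hk
  · exact ⟨1, by rw [ladder_sub_one _ _ hk, map_one, mul_one]⟩
  · obtain ⟨p, hp⟩ := h.dn_up (k - 1)
    have h1 := ladder_add_one up dn (k := k - 1) (by lia)
    rw [sub_add_cancel] at h1 hp
    exact ⟨p, by rw [h1, ← mul_assoc, hp, aeval_mul_of_mul_eq (h.c_mul_ladder _)]⟩

end IsLadder

end Ladder

/-! ### Steps, loops and the squares of paths. -/

section Steps

variable (q : Set.Ioo (0 : ℝ) 1) (a : ℝ)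

/-- The step from `(l, n)` in the direction `(ε, δ)`. -/
def step (ε δ : Bool) (l n : ℤ) : Oq q := stepElt q (spt q a ε l) (spt q a δ n)

/-- The Casimir element at `(l, n)`. -/
def cas (l n : ℤ) : Oq q := casimir q (pt q a l) (pt q a n)

lemma casimir_spt (ε δ : Bool) (l n : ℤ) :
    casimir q (spt q a ε l) (spt q a δ n) = cas q a l n := by
  cases ε <;> cases δ <;> simp [spt, cas, casimir_neg_inv_left, casimir_neg_inv_right]

/-- The polynomial giving the loop in the direction `(ε, δ)` at `(l, n)`. -/
def loopPoly (ε δ : Bool) (l n : ℤ) : Polynomial ℂ :=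
  Polynomial.C (((q : ℝ) : ℂ) ^ 2)⁻¹ * Polynomial.X +
    Polynomial.C (loopConst q (spt q a ε l) (spt q a δ n))

lemma step_loop (ε δ : Bool) (l n : ℤ) :
    step q a (!ε) (!δ) (shift ε l) (shift δ n) * step q a ε δ l n =
      Polynomial.aeval (cas q a l n) (loopPoly q a ε δ l n) := by
  rw [step, step, spt_not_shift, spt_not_shift,
    stepElt_loop (spt_ne_zero q a ε l) (spt_ne_zero q a δ n), casimir_spt, loopPoly]
  simp [Algebra.smul_def]

lemma cas_mul_step (ε δ : Bool) (l n : ℤ) : cas q a (shift ε l) (shift δ n) * step q a ε δ l n =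
    step q a ε δ l n * cas q a l n := by
  have := stepElt_mul_casimir (q := q) (spt_ne_zero q a ε l) (spt_ne_zero q a δ n)
  rw [← spt_shift, ← spt_shift, casimir_spt, casimir_spt] at this
  exact this.symm

lemma step_mul_step_right (ε δ : Bool) (l n : ℤ) :
    step q a ε (!δ) (shift ε l) (shift δ n) * step q a ε δ l n =
      step q a ε δ (shift ε l) (shift (!δ) n) * step q a ε (!δ) l n := by
  have := stepElt_mul_stepElt_right (q := q) (X := spt q a ε l) (spt_ne_zero q a δ n)
  rw [← spt_shift, ← spt_not_shift, ← spt_shift_not, ← spt_not] at this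
  exact this

lemma step_mul_step_left (ε δ : Bool) (l n : ℤ) :
    step q a (!ε) δ (shift ε l) (shift δ n) * step q a ε δ l n =
      step q a ε δ (shift (!ε) l) (shift δ n) * step q a (!ε) δ l n := by
  have := stepElt_mul_stepElt_left (q := q) (Y := spt q a δ n) (spt_ne_zero q a ε l)
  rw [← spt_not_shift, ← spt_shift, ← spt_shift_not, ← spt_not] at this
  exact this

lemma step_mem_leftDeg (ε δ : Bool) (l n : ℤ) : step q a ε δ l n ∈ leftDeg q a l (shift ε l) :=
  stepElt_mem_leftDeg q a ε l _

lemma step_mem_rightDeg (ε δ : Bool) (l n : ℤ) : step q a ε δ l n ∈ rightDeg q a n (shift δ n) :=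
  stepElt_mem_rightDeg q a δ n _

/-- A loop has degree (n, n), and the Casimir is a combination of a loop and 1. -/
lemma cas_mem_rightDeg (l n : ℤ) : cas q a l n ∈ rightDeg q a n n := by
  have h := step_loop q a true true l n
  have h1 := mul_mem_rightDeg q a (step_mem_rightDeg q a (!true) (!true) (shift true l)
    (shift true n)) (step_mem_rightDeg q a true true l n)
  rw [h, shift_not_shift, loopPoly] at h1
  simp only [map_add, map_mul, Polynomial.aeval_C, Polynomial.aeval_X,
    Algebra.algebraMap_eq_smul_one, smul_mul_assoc, one_mul] at h1
  rw [Submodule.add_mem_iff_left _ (Submodule.smul_mem _ _ (one_mem_rightDeg q a n)),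
    Submodule.smul_mem_iff _ (inv_ne_zero (pow_ne_zero 2 (Oq.q_ne_zero q)))] at h1
  exact h1

lemma cas_mem_leftDeg (l n : ℤ) : cas q a l n ∈ leftDeg q a l l := by
  have h := step_loop q a true true l n
  have h1 := mul_mem_leftDeg q a (step_mem_leftDeg q a (!true) (!true) (shift true l)
    (shift true n)) (step_mem_leftDeg q a true true l n)
  rw [h, shift_not_shift, loopPoly] at h1
  simp only [map_add, map_mul, Polynomial.aeval_C, Polynomial.aeval_X,
    Algebra.algebraMap_eq_smul_one, smul_mul_assoc, one_mul] at h1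
  rw [Submodule.add_mem_iff_left _ (Submodule.smul_mem _ _ (one_mem_leftDeg q a l)),
    Submodule.smul_mem_iff _ (inv_ne_zero (pow_ne_zero 2 (Oq.q_ne_zero q)))] at h1
  exact h1

lemma aeval_mem_of_mem (S : Submodule ℂ (Oq q)) (h1 : 1 ∈ S) (hS : ∀ x ∈ S, ∀ y ∈ S, x * y ∈ S)
    {x : Oq q} (hx : x ∈ S) (p : Polynomial ℂ) : Polynomial.aeval x p ∈ S := by
  rw [Polynomial.aeval_eq_sum_range]
  refine Submodule.sum_mem _ fun i hi => Submodule.smul_mem _ _ ?_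
  clear hi
  induction i with
  | zero => rwa [pow_zero]
  | succ i ih => rw [pow_succ]; exact hS _ ih _ hx

lemma aeval_cas_mem_rightDeg (l n : ℤ) (p : Polynomial ℂ) :
    Polynomial.aeval (cas q a l n) p ∈ rightDeg q a n n :=
  aeval_mem_of_mem q _ (one_mem_rightDeg q a n) (fun _ hx _ hy => mul_mem_rightDeg q a hx hy)
    (cas_mem_rightDeg q a l n) p

lemma aeval_cas_mem_leftDeg (l n : ℤ) (p : Polynomial ℂ) :
    Polynomial.aeval (cas q a l n) p ∈ leftDeg q a l l :=
  aeval_mem_of_mem q _ (one_mem_leftDeg q a l) (fun _ hx _ hy => mul_mem_leftDeg q a hx hy)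
    (cas_mem_leftDeg q a l n) p

/-- Polynomials which are positive on the interval `(-2q, 2q)`. -/
def PosPoly (p : Polynomial ℂ) : Prop :=
  ∀ x : ℝ, x ^ 2 < 4 * (q : ℝ) ^ 2 → ∃ r : ℝ, 0 < r ∧ p.eval (x : ℂ) = r

variable {q} in
lemma PosPoly.mul {p p' : Polynomial ℂ} (h : PosPoly q p) (h' : PosPoly q p') :
    PosPoly q (p * p') := by
  intro x hx
  obtain ⟨r, hr, e⟩ := h x hx
  obtain ⟨r', hr', e'⟩ := h' x hx
  exact ⟨r * r', mul_pos hr hr', by rw [Polynomial.eval_mul, e, e']; push_cast; rfl⟩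

lemma shift_ne (δ : Bool) (n : ℤ) : shift δ (shift δ n) ≠ n := by
  cases δ <;> simp only [shift, if_true, Bool.false_eq_true, if_false] <;> lia

/-- Multiplying by the projections Φ discards the part of the adjoint that goes further on the
right. What remains closes a loop, hence is affine in the Casimir with real coefficients. -/
lemma star_step_mul_step (ε δ : Bool) (l n : ℤ) : ∃ r c : ℝ, r ≠ 0 ∧
    PosPoly q (Polynomial.C (r : ℂ) * Polynomial.X + Polynomial.C (c : ℂ)) ∧
    star (Smash.mk (step q a ε δ l n) (phi q a n)) * Smash.mk (step q a ε δ l n) (phi q a n) =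
      Smash.mk ((r : ℂ) • cas q a l n + (c : ℂ) • 1) (phi q a n) := by
  obtain ⟨X, hX, hXe⟩ := spt_eq q a ε l
  obtain ⟨Y, hY, hYe⟩ := spt_eq q a δ n
  have hq := q.2.1
  -- The coefficient of the return step in `star_stepElt`.
  set s : ℝ := X * Y * ((q : ℝ) ^ 2 * (1 + Y ^ 2) / (1 + (q : ℝ) ^ 2 * Y ^ 2)) with hs
  refine ⟨s * ((q : ℝ) ^ 2)⁻¹, s * (((q : ℝ) ^ 2 * X * Y)⁻¹ + X * Y), by positivity,
    fun x hx => ?_, ?_⟩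
  · refine ⟨(1 + Y ^ 2) / (1 + (q : ℝ) ^ 2 * Y ^ 2) *
      (X * Y * x + 1 + (q : ℝ) ^ 2 * X ^ 2 * Y ^ 2), mul_pos (by positivity) ?_, ?_⟩
    -- With w = XY the factor is q²w² + xw + 1, and 4q² times it is (2q²w + x)² + 4q² - x². The
    -- interval (-2q, 2q) is the one on which this is positive for every w.
    · nlinarith [sq_nonneg (2 * (q : ℝ) ^ 2 * (X * Y) + x), mul_pos hq hq]
    · simp only [Polynomial.eval_mul, Polynomial.eval_add, Polynomial.eval_C, Polynomial.eval_X]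
      norm_cast
      rw [hs]
      field_simp
      ring
  · rw [star_mk_of_mem q a (step_mem_rightDeg q a ε δ l n)]
    have h1 := star_stepElt (q := q) hX hY
    rw [← hXe, ← hYe, ← spt_not_shift, ← spt_not_shift, ← spt_shift] at h1
    change star (step q a ε δ l n) = _ • (_ • step q a (!ε) (!δ) (shift ε l) (shift δ n) +
      _ • step q a (!ε) δ (shift ε l) (shift δ n)) at h1
    have h2 := step_mem_rightDeg q a (!ε) (!δ) (shift ε l) (shift δ n)
    rw [shift_not_shift] at h2
    have h3 : loopConst q (spt q a ε l) (spt q a δ n) =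
        (((((q : ℝ) ^ 2 * X * Y)⁻¹ + X * Y : ℝ)) : ℂ) := by
      rw [hXe, hYe, loopConst]
      push_cast
      rfl
    -- The second term of the adjoint ends at n shifted twice in direction δ, which differs from n,
    -- so the projection annihilates it.
    rw [h1, map_smul, map_add, map_smul, map_smul, rightComp_of_mem q a h2,
      rightComp_of_mem q a (step_mem_rightDeg q a (!ε) δ (shift ε l) (shift δ n)), if_pos rfl,
      if_neg (shift_ne δ n), smul_zero, add_zero, smul_smul, ← Complex.ofReal_mul,
      mk_mul_mk_of_mem q a (step_mem_rightDeg q a ε δ l n), if_pos rfl, smul_mul_assoc, step_loop,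
      loopPoly, h3]
    simp only [map_add, map_mul, Polynomial.aeval_C, Polynomial.aeval_X, ← Algebra.smul_def,
      Algebra.algebraMap_eq_smul_one, smul_add, smul_smul, smul_mul_assoc, one_mul]
    rw [hs]
    push_cast
    rfl

/-- The properties of the elements given by paths from `(0, n)` to `(l, m)`. -/
structure IsPath (n l m : ℤ) (T : Oq q) : Prop where
  left : T ∈ leftDeg q a 0 l
  right : T ∈ rightDeg q a n m
  cas_mul : cas q a l m * T = T * cas q a 0 n
  star_mul_self : ∃ p : Polynomial ℂ, PosPoly q p ∧
    star (Smash.mk T (phi q a n)) * Smash.mk T (phi q a n) =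
      Smash.mk (Polynomial.aeval (cas q a 0 n) p) (phi q a n)

lemma isPath_one (n : ℤ) : IsPath q a n 0 n 1 where
  left := one_mem_leftDeg q a 0
  right := one_mem_rightDeg q a n
  cas_mul := by rw [one_mul, mul_one]
  star_mul_self := by
    refine ⟨1, fun x _ => ⟨1, one_pos, by simp⟩, ?_⟩
    rw [Smash.star_mk, dualStar_phi, star_one, ← Smash.one_def, mul_one,
      mk_mul_mk_of_mem q a (one_mem_rightDeg q a n), if_pos rfl, map_one, one_mul]

variable {q a} in
-- The new inner square is p'(Ω) for the Casimir at the end of T. It is moved through T to the base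
-- point and leaves T^* T, so the two positive polynomials multiply.
lemma IsPath.step_mul {n l m : ℤ} {T : Oq q} (h : IsPath q a n l m T) (ε δ : Bool) :
    IsPath q a n (shift ε l) (shift δ m) (step q a ε δ l m * T) where
  left := mul_mem_leftDeg q a (step_mem_leftDeg q a ε δ l m) h.left
  right := mul_mem_rightDeg q a (step_mem_rightDeg q a ε δ l m) h.right
  cas_mul := by rw [← mul_assoc, cas_mul_step, mul_assoc, h.cas_mul, mul_assoc]
  star_mul_self := by
    obtain ⟨p, hp, e⟩ := h.star_mul_self
    obtain ⟨r, c, -, hp', e'⟩ := star_step_mul_step q a ε δ l m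
    have e'' : (r : ℂ) • cas q a l m + (c : ℂ) • 1 = Polynomial.aeval (cas q a l m)
        (Polynomial.C (r : ℂ) * Polynomial.X + Polynomial.C (c : ℂ)) := by
      simp [Algebra.smul_def]
    rw [e''] at e'
    set p' := Polynomial.C (r : ℂ) * Polynomial.X + Polynomial.C (c : ℂ)
    refine ⟨p * p', hp.mul hp', ?_⟩
    have h1 := mk_mul_mk_of_mem (m' := m) q a h.right (step q a ε δ l m)
    rw [if_pos rfl] at h1
    rw [← h1, star_mul, mul_assoc, ← mul_assoc (star (Smash.mk (step _ _ _ _ _ _) _)), e',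
      mk_mul_mk_of_mem q a h.right, if_pos rfl, aeval_mul_of_mul_eq h.cas_mul]
    have h2 := mk_mul_mk_of_mem (m' := n) q a (aeval_cas_mem_rightDeg q a 0 n p') T
    rw [if_pos rfl] at h2
    rw [← h2, ← mul_assoc, e, mk_mul_mk_of_mem q a (aeval_cas_mem_rightDeg q a 0 n p'), if_pos rfl,
      map_mul]

end Steps

/-! ### Straightening paths: a spanning set over the polynomials in the Casimir. -/

section Grid

variable (q : Set.Ioo (0 : ℝ) 1) (a : ℝ)

lemma isLadder_step (ε δ : Bool) {l n : ℤ → ℤ} (hl : ∀ k, l (k + 1) = shift ε (l k))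
    (hn : ∀ k, n (k + 1) = shift δ (n k)) :
    IsLadder (fun k => step q a ε δ (l k) (n k)) (fun k => step q a (!ε) (!δ) (l k) (n k))
      (fun k => cas q a (l k) (n k)) := by
  have hl' : ∀ k, l (k - 1) = shift (!ε) (l k) := fun k => by
    conv_rhs => rw [← sub_add_cancel k 1, hl, shift_not_shift]
  have hn' : ∀ k, n (k - 1) = shift (!δ) (n k) := fun k => by
    conv_rhs => rw [← sub_add_cancel k 1, hn, shift_not_shift]
  constructor
  · intro k
    exact ⟨_, by rw [hl, hn]; exact step_loop q a ε δ (l k) (n k)⟩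
  · intro k
    have := step_loop q a (!ε) (!δ) (l k) (n k)
    rw [Bool.not_not, Bool.not_not, ← hl', ← hn'] at this
    exact ⟨_, this⟩
  · intro k
    simp only [hl, hn]
    exact cas_mul_step q a ε δ (l k) (n k)
  · intro k
    simp only [hl', hn']
    exact cas_mul_step q a (!ε) (!δ) (l k) (n k)

/-- The step at the point of the grid with coordinates `(i, j)` based at `(0, n)`. -/
def gridStep (n : ℤ) (ε δ : Bool) (i j : ℤ) : Oq q := step q a ε δ (i + j) (n + i - j)

variable {q a} in
lemma gridStep_eq {n i j l m : ℤ} (ε δ : Bool) (hl : i + j = l) (hm : n + i - j = m) :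
    gridStep q a n ε δ i j = step q a ε δ l m := by
  rw [gridStep, hl, hm]

/-- The product of the steps from `(0, n)` along the first axis. -/
def rowElt (n : ℤ) (i j : ℤ) : Oq q :=
  ladder (fun i => gridStep q a n true true i j) (fun i => gridStep q a n false false i j) i

/-- The product of the steps from `(0, n)` along the second axis. -/
def colElt (n : ℤ) (j : ℤ) : Oq q :=
  ladder (fun j => gridStep q a n true false 0 j) (fun j => gridStep q a n false true 0 j) j

/-- The path from the base point to the point with coordinates `(i, j)`. -/
def gridElt (n : ℤ) (i j : ℤ) : Oq q := rowElt q a n i j * colElt q a n j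

lemma isLadder_row (n j : ℤ) : IsLadder (fun i => gridStep q a n true true i j)
    (fun i => gridStep q a n false false i j) (fun i => cas q a (i + j) (n + i - j)) :=
  isLadder_step q a true true (fun k => by simp only [shift, if_true]; ring)
    (fun k => by simp only [shift, if_true]; ring)

lemma isLadder_col (n : ℤ) : IsLadder (fun j => gridStep q a n true false 0 j)
    (fun j => gridStep q a n false true 0 j) (fun j => cas q a (0 + j) (n + 0 - j)) :=
  isLadder_step q a true false (fun k => by simp only [shift, if_true]; ring)
    (fun k => by simp only [shift, Bool.false_eq_true, if_false]; ring)

/-- The squares of the grid, applied rung by rung, slide a step along the second axis past the row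
down to the first column. -/
lemma gridStep_mul_rowElt_succ (n i j : ℤ) : gridStep q a n true false i j * rowElt q a n i j =
    rowElt q a n i (j + 1) * gridStep q a n true false 0 j := by
  refine mul_ladder_of_comm (w := fun i => gridStep q a n true false i j) (fun k => ?_)
    (fun k => ?_) i
  · rw [gridStep_eq (l := shift true (k + j)) (m := shift true (n + k - j)) _ _
        (by change _ = _ + 1; ring) (by change _ = _ + 1; ring),
      gridStep_eq (j := j + 1) (l := shift true (k + j)) (m := shift false (n + k - j)) _ _
        (by change _ = _ + 1; ring) (by change _ = _ - 1; ring)]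
    exact step_mul_step_right q a true true (k + j) (n + k - j)
  · rw [gridStep_eq (l := shift false (k + j)) (m := shift false (n + k - j)) _ _
        (by change _ = _ - 1; ring) (by change _ = _ - 1; ring),
      gridStep_eq (j := j + 1) (l := shift true (k + j)) (m := shift false (n + k - j)) _ _
        (by change _ = _ + 1; ring) (by change _ = _ - 1; ring)]
    exact step_mul_step_left q a false false (k + j) (n + k - j)

lemma gridStep_mul_rowElt_pred (n i j : ℤ) : gridStep q a n false true i j * rowElt q a n i j =
    rowElt q a n i (j - 1) * gridStep q a n false true 0 j := by
  refine mul_ladder_of_comm (w := fun i => gridStep q a n false true i j) (fun k => ?_)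
    (fun k => ?_) i
  · rw [gridStep_eq (l := shift true (k + j)) (m := shift true (n + k - j)) _ _
        (by change _ = _ + 1; ring) (by change _ = _ + 1; ring),
      gridStep_eq (j := j - 1) (l := shift false (k + j)) (m := shift true (n + k - j)) _ _
        (by change _ = _ - 1; ring) (by change _ = _ + 1; ring)]
    exact step_mul_step_left q a true true (k + j) (n + k - j)
  · rw [gridStep_eq (l := shift false (k + j)) (m := shift false (n + k - j)) _ _
        (by change _ = _ - 1; ring) (by change _ = _ - 1; ring),
      gridStep_eq (j := j - 1) (l := shift false (k + j)) (m := shift true (n + k - j)) _ _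
        (by change _ = _ - 1; ring) (by change _ = _ + 1; ring)]
    exact step_mul_step_right q a false false (k + j) (n + k - j)

/-- The multiples of a path by polynomials in the Casimir element. -/
def gridSpan (n i j : ℤ) : Submodule ℂ (Oq q) :=
  LinearMap.range (LinearMap.mulLeft ℂ (gridElt q a n i j) ∘ₗ
    (Polynomial.aeval (cas q a 0 n)).toLinearMap)

lemma mem_gridSpan {n i j : ℤ} {x : Oq q} : x ∈ gridSpan q a n i j ↔
    ∃ p : Polynomial ℂ, gridElt q a n i j * Polynomial.aeval (cas q a 0 n) p = x := Iff.rfl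

lemma cas_mul_colElt (n j : ℤ) :
    cas q a (0 + j) (n - j) * colElt q a n j = colElt q a n j * cas q a 0 n := by
  have := (isLadder_col q a n).c_mul_ladder j
  simp only [add_zero, sub_zero] at this
  exact this

/-- Steps along the first axis extend or shorten the row. Steps along the second axis slide through
the row and extend or shorten the column. Backtracking produces a polynomial in Ω, which is carried
to the base point. -/
lemma gridStep_mul_gridElt (n i j : ℤ) (ε δ : Bool) : ∃ i' j' : ℤ, ∃ p : Polynomial ℂ,
    gridStep q a n ε δ i j * gridElt q a n i j =
      gridElt q a n i' j' * Polynomial.aeval (cas q a 0 n) p := by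
  have hcol : ∀ p : Polynomial ℂ, Polynomial.aeval (cas q a (0 + j) (n + 0 - j)) p *
      colElt q a n j = colElt q a n j * Polynomial.aeval (cas q a 0 n) p := by
    intro p
    rw [add_zero]
    exact aeval_mul_of_mul_eq (cas_mul_colElt q a n j) p
  cases ε <;> cases δ
  · obtain ⟨p, hp⟩ := (isLadder_row q a n j).dn_mul_ladder i
    refine ⟨i - 1, j, p, ?_⟩
    change _ * rowElt q a n i j = rowElt q a n (i - 1) j * _ at hp
    rw [gridElt, gridElt, ← mul_assoc, hp, mul_assoc, hcol, mul_assoc]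
  · obtain ⟨p, hp⟩ := (isLadder_col q a n).dn_mul_ladder j
    refine ⟨i, j - 1, p, ?_⟩
    change _ * colElt q a n j = colElt q a n (j - 1) * _ at hp
    rw [add_zero, add_zero, sub_zero] at hp
    rw [gridElt, gridElt, ← mul_assoc, gridStep_mul_rowElt_pred, mul_assoc, hp, mul_assoc]
  · obtain ⟨p, hp⟩ := (isLadder_col q a n).up_mul_ladder j
    refine ⟨i, j + 1, p, ?_⟩
    change _ * colElt q a n j = colElt q a n (j + 1) * _ at hp
    rw [add_zero, add_zero, sub_zero] at hp
    rw [gridElt, gridElt, ← mul_assoc, gridStep_mul_rowElt_succ, mul_assoc, hp, mul_assoc]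
  · obtain ⟨p, hp⟩ := (isLadder_row q a n j).up_mul_ladder i
    refine ⟨i + 1, j, p, ?_⟩
    change _ * rowElt q a n i j = rowElt q a n (i + 1) j * _ at hp
    rw [gridElt, gridElt, ← mul_assoc, hp, mul_assoc, hcol, mul_assoc]

lemma isPath_colElt (n j : ℤ) : IsPath q a n j (n - j) (colElt q a n j) := by
  induction j using Int.inductionOn' (b := 0) with
  | zero => rw [colElt, ladder_zero, sub_zero]; exact isPath_one q a n
  | succ k hk ih =>
    have h := ih.step_mul true false
    rw [← gridStep_eq (i := 0) (n := n) _ _ (zero_add k) (by ring),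
      show shift false (n - k) = n - (k + 1) by change _ - 1 = _; ring] at h
    rw [colElt, ladder_add_one _ _ hk]
    exact h
  | pred k hk ih =>
    have h := ih.step_mul false true
    rw [← gridStep_eq (i := 0) (n := n) _ _ (zero_add k) (by ring),
      show shift true (n - k) = n - (k - 1) by change _ + 1 = _; ring] at h
    rw [colElt, ladder_sub_one _ _ hk]
    exact h

lemma isPath_gridElt (n i j : ℤ) : IsPath q a n (i + j) (n + i - j) (gridElt q a n i j) := by
  induction i using Int.inductionOn' (b := 0) with
  | zero =>
    rw [gridElt, rowElt, ladder_zero, one_mul, zero_add, add_zero]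
    exact isPath_colElt q a n j
  | succ k hk ih =>
    have h := ih.step_mul true true
    rw [show shift true (n + k - j) = n + (k + 1) - j by change _ + 1 = _; ring,
      show shift true (k + j) = k + 1 + j by change _ + 1 = _; ring, gridElt, ← mul_assoc] at h
    rw [gridElt, rowElt, ladder_add_one _ _ hk]
    exact h
  | pred k hk ih =>
    have h := ih.step_mul false false
    rw [show shift false (n + k - j) = n + (k - 1) - j by change _ - 1 = _; ring,
      show shift false (k + j) = k - 1 + j by change _ - 1 = _; ring, gridElt, ← mul_assoc] at h
    rw [gridElt, rowElt, ladder_sub_one _ _ hk]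
    exact h

/-- The sum is a left ideal containing 1, since at each grid point the generators are combinations
of the four steps. -/
lemma iSup_gridSpan (n : ℤ) : ⨆ k : ℤ × ℤ, gridSpan q a n k.1 k.2 = ⊤ := by
  have key : ∀ x : Oq q, ∀ y ∈ ⨆ k : ℤ × ℤ, gridSpan q a n k.1 k.2,
      x * y ∈ ⨆ k : ℤ × ℤ, gridSpan q a n k.1 k.2 := by
    intro x
    refine Oq.induction (p := fun x => ∀ y ∈ ⨆ k : ℤ × ℤ, gridSpan q a n k.1 k.2,
      x * y ∈ ⨆ k : ℤ × ℤ, gridSpan q a n k.1 k.2) (fun r y hy => ?_) (fun i y hy => ?_)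
      (fun x x' hx hx' y hy => ?_) (fun x x' hx hx' y hy => ?_) x
    · rw [← Algebra.smul_def]; exact Submodule.smul_mem _ _ hy
    · refine Submodule.iSup_induction _ (motive := fun y => Oq.gen q i * y ∈
        ⨆ k : ℤ × ℤ, gridSpan q a n k.1 k.2) hy (fun k y hy => ?_) ?_ ?_
      · obtain ⟨p, rfl⟩ := (mem_gridSpan q a).1 hy
        obtain ⟨r, hr⟩ := gen_eq_sum_stepElt q a i (k.1 + k.2) (n + k.1 - k.2)
        rw [hr]
        simp only [Finset.sum_mul, smul_mul_assoc]
        refine Submodule.sum_mem _ fun ε _ => Submodule.sum_mem _ fun δ _ =>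
          Submodule.smul_mem _ _ ?_
        obtain ⟨i', j', p', hp'⟩ := gridStep_mul_gridElt q a n k.1 k.2 ε δ
        refine Submodule.mem_iSup_of_mem (i', j') ((mem_gridSpan q a).2 ⟨p' * p, ?_⟩)
        rw [map_mul, ← mul_assoc, ← hp', mul_assoc]
        rfl
      · rw [mul_zero]; exact zero_mem _
      · intro y z hy hz
        rw [mul_add]; exact add_mem hy hz
    · rw [mul_assoc]; exact hx _ (hx' _ hy)
    · rw [add_mul]; exact add_mem (hx _ hy) (hx' _ hy)
  rw [eq_top_iff]
  intro x _
  rw [← mul_one x]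
  refine key x 1 (Submodule.mem_iSup_of_mem (0, 0) ((mem_gridSpan q a).2 ⟨1, ?_⟩))
  rw [gridElt, rowElt, colElt, ladder_zero, ladder_zero, map_one, mul_one, mul_one]

/-- The path from `(0, n)` to `(0, n + 2 i)`. -/
def loopElt (n i : ℤ) : Oq q := gridElt q a n i (-i)

lemma isPath_loopElt (n i : ℤ) : IsPath q a n 0 (n + 2 * i) (loopElt q a n i) := by
  have := isPath_gridElt q a n i (-i)
  rwa [add_neg_cancel, show n + i - -i = n + 2 * i by ring] at this

lemma loopElt_zero (n : ℤ) : loopElt q a n 0 = 1 := by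
  rw [loopElt, gridElt, neg_zero, rowElt, colElt, ladder_zero, ladder_zero, one_mul]

lemma loopElt_mul_mem_rightDeg (n i : ℤ) (p : Polynomial ℂ) :
    loopElt q a n i * Polynomial.aeval (cas q a 0 n) p ∈ rightDeg q a n (n + 2 * i) :=
  mul_mem_rightDeg q a (isPath_loopElt q a n i).right (aeval_cas_mem_rightDeg q a 0 n p)

lemma loopElt_mul_mem_podles (n i : ℤ) (p : Polynomial ℂ) :
    loopElt q a n i * Polynomial.aeval (cas q a 0 n) p ∈ podles q a := by
  rw [podles_eq]
  exact mul_mem_leftDeg q a (isPath_loopElt q a n i).left (aeval_cas_mem_leftDeg q a 0 n p)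

/-- Every element of the Podleś sphere is a combination of paths with coefficients that are
polynomials in the Casimir element. -/
lemma exists_eq_sum_loopElt (n : ℤ) {x : Oq q} (hx : x ∈ podles q a) :
    ∃ p : ℤ →₀ Polynomial ℂ,
      x = ∑ i ∈ p.support, loopElt q a n i * Polynomial.aeval (cas q a 0 n) (p i) := by
  let S : ℤ → Submodule ℂ (Oq q) := fun i => gridSpan q a n i (-i)
  -- The projection to left degree (0, 0) fixes x and keeps only the grid points with i + j = 0.
  have h1 : x ∈ ⨆ i, S i := by
    rw [podles_eq] at hx
    have h2 : leftComp q a 0 0 x = x := by rw [leftComp_of_mem q a hx, if_pos rfl]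
    rw [← h2]
    have h3 : x ∈ ⨆ k : ℤ × ℤ, gridSpan q a n k.1 k.2 := by rw [iSup_gridSpan]; trivial
    refine Submodule.iSup_induction _ (motive := fun y => leftComp q a 0 0 y ∈ ⨆ i, S i) h3
      (fun k y hy => ?_) ?_ ?_
    · obtain ⟨p, rfl⟩ := (mem_gridSpan q a).1 hy
      rw [leftComp_of_mem q a (mul_mem_leftDeg q a (isPath_gridElt q a n k.1 k.2).left
        (aeval_cas_mem_leftDeg q a 0 n p))]
      split_ifs with h
      · have : k.2 = -k.1 := by lia
        rw [this]
        exact Submodule.mem_iSup_of_mem k.1 ⟨p, rfl⟩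
      · exact zero_mem _
    · rw [map_zero]; exact zero_mem _
    · intro y z hy hz
      rw [map_add]; exact add_mem hy hz
  refine Submodule.iSup_induction S (motive := fun x => ∃ p : ℤ →₀ Polynomial ℂ,
      x = ∑ i ∈ p.support, loopElt q a n i * Polynomial.aeval (cas q a 0 n) (p i)) h1
      (fun k y hy => ?_) ⟨0, by simp⟩ ?_
  · obtain ⟨p, rfl⟩ := (mem_gridSpan q a).1 hy
    refine ⟨Finsupp.single k p, ?_⟩
    have := Finsupp.sum_single_index (a := k) (b := p)
      (h := fun i p => loopElt q a n i * Polynomial.aeval (cas q a 0 n) p) (by simp)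
    exact this.symm
  · rintro y z ⟨p, rfl⟩ ⟨p', rfl⟩
    refine ⟨p + p', ?_⟩
    have := Finsupp.sum_add_index' (f := p) (g := p')
      (h := fun i p => loopElt q a n i * Polynomial.aeval (cas q a 0 n) p) (by simp)
      (by intro i p p'; rw [map_add, mul_add])
    exact this.symm

/-- The spanning elements of B are homogeneous for the right grading, so B contains the right
components of its elements. -/
lemma rightComp_mem (n m : ℤ) {x : Oq q} (hx : x ∈ podles q a) :
    rightComp q a n m x ∈ podles q a := by
  obtain ⟨p, rfl⟩ := exists_eq_sum_loopElt q a n hx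
  rw [map_sum]
  refine Submodule.sum_mem _ fun i _ => ?_
  rw [rightComp_of_mem q a (loopElt_mul_mem_rightDeg q a n i _)]
  split_ifs
  · exact loopElt_mul_mem_podles q a n i _
  · exact zero_mem _

/-- Only the trivial path returns to right degree n, and it contributes a polynomial in Ω. This is
the source of commutativity of the corners. -/
lemma exists_rightComp_self (n : ℤ) {x : Oq q} (hx : x ∈ podles q a) :
    ∃ p : Polynomial ℂ, rightComp q a n n x = Polynomial.aeval (cas q a 0 n) p := by
  obtain ⟨p, rfl⟩ := exists_eq_sum_loopElt q a n hx
  refine ⟨p 0, ?_⟩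
  rw [map_sum]
  simp only [rightComp_of_mem q a (loopElt_mul_mem_rightDeg q a n _ _)]
  rw [Finset.sum_eq_single 0]
  · rw [mul_zero, add_zero, if_pos rfl, loopElt_zero, one_mul]
  · intro i _ hi
    rw [if_neg (by lia)]
  · intro h
    rw [Finsupp.notMem_support_iff] at h
    simp [h]

end Grid

/-! ### The convolution algebra, its corners and its spanning elements. -/

section ConvolutionAlgebra

variable (q : Set.Ioo (0 : ℝ) 1) (a : ℝ)

lemma mk_phi_mul_mk_phi (m n : ℤ) (y x : Oq q) :
    Smash.mk y (phi q a m) * Smash.mk x (phi q a n) =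
      Smash.mk (y * rightComp q a n m x) (phi q a n) := by
  rw [Smash.mk_eq y, mul_assoc, phi_mul_mk, Smash.mk_one_mul]

lemma mul_mem_podles {x y : Oq q} (hx : x ∈ podles q a) (hy : y ∈ podles q a) :
    x * y ∈ podles q a := by
  rw [podles_eq] at *
  exact mul_mem_leftDeg q a hx hy

lemma star_mem_podles {x : Oq q} (hx : x ∈ podles q a) : star x ∈ podles q a := by
  rw [podles_eq] at *
  exact star_mem_leftDeg q a hx

/-- The map `x ↦ x ω` to the smash product. -/
def mkRight (ω : FullDual (Oq q)) : Oq q →ₗ[ℂ] Smash (Oq q) :=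
  (TensorProduct.mk ℂ (Oq q) (FullDual (Oq q))).flip ω

lemma mkRight_apply (ω : FullDual (Oq q)) (x : Oq q) : mkRight q ω x = Smash.mk x ω := rfl

lemma mk_mem_span_ccGen (n : ℤ) {x : Oq q} (hx : x ∈ podles q a) :
    Smash.mk x (phi q a n) ∈ Submodule.span ℂ (ccGen q a) := by
  refine Submodule.subset_span ⟨x, hx, _, ?_, rfl⟩
  rw [coidealIc_eq]
  exact Submodule.subset_span ⟨n, rfl⟩

lemma span_ccGen : Submodule.span ℂ (ccGen q a) =
    Submodule.span ℂ {f | ∃ n : ℤ, ∃ x ∈ podles q a, Smash.mk x (phi q a n) = f} := by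
  refine le_antisymm (Submodule.span_le.2 ?_) (Submodule.span_le.2 ?_)
  · rintro _ ⟨x, hx, ω, hω, rfl⟩
    rw [coidealIc_eq] at hω
    have : Submodule.span ℂ (Set.range (phi q a)) ≤ (Submodule.span ℂ {f | ∃ n : ℤ,
        ∃ x ∈ podles q a, Smash.mk x (phi q a n) = f}).comap
        (TensorProduct.mk ℂ (Oq q) (FullDual (Oq q)) x) := by
      refine Submodule.span_le.2 ?_
      rintro _ ⟨n, rfl⟩
      exact Submodule.subset_span ⟨n, x, hx, rfl⟩
    exact this hω
  · rintro _ ⟨n, x, hx, rfl⟩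
    exact mk_mem_span_ccGen q a n hx

/-- For right homogeneous b, (b Φ_n)^* has its projection Φ_m on the right again with a factor from
B in front; general b is a sum of such elements. -/
lemma star_mk_phi_mem (n : ℤ) {x : Oq q} (hx : x ∈ podles q a) :
    star (Smash.mk x (phi q a n)) ∈ Submodule.span ℂ (ccGen q a) := by
  obtain ⟨p, hp⟩ := exists_eq_sum_loopElt q a n hx
  rw [← mkRight_apply, hp, map_sum, star_sum]
  refine Submodule.sum_mem _ fun i _ => ?_
  rw [mkRight_apply, star_mk_of_mem q a (loopElt_mul_mem_rightDeg q a n i _)]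
  exact mk_mem_span_ccGen q a _
    (rightComp_mem q a _ _ (star_mem_podles q a (loopElt_mul_mem_podles q a n i _)))

/-- The linear span of the products `b ω`, as a `*`-subalgebra. -/
def ccSpan : NonUnitalStarSubalgebra ℂ (Smash (Oq q)) where
  __ := Submodule.span ℂ (ccGen q a)
  mul_mem' {f g} hf hg := by
    change f ∈ Submodule.span ℂ (ccGen q a) at hf
    change g ∈ Submodule.span ℂ (ccGen q a) at hg
    change f * g ∈ Submodule.span ℂ (ccGen q a)
    rw [span_ccGen] at hf hg
    induction hf using Submodule.span_induction with
    | zero => rw [zero_mul]; exact zero_mem _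
    | add f f' _ _ h h' => rw [add_mul]; exact add_mem h h'
    | smul r f _ h => rw [smul_mul_assoc]; exact Submodule.smul_mem _ _ h
    | mem f hf =>
      obtain ⟨m, y, hy, rfl⟩ := hf
      induction hg using Submodule.span_induction with
      | zero => rw [mul_zero]; exact zero_mem _
      | add g g' _ _ h h' => rw [mul_add]; exact add_mem h h'
      | smul r g _ h => rw [mul_smul_comm]; exact Submodule.smul_mem _ _ h
      | mem g hg =>
        obtain ⟨n, x, hx, rfl⟩ := hg
        rw [mk_phi_mul_mk_phi]
        exact mk_mem_span_ccGen q a n (mul_mem_podles q a hy (rightComp_mem q a n m hx))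
  star_mem' {f} hf := by
    change f ∈ Submodule.span ℂ (ccGen q a) at hf
    change star f ∈ Submodule.span ℂ (ccGen q a)
    rw [span_ccGen] at hf
    induction hf using Submodule.span_induction with
    | zero => rw [star_zero]; exact zero_mem _
    | add f f' _ _ h h' => rw [star_add]; exact add_mem h h'
    | smul r f _ h => rw [star_smul]; exact Submodule.smul_mem _ _ h
    | mem f hf =>
      obtain ⟨n, x, hx, rfl⟩ := hf
      exact star_mk_phi_mem q a n hx

/-- Every element of the convolution algebra is a sum of products `b ω`. -/
lemma coe_Cc : (Cc q a : Set (Smash (Oq q))) = Submodule.span ℂ (ccGen q a) := by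
  refine Set.Subset.antisymm ?_ ?_
  · exact (NonUnitalStarAlgebra.adjoin_le (S := ccSpan q a) Submodule.subset_span :
      Cc q a ≤ ccSpan q a)
  · change Submodule.span ℂ (ccGen q a) ≤ (Cc q a).toSubmodule
    exact Submodule.span_le.2 (NonUnitalStarAlgebra.subset_adjoin ℂ _)

/-- The element `x Φ_n` of the convolution algebra. -/
def ccMk (n : ℤ) : podles q a →ₗ[ℂ] Cc q a where
  toFun x := ⟨Smash.mk (x : Oq q) (phi q a n), by
    rw [← SetLike.mem_coe, coe_Cc]
    exact mk_mem_span_ccGen q a n x.2⟩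
  map_add' x y := Subtype.ext (map_add (mkRight q (phi q a n)) (x : Oq q) y)
  map_smul' r x := Subtype.ext (map_smul (mkRight q (phi q a n)) r (x : Oq q))

lemma iSup_range_ccMk : ⨆ n, LinearMap.range (ccMk q a n) = ⊤ := by
  rw [eq_top_iff]
  rintro ⟨f, hf⟩ -
  have h1 := hf
  rw [← SetLike.mem_coe, coe_Cc, SetLike.mem_coe, span_ccGen] at h1
  have h2 : Submodule.span ℂ {f | ∃ n : ℤ, ∃ x ∈ podles q a, Smash.mk x (phi q a n) = f} ≤
      (⨆ n, LinearMap.range (ccMk q a n)).map (Cc q a).toSubmodule.subtype := by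
    refine Submodule.span_le.2 ?_
    rintro _ ⟨n, x, hx, rfl⟩
    exact ⟨ccMk q a n ⟨x, hx⟩, Submodule.mem_iSup_of_mem n ⟨_, rfl⟩, rfl⟩
  obtain ⟨g, hg, hgf⟩ := h2 h1
  have : g = ⟨f, hf⟩ := Subtype.ext hgf
  rwa [← this]

variable {q a} in
lemma Cc.induction {p : Cc q a → Prop} (f : Cc q a) (zero : p 0)
    (add : ∀ f g, p f → p g → p (f + g)) (mk : ∀ n x, p (ccMk q a n x)) : p f := by
  have : f ∈ ⨆ n, LinearMap.range (ccMk q a n) := by rw [iSup_range_ccMk]; trivial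
  refine Submodule.iSup_induction _ (motive := p) this ?_ zero add
  rintro n _ ⟨x, rfl⟩
  exact mk n x

/-- The unit `Φ_n` of a block, as an element of the convolution algebra. -/
def ccPhi (n : ℤ) : Cc q a := ccMk q a n ⟨1, one_mem_podles q a⟩

@[simp] lemma coe_ccPhi (n : ℤ) : (ccPhi q a n : Smash (Oq q)) = Smash.mk 1 (phi q a n) := rfl

variable {q a} in
lemma phiElt_eq {n : ℤ} {p : FullDual (Oq q)} (hp : IsPhi q a n p) : phiElt q hp = ccPhi q a n := by
  obtain rfl := hp.eq_phi
  rfl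

lemma star_ccPhi (n : ℤ) : star (ccPhi q a n) = ccPhi q a n := by
  refine Subtype.ext ?_
  change star (Smash.mk 1 (phi q a n)) = Smash.mk 1 (phi q a n)
  rw [Smash.star_mk, dualStar_phi, star_one, ← Smash.one_def, mul_one]

lemma ccPhi_mul_ccPhi (m n : ℤ) :
    ccPhi q a m * ccPhi q a n = if m = n then ccPhi q a n else 0 := by
  refine Subtype.ext ?_
  change Smash.mk 1 (phi q a m) * Smash.mk 1 (phi q a n) = _
  rw [phi_mul_mk_of_mem q a (one_mem_rightDeg q a n)]
  by_cases h : n = m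
  · rw [if_pos h, if_pos h.symm]; rfl
  · rw [if_neg h, if_neg (Ne.symm h)]; rfl

lemma ccMk_mul_ccPhi (m n : ℤ) (x : podles q a) :
    ccMk q a m x * ccPhi q a n = if m = n then ccMk q a m x else 0 := by
  refine Subtype.ext ?_
  change Smash.mk (x : Oq q) (phi q a m) * Smash.mk 1 (phi q a n) = _
  rw [mk_mul_mk_of_mem q a (one_mem_rightDeg q a n), mul_one]
  by_cases h : n = m
  · rw [if_pos h, if_pos h.symm, h]; rfl
  · rw [if_neg h, if_neg (Ne.symm h)]; rfl

/-- Stating it for all larger sets F' allows the two finite sets belonging to a sum to be merged. -/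
lemma exists_eq_sum_mul_ccPhi (f : Cc q a) :
    ∃ F : Finset ℤ, ∀ F', F ⊆ F' → ∑ n ∈ F', f * ccPhi q a n = f := by
  refine Cc.induction (p := fun f => ∃ F : Finset ℤ, ∀ F', F ⊆ F' →
    ∑ n ∈ F', f * ccPhi q a n = f) f ⟨∅, by simp⟩ ?_ ?_
  · rintro f g ⟨F, hF⟩ ⟨G, hG⟩
    refine ⟨F ∪ G, fun F' h => ?_⟩
    simp only [add_mul, Finset.sum_add_distrib]
    rw [hF F' (Finset.union_subset_left h), hG F' (Finset.union_subset_right h)]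
  · intro n x
    refine ⟨{n}, fun F' h => ?_⟩
    simp only [ccMk_mul_ccPhi]
    rw [Finset.sum_ite_eq, if_pos (h (Finset.mem_singleton_self n))]

lemma exists_ccMk_of_mul_ccPhi (n : ℤ) (f : Cc q a) : ∃ x, f * ccPhi q a n = ccMk q a n x := by
  refine Cc.induction (p := fun f => ∃ x, f * ccPhi q a n = ccMk q a n x) f
    ⟨0, by rw [zero_mul, map_zero]⟩ ?_ ?_
  · rintro f g ⟨x, hx⟩ ⟨y, hy⟩
    exact ⟨x + y, by rw [add_mul, hx, hy, map_add]⟩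
  · intro m x
    rw [ccMk_mul_ccPhi]
    split_ifs with h
    · exact ⟨x, by rw [h]⟩
    · exact ⟨0, by rw [map_zero]⟩

/-- The element `p(Ω) Φ_n`, where `Ω` is the Casimir element. -/
def casElt (n : ℤ) : Polynomial ℂ →ₗ[ℂ] Smash (Oq q) :=
  mkRight q (phi q a n) ∘ₗ (Polynomial.aeval (cas q a 0 n)).toLinearMap

lemma casElt_apply (n : ℤ) (p : Polynomial ℂ) :
    casElt q a n p = Smash.mk (Polynomial.aeval (cas q a 0 n) p) (phi q a n) := rfl

lemma casElt_one (n : ℤ) : casElt q a n 1 = Smash.mk 1 (phi q a n) := by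
  rw [casElt_apply, map_one]

lemma mk_mul_casElt (n : ℤ) (x : Oq q) (p : Polynomial ℂ) :
    Smash.mk x (phi q a n) * casElt q a n p =
      Smash.mk (x * Polynomial.aeval (cas q a 0 n) p) (phi q a n) := by
  rw [casElt_apply, mk_mul_mk_of_mem q a (aeval_cas_mem_rightDeg q a 0 n p), if_pos rfl]

lemma casElt_mul (n : ℤ) (p p' : Polynomial ℂ) :
    casElt q a n p * casElt q a n p' = casElt q a n (p * p') := by
  rw [casElt_apply, mk_mul_casElt, casElt_apply, map_mul]

/-- It suffices that Ω Φ_n is self-adjoint: rΩΦ_n + cΦ_n has the form T^* T for a step T, with r and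
c real and r ≠ 0. -/
lemma star_casElt (n : ℤ) (p : Polynomial ℂ) :
    star (casElt q a n p) = casElt q a n (p.map (starRingEnd ℂ)) := by
  have h1 : star (casElt q a n 1) = casElt q a n 1 := by
    rw [casElt_one, Smash.star_mk, dualStar_phi, star_one, ← Smash.one_def, mul_one]
  have hX : star (casElt q a n Polynomial.X) = casElt q a n Polynomial.X := by
    obtain ⟨r, c, hr, -, h⟩ := star_step_mul_step q a true true 0 n
    have e : Smash.mk ((r : ℂ) • cas q a 0 n + (c : ℂ) • 1) (phi q a n) =
        (r : ℂ) • casElt q a n Polynomial.X + (c : ℂ) • casElt q a n 1 := by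
      rw [← map_smul, ← map_smul, ← map_add, casElt_apply, map_add, map_smul, map_smul, map_one,
        Polynomial.aeval_X]
    rw [e] at h
    have h' := congrArg star h
    rw [star_mul, star_star, h, star_add, star_smul, star_smul, h1, Complex.star_def,
      Complex.conj_ofReal, Complex.conj_ofReal, add_left_inj] at h'
    exact (smul_right_injective _ (by exact_mod_cast hr) h').symm
  induction p using Polynomial.induction_on with
  | C r =>
    rw [Polynomial.map_C, ← mul_one (Polynomial.C r), ← Polynomial.smul_eq_C_mul, map_smul,
      star_smul, h1, ← mul_one (Polynomial.C _), ← Polynomial.smul_eq_C_mul, map_smul]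
    rfl
  | add p p' h h' => rw [map_add, star_add, h, h', Polynomial.map_add, map_add]
  | monomial k r h =>
    rw [pow_succ, ← mul_assoc, ← casElt_mul, star_mul, h, hX, casElt_mul,
      Polynomial.map_mul (p := _ * _) (q := Polynomial.X), Polynomial.map_X, mul_comm]

lemma exists_ccPhi_mul_mul_ccPhi (n : ℤ) (f : Cc q a) : ∃ p : Polynomial ℂ,
    Smash.mk 1 (phi q a n) * (f : Smash (Oq q)) * Smash.mk 1 (phi q a n) = casElt q a n p := by
  obtain ⟨x, hx⟩ := exists_ccMk_of_mul_ccPhi q a n f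
  have hx' : (f : Smash (Oq q)) * Smash.mk 1 (phi q a n) = Smash.mk (x : Oq q) (phi q a n) :=
    congrArg Subtype.val hx
  obtain ⟨p, hp⟩ := exists_rightComp_self q a n x.2
  exact ⟨p, by rw [mul_assoc, hx', phi_mul_mk, hp, casElt_apply]⟩

/-- Both corner elements are polynomials in the Casimir times Φ_n. -/
lemma ccPhi_corner_comm (n : ℤ) (f g : Cc q a) :
    (ccPhi q a n * f * ccPhi q a n) * (ccPhi q a n * g * ccPhi q a n) =
      (ccPhi q a n * g * ccPhi q a n) * (ccPhi q a n * f * ccPhi q a n) := by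
  obtain ⟨p, hp⟩ := exists_ccPhi_mul_mul_ccPhi q a n f
  obtain ⟨p', hp'⟩ := exists_ccPhi_mul_mul_ccPhi q a n g
  refine Subtype.ext ?_
  change (Smash.mk 1 (phi q a n) * (f : Smash (Oq q)) * Smash.mk 1 (phi q a n)) *
      (Smash.mk 1 (phi q a n) * (g : Smash (Oq q)) * Smash.mk 1 (phi q a n)) =
    (Smash.mk 1 (phi q a n) * (g : Smash (Oq q)) * Smash.mk 1 (phi q a n)) *
      (Smash.mk 1 (phi q a n) * (f : Smash (Oq q)) * Smash.mk 1 (phi q a n))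
  rw [hp, hp', casElt_mul, casElt_mul, mul_comm]

/-- The convolution algebra is spanned by elements `f` for which a sum `f^* f + ⋯` is a multiple of
`Φ_n`. -/
lemma span_dominated : Submodule.span ℂ {f : Cc q a | ∃ (n : ℤ) (c : ℝ) (ι : Type) (_ : Fintype ι)
    (h : ι → Cc q a), f ∈ Set.range h ∧ ∑ i, star (h i) * h i = (c : ℂ) • ccPhi q a n} = ⊤ := by
  set V := Submodule.span ℂ {f : Cc q a | ∃ (n : ℤ) (c : ℝ) (ι : Type) (_ : Fintype ι)
    (h : ι → Cc q a), f ∈ Set.range h ∧ ∑ i, star (h i) * h i = (c : ℂ) • ccPhi q a n}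
  -- Adjoints of frame members are used because (y^* Φ)^* (y^* Φ) = Φ y y^* Φ, and y y^* is what a
  -- frame sums to a scalar.
  have key : ∀ n, ∀ x ∈ frameSpan q a 0 0, ∀ hx : star x ∈ podles q a,
      ccMk q a n ⟨star x, hx⟩ ∈ V := by
    intro n x hx
    induction hx using Submodule.span_induction with
    | zero =>
      intro hx
      have : (⟨star 0, hx⟩ : podles q a) = 0 := Subtype.ext (star_zero _)
      rw [this, map_zero]
      exact zero_mem _
    | add x y hx hy ihx ihy =>
      intro hxy
      have hx' : star x ∈ podles q a := by
        rw [podles_eq]; exact star_mem_leftDeg q a (by rwa [← frameSpan_eq])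
      have hy' : star y ∈ podles q a := by
        rw [podles_eq]; exact star_mem_leftDeg q a (by rwa [← frameSpan_eq])
      have : (⟨star (x + y), hxy⟩ : podles q a) = ⟨star x, hx'⟩ + ⟨star y, hy'⟩ :=
        Subtype.ext (star_add _ _)
      rw [this, map_add]
      exact add_mem (ihx hx') (ihy hy')
    | smul r x hx ih =>
      intro hrx
      have hx' : star x ∈ podles q a := by
        rw [podles_eq]; exact star_mem_leftDeg q a (by rwa [← frameSpan_eq])
      have : (⟨star (r • x), hrx⟩ : podles q a) = star r • ⟨star x, hx'⟩ :=
        Subtype.ext (star_smul _ _)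
      rw [this, map_smul]
      exact Submodule.smul_mem _ _ (ih hx')
    | mem x hx =>
      obtain ⟨ι, hι, y, C, hy, i, rfl⟩ := hx
      intro hi
      have hy' : ∀ i, star (y i) ∈ podles q a := fun i => by rw [podles_eq]; exact hy.star_mem i
      refine Submodule.subset_span ⟨n, C, ι, hι, fun i => ccMk q a n ⟨star (y i), hy' i⟩, ⟨i, rfl⟩,
        Subtype.ext ?_⟩
      have e : ∀ i, star (Smash.mk (star (y i)) (phi q a n)) * Smash.mk (star (y i)) (phi q a n) =
          Smash.mk 1 (phi q a n) * mkRight q (phi q a n) (y i * star (y i)) := by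
        intro i
        rw [Smash.star_mk, star_star, dualStar_phi, mul_assoc, Smash.mk_one_mul, mkRight_apply]
      have e2 : ((∑ i, star (ccMk q a n ⟨star (y i), hy' i⟩) * ccMk q a n ⟨star (y i), hy' i⟩ :
          Cc q a) : Smash (Oq q)) = ∑ i, star (Smash.mk (star (y i)) (phi q a n)) *
            Smash.mk (star (y i)) (phi q a n) := by
        rw [AddSubmonoidClass.coe_finsetSum]
        rfl
      rw [e2]
      simp only [e]
      rw [← Finset.mul_sum, ← map_sum, hy.sum_eq, map_smul, mul_smul_comm, mkRight_apply,
        phi_mul_mk_of_mem q a (one_mem_rightDeg q a n), if_pos rfl]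
      rfl
  rw [eq_top_iff]
  rintro f -
  refine Cc.induction (p := fun f => f ∈ V) f (zero_mem _) (fun f g => add_mem) fun n x => ?_
  have hx : star (x : Oq q) ∈ frameSpan q a 0 0 := by
    rw [frameSpan_eq, ← podles_eq]; exact star_mem_podles q a x.2
  have hx' : star (star (x : Oq q)) ∈ podles q a := by rw [star_star]; exact x.2
  have : x = ⟨star (star (x : Oq q)), hx'⟩ := Subtype.ext (star_star _).symm
  rw [this]
  exact key n _ hx hx'

end ConvolutionAlgebra

/-! ### Positive functionals from evaluating the Casimir. -/

section States

open scoped ComplexOrder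

variable (q : Set.Ioo (0 : ℝ) 1) (a : ℝ)

/-- The values on the generators of the character with `α ↦ z` and `γ ↦ 0`. -/
def torusGen (z : ℂˣ) : Gen → ℂ
  | .al => z
  | .als => (z : ℂ)⁻¹
  | .ga => 0
  | .gas => 0

lemma isSUq2_torusGen (z : ℂˣ) : IsSUq2 ((q : ℝ) : ℂ) (torusGen z) := by
  have hz := z.ne_zero
  constructor <;> simp [torusGen, hz]

/-- The character with `α ↦ z` and `γ ↦ 0`. -/
def torusChar (z : ℂˣ) : Oq q →ₐ[ℂ] ℂ := Oq.lift (torusGen z) (isSUq2_torusGen q z)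

lemma torusChar_cas (z : ℂˣ) (l n : ℤ) :
    torusChar q z (cas q a l n) = (z : ℂ) ^ 2 + ((q : ℝ) : ℂ) ^ 2 * ((z : ℂ)⁻¹) ^ 2 := by
  simp only [cas, casimir, map_add, map_sub, map_mul, map_smul, torusChar, Oq.lift_gen, torusGen,
    smul_eq_mul, mul_zero, zero_mul, add_zero, sub_zero]
  ring

/-- A character that kills γ sends Ω to z² + q² z⁻², so z² must be a root of u² - ru + q². Such a
root is nonzero because q is. -/
lemma exists_torusChar_cas (r : ℂ) : ∃ z : ℂˣ, ∀ l n, torusChar q z (cas q a l n) = r := by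
  have hq := Oq.q_ne_zero q
  obtain ⟨u, hu⟩ := IsAlgClosed.exists_root
    (Polynomial.X ^ 2 - Polynomial.C r * Polynomial.X + Polynomial.C (((q : ℝ) : ℂ) ^ 2))
    (by
      have : (Polynomial.X ^ 2 - Polynomial.C r * Polynomial.X +
        Polynomial.C (((q : ℝ) : ℂ) ^ 2)).degree = 2 := by compute_degree!
      rw [this]; decide)
  simp only [Polynomial.IsRoot.def, Polynomial.eval_add, Polynomial.eval_sub, Polynomial.eval_pow,
    Polynomial.eval_X, Polynomial.eval_mul, Polynomial.eval_C] at hu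
  obtain ⟨z, hz⟩ := IsAlgClosed.exists_pow_nat_eq u two_pos
  have hz0 : z ≠ 0 := by
    rintro rfl
    have : u = 0 := by rw [← hz]; simp
    rw [this] at hu
    simp [hq] at hu
  refine ⟨Units.mk0 z hz0, fun l n => ?_⟩
  rw [torusChar_cas, Units.val_mk0]
  field_simp
  rw [← hz] at hu
  linear_combination hu

/-- The functional `x ω ↦ χ(x) ω(e)` on the smash product, for a character `χ`. -/
def smashEval (z : ℂˣ) (e : Oq q) : Smash (Oq q) →ₗ[ℂ] ℂ :=
  TensorProduct.lift (LinearMap.mk₂ ℂ (fun x (ω : FullDual (Oq q)) => torusChar q z x * ω e)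
    (fun x y ω => by rw [map_add, add_mul])
    (fun r x ω => by rw [map_smul, smul_mul_assoc])
    (fun x ω ω' => by rw [← mul_add]; rfl)
    (fun r x ω => by rw [← mul_smul_comm]; rfl))

lemma smashEval_casElt (z : ℂˣ) (e : Oq q) (n : ℤ) (p : Polynomial ℂ) :
    smashEval q z e (casElt q a n p) =
      p.eval (torusChar q z (cas q a 0 n)) * phi q a n e := by
  have : smashEval q z e (casElt q a n p) =
    torusChar q z (Polynomial.aeval (cas q a 0 n) p) * phi q a n e := rfl
  rw [this, ← Polynomial.aeval_algHom_apply, Polynomial.coe_aeval_eq_eval]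

/-- The inclusion of the convolution algebra in the smash product. -/
def ccVal : Cc q a →ₗ[ℂ] Smash (Oq q) where
  toFun f := f
  map_add' _ _ := rfl
  map_smul' _ _ := rfl

/-- Evaluation of the corner at `Φ_n` at a point of the spectrum of the Casimir element. -/
lemma exists_cornerEval (n : ℤ) (r : ℂ) : ∃ χ : Cc q a →ₗ[ℂ] ℂ,
    ∀ (f : Cc q a) p,
    Smash.mk 1 (phi q a n) * (f : Smash (Oq q)) * Smash.mk 1 (phi q a n) = casElt q a n p →
    χ f = p.eval r := by
  obtain ⟨z, hz⟩ := exists_torusChar_cas q a r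
  obtain ⟨e, he⟩ : ∃ e, phi q a n e ≠ 0 := by
    by_contra! h
    refine phi_ne_zero q a n ?_
    ext x
    exact h x
  -- The functional is defined on the whole smash product, by a character on A and evaluation at e
  -- on the dual. Hence p(Ω)Φ_n determines p(r), without a separate proof that p is unique.
  refine ⟨(phi q a n e)⁻¹ • (smashEval q z e ∘ₗ LinearMap.mulLeft ℂ (Smash.mk 1 (phi q a n)) ∘ₗ
    LinearMap.mulRight ℂ (Smash.mk 1 (phi q a n)) ∘ₗ ccVal q a), ?_⟩
  intro f p hp
  have : ((phi q a n e)⁻¹ • (smashEval q z e ∘ₗ LinearMap.mulLeft ℂ (Smash.mk 1 (phi q a n)) ∘ₗ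
    LinearMap.mulRight ℂ (Smash.mk 1 (phi q a n)) ∘ₗ ccVal q a)) f =
    (phi q a n e)⁻¹ * smashEval q z e (Smash.mk 1 (phi q a n) * ((f : Smash (Oq q)) *
      Smash.mk 1 (phi q a n))) := rfl
  rw [this, ← mul_assoc, hp, smashEval_casElt, hz]
  field_simp

variable {q} in
-- At a real point the product is |s(x)|² p(x).
lemma PosPoly.conj_mul_mul {p : Polynomial ℂ} (hp : PosPoly q p) (s : Polynomial ℂ) {x : ℝ}
    (hx : x ^ 2 < 4 * (q : ℝ) ^ 2) : ∃ r : ℝ, 0 ≤ r ∧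
      (s.map (starRingEnd ℂ) * p * s).eval (x : ℂ) = r ∧ (s.eval (x : ℂ) ≠ 0 → 0 < r) := by
  obtain ⟨r, hr, e⟩ := hp x hx
  have h : (s.map (starRingEnd ℂ)).eval (x : ℂ) = conj (s.eval (x : ℂ)) := by
    rw [← Polynomial.eval_map_apply, Complex.conj_ofReal]
  refine ⟨‖s.eval (x : ℂ)‖ ^ 2 * r, by positivity, ?_, fun h => by positivity⟩
  rw [Polynomial.eval_mul, Polynomial.eval_mul, e, h]
  push_cast
  rw [← Complex.conj_mul']
  ring

/-- The two elements have different right degrees, so they are cut out by orthogonal projections. -/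
lemma star_mul_self_loop (n i j : ℤ) (s s' : Polynomial ℂ) : i ≠ j →
    star (Smash.mk (loopElt q a n i * Polynomial.aeval (cas q a 0 n) s) (phi q a n)) *
      Smash.mk (loopElt q a n j * Polynomial.aeval (cas q a 0 n) s') (phi q a n) = 0 := by
  intro hij
  have h1 := phi_mul_mk_of_mem (m' := n + 2 * i) q a (loopElt_mul_mem_rightDeg q a n i s)
  have h2 := phi_mul_mk_of_mem (m' := n + 2 * i) q a (loopElt_mul_mem_rightDeg q a n j s')
  rw [if_pos rfl] at h1
  rw [if_neg (by lia)] at h2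
  rw [← h1, star_mul, mul_assoc, Smash.star_mk 1, dualStar_phi, star_one, ← Smash.one_def, mul_one,
    h2, mul_zero]

/-- Expanding f Φ_n in the paths T_i, cross terms vanish by orthogonality and the diagonal terms are
s̄_i p_i s_i evaluated at Ω. -/
lemma exists_corner_star_mul_self (n : ℤ) (f : Cc q a) : ∃ s : ℤ →₀ Polynomial ℂ,
    ∃ p : ℤ → Polynomial ℂ, (∀ i, PosPoly q (p i)) ∧ (s = 0 → f * ccPhi q a n = 0) ∧
    Smash.mk 1 (phi q a n) * ((star f * f : Cc q a) : Smash (Oq q)) * Smash.mk 1 (phi q a n) =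
      casElt q a n (∑ i ∈ s.support, (s i).map (starRingEnd ℂ) * p i * s i) := by
  obtain ⟨x, hx⟩ := exists_ccMk_of_mul_ccPhi q a n f
  have hx' : (f : Smash (Oq q)) * Smash.mk 1 (phi q a n) = Smash.mk (x : Oq q) (phi q a n) :=
    congrArg Subtype.val hx
  obtain ⟨s, hs⟩ := exists_eq_sum_loopElt q a n x.2
  choose p hp hp' using fun i => (isPath_loopElt q a n i).star_mul_self
  refine ⟨s, p, hp, fun h => ?_, ?_⟩
  · have : x = 0 := Subtype.ext (by rw [hs, h]; simp)
    rw [hx, this, map_zero]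
  · have h1 : Smash.mk 1 (phi q a n) * ((star f * f : Cc q a) : Smash (Oq q)) *
        Smash.mk 1 (phi q a n) = star (Smash.mk (x : Oq q) (phi q a n)) *
        Smash.mk (x : Oq q) (phi q a n) := by
      rw [← hx', star_mul, Smash.star_mk 1, dualStar_phi, star_one, ← Smash.one_def, mul_one]
      change _ * (star (f : Smash (Oq q)) * (f : Smash (Oq q))) * _ = _
      simp only [mul_assoc]
    rw [h1, hs, ← mkRight_apply, map_sum, star_sum, Finset.sum_mul_sum, map_sum]
    refine Finset.sum_congr rfl fun i hi => ?_
    rw [Finset.sum_eq_single i]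
    · rw [mkRight_apply, ← mk_mul_casElt, star_mul, star_casElt, mul_assoc, ← mul_assoc (star _),
        hp', ← casElt_apply, casElt_mul, casElt_mul, mul_assoc]
    · intro j _ hj
      exact star_mul_self_loop q a n i j _ _ hj.symm
    · intro h
      exact absurd hi h

lemma infinite_interval : {z : ℂ | ∃ x : ℝ, x ^ 2 < 4 * (q : ℝ) ^ 2 ∧ (x : ℂ) = z}.Infinite := by
  have hq := q.2.1
  have h1 : (Set.Ioo (0 : ℝ) (2 * q)).Infinite := Set.Ioo_infinite (by linarith)
  refine (h1.image (f := fun x : ℝ => (x : ℂ)) Complex.ofReal_injective.injOn).mono ?_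
  rintro _ ⟨x, hx, rfl⟩
  exact ⟨x, by nlinarith [hx.1, hx.2], rfl⟩

/-- The corners of the convolution algebra have enough positive characters. -/
lemma exists_state {f : Cc q a} (hf : f ≠ 0) : ∃ n : ℤ, ∃ χ : Cc q a →ₗ[ℂ] ℂ,
    χ (ccPhi q a n) = 1 ∧ (∀ g h, χ (g * ccPhi q a n * h) = χ g * χ h) ∧
    (∀ g, 0 ≤ χ (star g * g)) ∧ χ (star f * f) ≠ 0 := by
  obtain ⟨n, hn⟩ : ∃ n, f * ccPhi q a n ≠ 0 := by
    by_contra! h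
    obtain ⟨F, hF⟩ := exists_eq_sum_mul_ccPhi q a f
    refine hf ?_
    rw [← hF F subset_rfl]
    exact Finset.sum_eq_zero fun n _ => h n
  obtain ⟨s, p, hp, hs, hfs⟩ := exists_corner_star_mul_self q a n f
  obtain ⟨i, hi⟩ : ∃ i, s i ≠ 0 := by
    by_contra! h
    exact hn (hs (Finsupp.ext h))
  -- The interval is infinite, so it contains a point that is not a root of the nonzero polynomial
  -- s_i.
  obtain ⟨_, ⟨x, hx, rfl⟩, hxi⟩ : ∃ z ∈ {z : ℂ | ∃ x : ℝ, x ^ 2 < 4 * (q : ℝ) ^ 2 ∧ (x : ℂ) = z},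
      (s i).eval z ≠ 0 := by
    by_contra! h
    exact hi (Polynomial.eq_zero_of_infinite_isRoot _ ((infinite_interval q).mono h))
  obtain ⟨χ, hχ⟩ := exists_cornerEval q a n (x : ℂ)
  refine ⟨n, χ, ?_, ?_, ?_, ?_⟩
  · rw [hχ _ 1, Polynomial.eval_one]
    rw [coe_ccPhi, casElt_one, phi_mul_mk_of_mem q a (one_mem_rightDeg q a n), if_pos rfl,
      phi_mul_mk_of_mem q a (one_mem_rightDeg q a n), if_pos rfl]
  · intro g h
    obtain ⟨u, hu⟩ := exists_ccPhi_mul_mul_ccPhi q a n g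
    obtain ⟨v, hv⟩ := exists_ccPhi_mul_mul_ccPhi q a n h
    rw [hχ _ _ hu, hχ _ _ hv, hχ _ (u * v), Polynomial.eval_mul]
    have h1 : Smash.mk 1 (phi q a n) * Smash.mk 1 (phi q a n) = Smash.mk 1 (phi q a n) := by
      rw [phi_mul_mk_of_mem q a (one_mem_rightDeg q a n), if_pos rfl]
    rw [← casElt_mul, ← hu, ← hv]
    change _ * ((g : Smash (Oq q)) * Smash.mk 1 (phi q a n) * (h : Smash (Oq q))) * _ = _
    conv_lhs => rw [← h1]
    simp only [mul_assoc]
    conv_rhs => rw [← mul_assoc (Smash.mk 1 (phi q a n)) (Smash.mk 1 (phi q a n)), h1]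
    conv_lhs => rw [← mul_assoc (Smash.mk 1 (phi q a n)) (Smash.mk 1 (phi q a n)), h1]
    conv_lhs => rw [← mul_assoc (Smash.mk 1 (phi q a n)) (Smash.mk 1 (phi q a n)), h1]
  · intro g
    obtain ⟨s, p, hp, -, hgs⟩ := exists_corner_star_mul_self q a n g
    rw [hχ _ _ hgs, Polynomial.eval_finsetSum]
    refine Finset.sum_nonneg fun i _ => ?_
    obtain ⟨r, hr, e, -⟩ := (hp i).conj_mul_mul (s i) hx
    rw [e]
    exact_mod_cast hr
  · rw [hχ _ _ hfs, Polynomial.eval_finsetSum]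
    refine ne_of_gt (Finset.sum_pos' (fun j _ => ?_) ⟨i, by simpa using hi, ?_⟩)
    · obtain ⟨r, hr, e, -⟩ := (hp j).conj_mul_mul (s j) hx
      rw [e]
      exact_mod_cast hr
    · obtain ⟨r, -, e, hr⟩ := (hp i).conj_mul_mul (s i) hx
      rw [e]
      exact_mod_cast hr hxi

end States

/-! ### Corner systems and the GNS construction. -/

section CornerSystems

open scoped ComplexOrder InnerProductSpace
open UniformSpace

variable {I : Type} [DecidableEq I] {R : Type} [NonUnitalRing R] [StarRing R] [Module ℂ R]

/-- A positive functional on a `*`-algebra which is a normalized character of the corner at a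
projection `p`. -/
structure CornerState (p : R) where
  /-- The functional. -/
  toFun : R →ₗ[ℂ] ℂ
  map_proj : toFun p = 1
  map_mul : ∀ g h, toFun (g * p * h) = toFun g * toFun h
  nonneg : ∀ g, 0 ≤ toFun (star g * g)

/-- A family of orthogonal projections in a `*`-algebra with commutative corners, which determine
the bounded representations of the algebra. -/
structure IsCornerSystem (φ : I → R) : Prop where
  star_eq : ∀ n, star (φ n) = φ n
  mul_eq : ∀ m n, φ m * φ n = if m = n then φ n else 0
  exists_sum : ∀ f, ∃ F : Finset I, ∑ n ∈ F, f * φ n = f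
  corner_comm : ∀ n f g, (φ n * f * φ n) * (φ n * g * φ n) = (φ n * g * φ n) * (φ n * f * φ n)
  span_dominated : Submodule.span ℂ {f : R | ∃ (n : I) (c : ℝ) (ι : Type) (_ : Fintype ι)
    (h : ι → R), f ∈ Set.range h ∧ ∑ i, star (h i) * h i = (c : ℂ) • φ n} = ⊤
  exists_state : ∀ f, f ≠ 0 → ∃ n, ∃ χ : CornerState (φ n), χ.toFun (star f * f) ≠ 0

lemma IsCornerSystem.mul_self {φ : I → R} (hφ : IsCornerSystem φ) (n : I) :
    φ n * φ n = φ n := by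
  rw [hφ.mul_eq, if_pos rfl]

section GNS

variable {p : R} (χ : CornerState p)

/-- The algebra with the positive semidefinite inner product given by a positive functional. -/
@[nolint unusedArguments]
def PreGNS (_ : CornerState p) : Type := R

instance : AddCommGroup (PreGNS χ) := inferInstanceAs (AddCommGroup R)
instance : Module ℂ (PreGNS χ) := inferInstanceAs (Module ℂ R)

lemma CornerState.map_mul_proj (hp : p * p = p) (g : R) : χ.toFun (g * p) = χ.toFun g := by
  have := χ.map_mul g p
  rwa [mul_assoc, hp, χ.map_proj, mul_one] at this

lemma CornerState.map_proj_mul (hp : p * p = p) (g : R) : χ.toFun (p * g) = χ.toFun g := by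
  have := χ.map_mul p g
  rwa [hp, χ.map_proj, one_mul] at this

/-- The class of an element of the algebra. -/
def toPreGNS : R ≃ₗ[ℂ] PreGNS χ := LinearEquiv.refl ℂ R

variable [IsScalarTower ℂ R R] [SMulCommClass ℂ R R] [StarModule ℂ R]

/-- Polarization: the values at squares of g + h and g + ih are real. -/
lemma CornerState.conj_symm (g h : R) :
    conj (χ.toFun (star h * g)) = χ.toFun (star g * h) := by
  have him : ∀ g, (χ.toFun (star g * g)).im = 0 := fun g => (Complex.nonneg_iff.1 (χ.nonneg g)).2.symm
  have h1 := him (g + h)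
  have h2 := him (g + Complex.I • h)
  simp only [star_add, star_smul, add_mul, mul_add, map_add, smul_mul_assoc, mul_smul_comm,
    map_smul, Complex.add_im, him, Complex.star_def, Complex.conj_I, smul_eq_mul, Complex.mul_im,
    Complex.mul_re, Complex.neg_re, Complex.neg_im, Complex.I_re, Complex.I_im] at h1 h2
  apply Complex.ext
  · rw [Complex.conj_re]; linarith
  · rw [Complex.conj_im]; linarith

/-- The inner product given by a positive functional. -/
abbrev gnsCore : PreInnerProductSpace.Core ℂ (PreGNS χ) where
  inner g h := χ.toFun (star ((toPreGNS χ).symm g) * (toPreGNS χ).symm h)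
  conj_inner_symm g h := χ.conj_symm _ _
  re_inner_nonneg g := (Complex.nonneg_iff.1 (χ.nonneg _)).1
  add_left g h k := by rw [map_add, star_add, add_mul, map_add]
  smul_left g h r := by
    rw [map_smul, star_smul, smul_mul_assoc, map_smul, smul_eq_mul]; rfl

instance : SeminormedAddCommGroup (PreGNS χ) :=
  InnerProductSpace.Core.toSeminormedAddCommGroup (c := gnsCore χ)
instance : InnerProductSpace ℂ (PreGNS χ) := InnerProductSpace.ofCore (gnsCore χ)

lemma inner_toPreGNS (g h : R) :
    ⟪toPreGNS χ g, toPreGNS χ h⟫_ℂ = χ.toFun (star g * h) := rfl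

lemma norm_toPreGNS_sq (g : R) : ((‖toPreGNS χ g‖ ^ 2 : ℝ) : ℂ) = χ.toFun (star g * g) := by
  rw [← inner_toPreGNS, inner_self_eq_norm_sq_to_K]
  push_cast
  rfl

/-- The Hilbert space of a positive functional. -/
abbrev GNS : Type := Completion (PreGNS χ)

/-- The class of an element of the algebra in the Hilbert space. -/
def gnsVec (g : R) : GNS χ := (toPreGNS χ g : GNS χ)

lemma gnsVec_add (g h : R) : gnsVec χ (g + h) = gnsVec χ g + gnsVec χ h := by
  rw [gnsVec, map_add, Completion.coe_add]; rfl

lemma gnsVec_sub (g h : R) : gnsVec χ (g - h) = gnsVec χ g - gnsVec χ h := by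
  rw [gnsVec, map_sub, Completion.coe_sub]; rfl

lemma gnsVec_smul (r : ℂ) (g : R) : gnsVec χ (r • g) = r • gnsVec χ g := by
  rw [gnsVec, map_smul, Completion.coe_smul]; rfl

lemma inner_gnsVec (g h : R) : ⟪gnsVec χ g, gnsVec χ h⟫_ℂ = χ.toFun (star g * h) := by
  rw [gnsVec, gnsVec, Completion.inner_coe, inner_toPreGNS]

lemma denseRange_gnsVec : DenseRange (gnsVec χ) :=
  (Completion.denseRange_coe (α := PreGNS χ))

lemma gnsVec_eq {g h : R} (H : ∀ f, χ.toFun (star f * g) = χ.toFun (star f * h)) :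
    gnsVec χ g = gnsVec χ h := by
  rw [← sub_eq_zero, ← gnsVec_sub, ← inner_self_eq_zero (𝕜 := ℂ), inner_gnsVec, mul_sub, map_sub,
    H, sub_self]

end GNS

variable [IsScalarTower ℂ R R] [SMulCommClass ℂ R R] [StarModule ℂ R]

lemma norm_toPreGNS_proj_mul_sq_le {p : R} (χ : CornerState p) {e : R} (he : star e = e)
    (he' : e * e = e) (g : R) : ‖toPreGNS χ (e * g)‖ ^ 2 ≤ ‖toPreGNS χ g‖ ^ 2 := by
  have h1 : star g * g = star (e * g) * (e * g) + star (g - e * g) * (g - e * g) := by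
    have h2 : star g * e * e = star g * e := by rw [mul_assoc, he']
    simp only [star_sub, star_mul, he, mul_sub, sub_mul, ← mul_assoc, h2]
    abel
  have h2 := congrArg χ.toFun h1
  rw [map_add, ← norm_toPreGNS_sq, ← norm_toPreGNS_sq, ← norm_toPreGNS_sq, ← Complex.ofReal_add,
    Complex.ofReal_inj] at h2
  rw [h2]
  exact le_add_of_nonneg_right (by positivity)

/-- A positive functional on a general *-algebra need not give bounded operators. Here the algebra
is spanned by elements dominated by a multiple of a projection, and projections are contractive. -/
lemma IsCornerSystem.exists_norm_toPreGNS_mul_le {φ : I → R} (hφ : IsCornerSystem φ) {p : R}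
    (χ : CornerState p) (f : R) :
    ∃ C : ℝ, ∀ g, ‖toPreGNS χ (f * g)‖ ≤ C * ‖toPreGNS χ g‖ := by
  have hf : f ∈ (⊤ : Submodule ℂ R) := trivial
  rw [← hφ.span_dominated] at hf
  induction hf using Submodule.span_induction with
  | zero => exact ⟨0, fun g => by rw [zero_mul, map_zero, norm_zero, zero_mul]⟩
  | add f f' _ _ h h' =>
    obtain ⟨C, hC⟩ := h
    obtain ⟨C', hC'⟩ := h'
    refine ⟨C + C', fun g => ?_⟩
    rw [add_mul, map_add, add_mul]
    exact (norm_add_le _ _).trans (add_le_add (hC g) (hC' g))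
  | smul r f _ h =>
    obtain ⟨C, hC⟩ := h
    refine ⟨‖r‖ * C, fun g => ?_⟩
    rw [smul_mul_assoc, map_smul, norm_smul, mul_assoc]
    exact mul_le_mul_of_nonneg_left (hC g) (norm_nonneg r)
  | mem f hf =>
    obtain ⟨n, c, ι, _, h, ⟨i, rfl⟩, hc⟩ := hf
    -- The sign of c is not part of the hypothesis, hence the absolute value.
    refine ⟨√|c|, fun g => ?_⟩
    rw [← Real.sqrt_sq (norm_nonneg (toPreGNS χ g)), ← Real.sqrt_mul (abs_nonneg c)]
    refine Real.le_sqrt_of_sq_le ?_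
    have h1 : ∑ j, ‖toPreGNS χ (h j * g)‖ ^ 2 = c * ‖toPreGNS χ (φ n * g)‖ ^ 2 := by
      have h2 : ∑ j, star (h j * g) * (h j * g) = (c : ℂ) • (star (φ n * g) * (φ n * g)) := by
        have h3 : ∀ j, star (h j * g) * (h j * g) = star g * (star (h j) * h j) * g := fun j => by
          simp only [star_mul, mul_assoc]
        simp only [h3]
        rw [← Finset.sum_mul, ← Finset.mul_sum, hc, star_mul, hφ.star_eq, mul_smul_comm,
          smul_mul_assoc, mul_assoc, mul_assoc, ← mul_assoc (φ n), hφ.mul_self]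
      have h3 := congrArg χ.toFun h2
      rw [map_sum, map_smul, ← norm_toPreGNS_sq, smul_eq_mul] at h3
      simp only [← norm_toPreGNS_sq] at h3
      exact_mod_cast h3
    calc ‖toPreGNS χ (h i * g)‖ ^ 2 ≤ ∑ j, ‖toPreGNS χ (h j * g)‖ ^ 2 :=
          Finset.single_le_sum (f := fun j => ‖toPreGNS χ (h j * g)‖ ^ 2)
            (fun j _ => by positivity) (Finset.mem_univ i)
      _ = c * ‖toPreGNS χ (φ n * g)‖ ^ 2 := h1
      _ ≤ |c| * ‖toPreGNS χ (φ n * g)‖ ^ 2 :=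
          mul_le_mul_of_nonneg_right (le_abs_self c) (by positivity)
      _ ≤ |c| * ‖toPreGNS χ g‖ ^ 2 := mul_le_mul_of_nonneg_left
          (norm_toPreGNS_proj_mul_sq_le χ (hφ.star_eq n) (hφ.mul_self n) g) (abs_nonneg c)

/-- Left multiplication on the space of a positive functional. -/
def gnsMul {φ : I → R} (hφ : IsCornerSystem φ) {p : R} (χ : CornerState p) (f : R) :
    PreGNS χ →L[ℂ] PreGNS χ :=
  ((toPreGNS χ).toLinearMap ∘ₗ LinearMap.mulLeft ℂ f ∘ₗ
    (toPreGNS χ).symm.toLinearMap).mkContinuousOfExistsBound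
    (hφ.exists_norm_toPreGNS_mul_le χ f)

lemma gnsMul_toPreGNS {φ : I → R} (hφ : IsCornerSystem φ) {p : R} (χ : CornerState p) (f g : R) :
    gnsMul hφ χ f (toPreGNS χ g) = toPreGNS χ (f * g) := rfl

/-- Left multiplication on the Hilbert space of a positive functional. -/
def gnsOp {φ : I → R} (hφ : IsCornerSystem φ) {p : R} (χ : CornerState p) (f : R) :
    GNS χ →L[ℂ] GNS χ := (gnsMul hφ χ f).completion

lemma gnsOp_gnsVec {φ : I → R} (hφ : IsCornerSystem φ) {p : R} (χ : CornerState p)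
    (f g : R) : gnsOp hφ χ f (gnsVec χ g) = gnsVec χ (f * g) := by
  rw [gnsVec, gnsOp, ContinuousLinearMap.completion_apply_coe, gnsMul_toPreGNS]
  rfl

lemma gnsVec_ext {p : R} (χ : CornerState p) {E : Type*} [TopologicalSpace E] [T2Space E]
    {S T : GNS χ → E} (hS : Continuous S) (hT : Continuous T)
    (h : ∀ g, S (gnsVec χ g) = T (gnsVec χ g)) (x : GNS χ) : S x = T x :=
  congrFun ((denseRange_gnsVec χ).equalizer hS hT (funext h)) x

lemma gns_clm_ext {p : R} (χ : CornerState p) {S T : GNS χ →L[ℂ] GNS χ}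
    (h : ∀ g, S (gnsVec χ g) = T (gnsVec χ g)) : S = T :=
  ContinuousLinearMap.ext fun x => gnsVec_ext χ S.continuous T.continuous h x

lemma star_gnsOp {φ : I → R} (hφ : IsCornerSystem φ) {p : R} (χ : CornerState p) (f : R) :
    gnsOp hφ χ (star f) = star (gnsOp hφ χ f) := by
  refine (ContinuousLinearMap.eq_adjoint_iff _ _).2 fun x y => ?_
  refine gnsVec_ext χ (S := fun x => ⟪gnsOp hφ χ (star f) x, y⟫_ℂ)
    (T := fun x => ⟪x, gnsOp hφ χ f y⟫_ℂ)
    (Continuous.inner (gnsOp hφ χ (star f)).continuous continuous_const)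
    (Continuous.inner continuous_id continuous_const) (fun g => ?_) x
  refine gnsVec_ext χ (S := fun y => ⟪gnsOp hφ χ (star f) (gnsVec χ g), y⟫_ℂ)
    (T := fun y => ⟪gnsVec χ g, gnsOp hφ χ f y⟫_ℂ)
    (Continuous.inner continuous_const continuous_id)
    (Continuous.inner continuous_const (gnsOp hφ χ f).continuous) (fun h => ?_) y
  rw [gnsOp_gnsVec, gnsOp_gnsVec, inner_gnsVec, inner_gnsVec, star_mul, star_star, mul_assoc]

lemma gnsVec_zero {p : R} (χ : CornerState p) : gnsVec χ 0 = 0 := by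
  have := gnsVec_smul χ 0 0
  rwa [smul_zero, zero_smul] at this

/-- The representation on the Hilbert space of a positive functional. -/
def gnsRep {φ : I → R} (hφ : IsCornerSystem φ) {p : R} (χ : CornerState p) :
    R →⋆ₙₐ[ℂ] (GNS χ →L[ℂ] GNS χ) where
  toFun := gnsOp hφ χ
  map_smul' r f := gns_clm_ext χ fun g => by
    change _ = r • gnsOp hφ χ f (gnsVec χ g)
    rw [gnsOp_gnsVec, gnsOp_gnsVec, smul_mul_assoc, gnsVec_smul]
  map_zero' := gns_clm_ext χ fun g => by
    change _ = 0
    rw [gnsOp_gnsVec, zero_mul, gnsVec_zero]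
  map_add' f f' := gns_clm_ext χ fun g => by
    change _ = gnsOp hφ χ f (gnsVec χ g) + gnsOp hφ χ f' (gnsVec χ g)
    rw [gnsOp_gnsVec, gnsOp_gnsVec, gnsOp_gnsVec, add_mul, gnsVec_add]
  map_mul' f f' := gns_clm_ext χ fun g => by
    change _ = gnsOp hφ χ f (gnsOp hφ χ f' (gnsVec χ g))
    rw [gnsOp_gnsVec, gnsOp_gnsVec, gnsOp_gnsVec, mul_assoc]
  map_star' f := star_gnsOp hφ χ f

lemma gnsRep_gnsVec {φ : I → R} (hφ : IsCornerSystem φ) {p : R} (χ : CornerState p) (f g : R) :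
    gnsRep hφ χ f (gnsVec χ g) = gnsVec χ (f * g) := gnsOp_gnsVec hφ χ f g

lemma gnsVec_mul_proj {p : R} (hp : p * p = p) (χ : CornerState p) (f : R) :
    gnsVec χ (f * p) = gnsVec χ f :=
  gnsVec_eq χ fun g => by rw [← mul_assoc, χ.map_mul_proj hp]

/-- The functional is a character of the corner at p, so p acts as the rank one projection onto the
cyclic vector. -/
lemma gnsVec_proj_mul {p : R} (hp : p * p = p) (χ : CornerState p) (f : R) :
    gnsVec χ (p * f) = χ.toFun f • gnsVec χ p := by
  rw [← gnsVec_smul]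
  refine gnsVec_eq χ fun g => ?_
  rw [← mul_assoc, χ.map_mul, mul_smul_comm, map_smul, χ.map_mul_proj hp, smul_eq_mul, mul_comm]

lemma isIrreducibleRep_gnsRep {φ : I → R} (hφ : IsCornerSystem φ) {n : I}
    (χ : CornerState (φ n)) : IsIrreducibleRep (gnsRep hφ χ) where
  ne_zero := by
    refine ⟨φ n, fun h => ?_⟩
    have h1 := gnsRep_gnsVec hφ χ (φ n) (φ n)
    rw [h, hφ.mul_self, zero_apply] at h1
    have h2 := inner_gnsVec χ (φ n) (φ n)
    rw [← h1, inner_zero_left, hφ.star_eq, hφ.mul_self, χ.map_proj] at h2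
    exact zero_ne_one h2
  eq_bot_or_eq_top K hK hinv := by
    have hproj : ∀ η, gnsRep hφ χ (φ n) η = ⟪gnsVec χ (φ n), η⟫_ℂ • gnsVec χ (φ n) := by
      refine gnsVec_ext χ (S := fun η => gnsRep hφ χ (φ n) η)
        (T := fun η => ⟪gnsVec χ (φ n), η⟫_ℂ • gnsVec χ (φ n)) (gnsRep hφ χ (φ n)).continuous
        (by fun_prop) fun g => ?_
      rw [gnsRep_gnsVec, gnsVec_proj_mul (hφ.mul_self n), inner_gnsVec, hφ.star_eq,
        χ.map_proj_mul (hφ.mul_self n)]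
    have hcyc : ∀ f, gnsRep hφ χ f (gnsVec χ (φ n)) = gnsVec χ f := fun f => by
      rw [gnsRep_gnsVec, gnsVec_mul_proj (hφ.mul_self n)]
    -- An invariant subspace orthogonal to the cyclic vector is orthogonal to its whole orbit and is
    -- zero. Otherwise the rank one projection puts the cyclic vector into it, and the subspace is
    -- everything.
    by_cases h : ∀ η ∈ K, ⟪gnsVec χ (φ n), η⟫_ℂ = 0
    · left
      rw [eq_bot_iff]
      intro η hη
      refine (denseRange_gnsVec χ).eq_zero_of_inner_right (𝕜 := ℂ) fun f => ?_
      have h1 := ContinuousLinearMap.adjoint_inner_right (gnsRep hφ χ f) (gnsVec χ (φ n)) η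
      rw [← hcyc, ← h1]
      change ⟪gnsVec χ (φ n), star (gnsRep hφ χ f) η⟫_ℂ = 0
      rw [← map_star]
      exact h _ (hinv (star f) η hη)
    · right
      push Not at h
      obtain ⟨η, hη, h0⟩ := h
      have h1 : gnsVec χ (φ n) ∈ K := by
        have := hinv (φ n) η hη
        rw [hproj] at this
        exact (Submodule.smul_mem_iff _ h0).1 this
      rw [eq_top_iff]
      rintro x -
      have h2 : Set.range (gnsVec χ) ⊆ K := by
        rintro _ ⟨f, rfl⟩
        rw [← hcyc]
        exact hinv f _ h1
      exact closure_minimal h2 hK (denseRange_gnsVec χ x)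

lemma IsCornerSystem.exists_rep_ne_zero {φ : I → R} (hφ : IsCornerSystem φ) {f : R} (hf : f ≠ 0) :
    ∃ (H : Type) (_ : NormedAddCommGroup H) (_ : InnerProductSpace ℂ H) (_ : CompleteSpace H)
      (π : R →⋆ₙₐ[ℂ] (H →L[ℂ] H)), IsIrreducibleRep π ∧ π f ≠ 0 := by
  obtain ⟨n, χ, hχ⟩ := hφ.exists_state f hf
  refine ⟨GNS χ, inferInstance, inferInstance, inferInstance, gnsRep hφ χ,
    isIrreducibleRep_gnsRep hφ χ, fun h => hχ ?_⟩
  have h1 := gnsRep_gnsVec hφ χ f (φ n)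
  rw [h, zero_apply, gnsVec_mul_proj (hφ.mul_self n)] at h1
  rw [← inner_gnsVec, ← h1, inner_zero_left]

end CornerSystems

/-! ### The universal C*-norm and its completion. -/

section UniversalNorm

open scoped ENNReal InnerProductSpace

universe u

variable {I : Type} [DecidableEq I] {R : Type} [NonUnitalRing R] [StarRing R] [Module ℂ R]

lemma IsCornerSystem.isStarProjection_map {φ : I → R} (hφ : IsCornerSystem φ) {B : Type*}
    [NonUnitalRing B] [StarRing B] [Module ℂ B] (π : R →⋆ₙₐ[ℂ] B) (n : I) :
    IsStarProjection (π (φ n)) where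
  isIdempotentElem := by
    change π (φ n) * π (φ n) = π (φ n)
    rw [← map_mul, hφ.mul_self]
  isSelfAdjoint := by
    change star (π (φ n)) = π (φ n)
    rw [← map_star, hφ.star_eq]

/-- The norms of an element in the bounded representations are bounded. -/
lemma IsCornerSystem.exists_norm_le {φ : I → R} (hφ : IsCornerSystem φ) (f : R) : ∃ C : ℝ,
    ∀ (H : Type u) [NormedAddCommGroup H] [InnerProductSpace ℂ H] [CompleteSpace H]
      (π : R →⋆ₙₐ[ℂ] (H →L[ℂ] H)), ‖π f‖ ≤ C := by
  have hf : f ∈ (⊤ : Submodule ℂ R) := trivial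
  rw [← hφ.span_dominated] at hf
  induction hf using Submodule.span_induction with
  | zero => exact ⟨0, fun H _ _ _ π => by rw [map_zero, norm_zero]⟩
  | add f f' _ _ h h' =>
    obtain ⟨C, hC⟩ := h
    obtain ⟨C', hC'⟩ := h'
    refine ⟨C + C', fun H _ _ _ π => ?_⟩
    rw [map_add]
    exact (norm_add_le _ _).trans (add_le_add (hC H π) (hC' H π))
  | smul r f _ h =>
    obtain ⟨C, hC⟩ := h
    refine ⟨‖r‖ * C, fun H _ _ _ π => ?_⟩
    rw [map_smul, norm_smul]
    exact mul_le_mul_of_nonneg_left (hC H π) (norm_nonneg r)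
  | mem f hf =>
    obtain ⟨n, c, ι, _, h, ⟨i, rfl⟩, hc⟩ := hf
    refine ⟨√|c|, fun H _ _ _ π => ?_⟩
    refine ContinuousLinearMap.opNorm_le_bound _ (Real.sqrt_nonneg _) fun x => ?_
    rw [← Real.sqrt_sq (norm_nonneg x), ← Real.sqrt_mul (abs_nonneg c)]
    refine Real.le_sqrt_of_sq_le ?_
    have h1 : ∑ j, ‖π (h j) x‖ ^ 2 = RCLike.re ⟪x, (c : ℂ) • π (φ n) x⟫_ℂ := by
      have h2 : ∑ j, star (π (h j)) * π (h j) = (c : ℂ) • π (φ n) := by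
        rw [← map_smul, ← hc, map_sum]
        simp only [map_mul, map_star]
      have h3 : ∑ j, (star (π (h j)) * π (h j)) x = (c : ℂ) • π (φ n) x := by
        rw [← sum_apply, h2, smul_apply]
      rw [← h3, inner_sum, map_sum]
      refine Finset.sum_congr rfl fun j _ => ?_
      rw [mul_apply_eq_comp, ContinuousLinearMap.star_eq_adjoint,
        ContinuousLinearMap.adjoint_inner_right, inner_self_eq_norm_sq]
    have h2 : ‖π (φ n) x‖ ≤ ‖x‖ :=
      (ContinuousLinearMap.le_of_opNorm_le _
        (IsStarProjection.norm_le _ (hφ.isStarProjection_map π n)) x).trans_eq (one_mul _)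
    calc ‖π (h i) x‖ ^ 2 ≤ ∑ j, ‖π (h j) x‖ ^ 2 :=
          Finset.single_le_sum (f := fun j => ‖π (h j) x‖ ^ 2)
            (fun j _ => by positivity) (Finset.mem_univ i)
      _ = RCLike.re ⟪x, (c : ℂ) • π (φ n) x⟫_ℂ := h1
      _ ≤ ‖x‖ * ‖(c : ℂ) • π (φ n) x‖ := re_inner_le_norm _ _
      _ = |c| * (‖x‖ * ‖π (φ n) x‖) := by
          rw [norm_smul, Complex.norm_real, Real.norm_eq_abs]; ring
      _ ≤ |c| * ‖x‖ ^ 2 := by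
          rw [sq]
          exact mul_le_mul_of_nonneg_left (mul_le_mul_of_nonneg_left h2 (norm_nonneg x))
            (abs_nonneg c)

lemma IsCornerSystem.bddAbove_irrepNorms {φ : I → R} (hφ : IsCornerSystem φ) (f : R) :
    BddAbove (irrepNorms f) := by
  obtain ⟨C, hC⟩ := hφ.exists_norm_le.{0} f
  refine ⟨C, ?_⟩
  rintro _ ⟨H, _, _, _, π, -, rfl⟩
  exact hC H π

variable (R) in
/-- An irreducible representation by bounded operators on a Hilbert space. -/
structure Irrep : Type 1 where
  /-- The Hilbert space. -/
  space : Type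
  [normed : NormedAddCommGroup space]
  [inner : InnerProductSpace ℂ space]
  [complete : CompleteSpace space]
  /-- The representation. -/
  rep : R →⋆ₙₐ[ℂ] (space →L[ℂ] space)
  irreducible : IsIrreducibleRep rep

attribute [instance] Irrep.normed Irrep.inner Irrep.complete

variable (R) in
/-- The norm functions of the irreducible representations. -/
abbrev IrrepNorm : Type := {N : R → ℝ // ∃ π : Irrep R, N = fun f => ‖π.rep f‖}

/-- A representation with the given norm function. -/
def IrrepNorm.irrep (N : IrrepNorm R) : Irrep R := N.2.choose

lemma IrrepNorm.norm_rep (N : IrrepNorm R) (f : R) : ‖N.irrep.rep f‖ = N.1 f :=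
  (congrFun N.2.choose_spec f).symm

/-- Irreducible representations form a proper class relative to `Type`, but their norm functions on
R do not. Choosing one representation for each function makes the product small without changing the
supremum. -/
lemma irrepNorms_eq (f : R) : irrepNorms f = Set.range fun N : IrrepNorm R => N.1 f := by
  ext r
  constructor
  · rintro ⟨H, _, _, _, π, hπ, rfl⟩
    exact ⟨⟨fun f => ‖π f‖, ⟨H, π, hπ⟩, rfl⟩, rfl⟩
  · rintro ⟨N, rfl⟩
    exact ⟨N.irrep.space, inferInstance, inferInstance, inferInstance, N.irrep.rep,
      N.irrep.irreducible, (N.norm_rep f).symm⟩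

/-- The C*-algebra of bounded families of operators on the spaces of the irreducible
representations. -/
abbrev IrrepProd (R : Type) [NonUnitalRing R] [StarRing R] [Module ℂ R] : Type :=
  lp (fun N : IrrepNorm R => N.irrep.space →L[ℂ] N.irrep.space) ∞

/-- The product of the irreducible representations. -/
def IsCornerSystem.universalRep {φ : I → R} (hφ : IsCornerSystem φ) : R →⋆ₙₐ[ℂ] IrrepProd R where
  toFun f := ⟨fun N => N.irrep.rep f, memℓp_infty (by
    have := hφ.bddAbove_irrepNorms f
    rw [irrepNorms_eq] at this
    simpa only [IrrepNorm.norm_rep] using this)⟩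
  map_smul' r f := by
    ext N : 2
    exact map_smul N.irrep.rep r f
  map_zero' := by
    ext N : 2
    exact map_zero N.irrep.rep
  map_add' f g := by
    ext N : 2
    exact map_add N.irrep.rep f g
  map_mul' f g := by
    ext N : 2
    exact map_mul N.irrep.rep f g
  map_star' f := by
    ext N : 2
    exact map_star N.irrep.rep f

lemma IsCornerSystem.universalRep_apply {φ : I → R} (hφ : IsCornerSystem φ) (f : R)
    (N : IrrepNorm R) : hφ.universalRep f N = N.irrep.rep f := rfl

lemma IsCornerSystem.norm_universalRep {φ : I → R} (hφ : IsCornerSystem φ) (f : R) :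
    ‖hφ.universalRep f‖ = uNorm f := by
  rw [lp.norm_eq_ciSup, uNorm, irrepNorms_eq, ← iSup]
  simp only [universalRep_apply, IrrepNorm.norm_rep]

lemma isCStarNorm_norm_map {B : Type*} [NonUnitalCStarAlgebra B] (π : R →⋆ₙₐ[ℂ] B)
    (h : ∀ f, π f = 0 → f = 0) : IsCStarNorm fun f => ‖π f‖ where
  eq_zero_iff f := by
    rw [norm_eq_zero]
    exact ⟨h f, fun h => by rw [h, map_zero]⟩
  add_le f g := by
    rw [map_add]
    exact norm_add_le _ _
  smul r f := by
    rw [map_smul]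
    exact norm_smul _ _
  mul_le f g := by
    rw [map_mul]
    exact norm_mul_le _ _
  star_mul_self f := by
    rw [map_mul, map_star, CStarRing.norm_star_mul_self, sq]

/-- The closure of the image of π is a C*-algebra with the required norm. -/
lemma exists_isCStarCompletion {B : Type} [NonUnitalCStarAlgebra B] (π : R →⋆ₙₐ[ℂ] B) :
    ∃ (𝔄 : Type) (_ : NonUnitalCStarAlgebra 𝔄) (ι : R →⋆ₙₐ[ℂ] 𝔄),
      IsCStarCompletion (fun f => ‖π f‖) ι := by
  let S := (NonUnitalStarAlgHom.range π).topologicalClosure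
  have hS : IsClosed (S : Set B) := NonUnitalStarSubalgebra.isClosed_topologicalClosure _
  have hmem : ∀ f, π f ∈ S := fun f =>
    NonUnitalStarSubalgebra.le_topologicalClosure _ ⟨f, rfl⟩
  let ι := NonUnitalStarAlgHom.codRestrict π S hmem
  refine ⟨S, NonUnitalStarSubalgebra.nonUnitalCStarAlgebra S (h_closed := hS), ι, fun f => rfl, ?_⟩
  intro x
  rw [closure_subtype]
  have h1 : Subtype.val '' Set.range ι = Set.range π := by
    rw [← Set.range_comp]; rfl
  rw [h1]
  exact x.2

lemma IsCornerSystem.exists_completion {φ : I → R} (hφ : IsCornerSystem φ) :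
    ∃ (𝔄 : Type) (_ : NonUnitalCStarAlgebra 𝔄) (ι : R →⋆ₙₐ[ℂ] 𝔄), IsCStarCompletion uNorm ι := by
  rw [← funext hφ.norm_universalRep]
  exact exists_isCStarCompletion hφ.universalRep

variable [IsScalarTower ℂ R R] [SMulCommClass ℂ R R] [StarModule ℂ R]

lemma IsCornerSystem.isCStarNorm {φ : I → R} (hφ : IsCornerSystem φ) :
    IsCStarNorm (uNorm : R → ℝ) := by
  rw [← funext hφ.norm_universalRep]
  refine isCStarNorm_norm_map hφ.universalRep fun f h => ?_
  by_contra hf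
  obtain ⟨H, _, _, _, π, hπ, hne⟩ := hφ.exists_rep_ne_zero hf
  -- The representation chosen for this norm function may differ from π, but it vanishes on the same
  -- elements.
  let N : IrrepNorm R := ⟨fun f => ‖π f‖, ⟨H, π, hπ⟩, rfl⟩
  have h1 : N.irrep.rep f = 0 := by
    rw [← hφ.universalRep_apply, h]; rfl
  have h2 := N.norm_rep f
  rw [h1, norm_zero] at h2
  exact hne (norm_eq_zero.1 h2.symm)

end UniversalNorm

/-! ### Irreducible representations: rank one corners and compactness. -/

section Liminality

open scoped InnerProductSpace

variable {I : Type} [DecidableEq I] {R : Type} [NonUnitalRing R] [StarRing R] [Module ℂ R]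
  {H : Type*} [NormedAddCommGroup H] [InnerProductSpace ℂ H] [CompleteSpace H]

/-- The closure of the orbit is invariant, and it is nonzero by hypothesis. -/
lemma IsIrreducibleRep.dense_range {A : Type*} [NonUnitalRing A] [StarRing A] [Module ℂ A]
    {π : A →⋆ₙₐ[ℂ] (H →L[ℂ] H)} (hπ : IsIrreducibleRep π) {x : H} (hx : ∃ f, π f x ≠ 0) :
    Dense (Set.range fun g => π g x) := by
  let L : A →ₗ[ℂ] H :=
    { toFun := fun g => π g x
      map_add' := fun g h => by rw [map_add]; rfl
      map_smul' := fun r g => by rw [map_smul]; rfl }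
  have h1 := hπ.eq_bot_or_eq_top (LinearMap.range L).topologicalClosure
    (Submodule.isClosed_topologicalClosure _) (fun g ξ hξ => by
      refine map_mem_closure (π g).continuous hξ ?_
      rintro _ ⟨h, rfl⟩
      exact ⟨g * h, by change π (g * h) x = π g (π h x); rw [map_mul]; rfl⟩)
  rcases h1 with h1 | h1
  · obtain ⟨f, hf⟩ := hx
    have h2 : L f ∈ (LinearMap.range L).topologicalClosure :=
      Submodule.le_topologicalClosure _ ⟨f, rfl⟩
    rw [h1] at h2
    exact absurd ((Submodule.mem_bot ℂ).1 h2) hf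
  · intro y
    have h2 : y ∈ (LinearMap.range L).topologicalClosure := by rw [h1]; trivial
    exact h2

lemma rank_le_one_of_eq_inner_smul {E : Type*} [NormedAddCommGroup E]
    [InnerProductSpace ℂ E] {T : E →L[ℂ] E} {ξ : E} (h : ∀ x, T x = ⟪ξ, x⟫_ℂ • ξ) :
    (T : E →ₗ[ℂ] E).rank ≤ 1 := by
  have h1 : LinearMap.range (T : E →ₗ[ℂ] E) ≤ Submodule.span ℂ {ξ} := by
    rintro _ ⟨x, rfl⟩
    exact Submodule.mem_span_singleton.2 ⟨_, (h x).symm⟩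
  exact (Submodule.rank_mono h1).trans ((rank_span_le _).trans (by simp))

lemma isCompactOperator_of_eq_inner_smul {E : Type*} [NormedAddCommGroup E]
    [InnerProductSpace ℂ E] {T : E →L[ℂ] E} {ξ : E} (h : ∀ x, T x = ⟪ξ, x⟫_ℂ • ξ) : IsCompactOperator T := by
  have h1 : (T : E → E) = (ContinuousLinearMap.toSpanSingleton ℂ ξ) ∘ (innerSL ℂ ξ) := by
    funext x
    rw [h]
    rfl
  rw [h1]
  exact (isCompactOperator_of_locallyCompactSpace_dom (innerSL ℂ ξ)).clm_comp _

section Corner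

variable {φ : I → R} {π : R →⋆ₙₐ[ℂ] (H →L[ℂ] H)}

lemma IsCornerSystem.map_corner (hφ : IsCornerSystem φ) (π : R →⋆ₙₐ[ℂ] (H →L[ℂ] H)) (n : I)
    (f : R) : π (φ n) * π (φ n * f * φ n) = π (φ n * f * φ n) ∧
      π (φ n * f * φ n) * π (φ n) = π (φ n * f * φ n) := by
  rw [← map_mul, ← map_mul]
  exact ⟨by rw [← mul_assoc, ← mul_assoc, hφ.mul_self], by rw [mul_assoc, hφ.mul_self]⟩

/-- A form of Schur's lemma for the corner. If S P x ≠ 0, where P = π(φ n), this vector lies in the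
range of P and has dense orbit. Commuting T with the corner gives T P π(g) S P x = π(φ n * g * φ n)
T S P x = 0, so T P = 0. -/
lemma IsCornerSystem.eq_zero_or_eq_zero (hφ : IsCornerSystem φ)
    (hπ : IsIrreducibleRep π) (n : I) {S T : H →L[ℂ] H} (hST : T * S = 0)
    (hS : ∀ f, Commute S (π (φ n * f * φ n))) (hT : ∀ f, Commute T (π (φ n * f * φ n))) :
    S * π (φ n) = 0 ∨ T * π (φ n) = 0 := by
  have hφn : φ n * φ n * φ n = φ n := by rw [hφ.mul_self, hφ.mul_self]
  by_contra! h
  obtain ⟨hS0, hT0⟩ := h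
  obtain ⟨x, hx⟩ : ∃ x, S (π (φ n) x) ≠ 0 := by
    by_contra! h
    exact hS0 (ContinuousLinearMap.ext h)
  have hS' := hS (φ n)
  rw [hφn] at hS'
  have h1 : π (φ n) (S (π (φ n) x)) = S (π (φ n) x) := by
    have h2 : π (φ n) * S * π (φ n) = S * π (φ n) := by
      rw [← hS'.eq, mul_assoc, ← map_mul, hφ.mul_self]
    exact congrArg (fun U : H →L[ℂ] H => U x) h2
  have hd := hπ.dense_range (x := S (π (φ n) x)) ⟨φ n, by rwa [h1]⟩
  refine hT0 (ContinuousLinearMap.ext fun z => ?_)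
  have hcl : IsClosed {z | T (π (φ n) z) = 0} :=
    isClosed_eq (T.continuous.comp (π (φ n)).continuous) continuous_const
  refine (closure_minimal ?_ hcl) (hd z)
  rintro _ ⟨g, rfl⟩
  change T (π (φ n) (π g (S (π (φ n) x)))) = 0
  rw [← h1]
  have h2 : T * π (φ n) * π g * π (φ n) * S * π (φ n) = 0 := by
    have h3 : T * π (φ n) * π g * π (φ n) = T * π (φ n * g * φ n) := by
      simp only [map_mul, mul_assoc]
    rw [h3, (hT g).eq, mul_assoc _ T, hST, mul_zero, zero_mul]
  exact congrArg (fun U : H →L[ℂ] H => U x) h2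

/-- The positive and negative parts of S = π(φ n * f * φ n) - c P have product zero and commute with
the commutative corner, by functional calculus. One of them therefore vanishes on the range of P,
and S has a sign there. -/
lemma IsCornerSystem.rayleigh_dichotomy (hφ : IsCornerSystem φ)
    (hπ : IsIrreducibleRep π) (n : I) {f : R} (hf : star f = f) (c : ℝ) :
    (∀ x, c * ‖π (φ n) x‖ ^ 2 ≤ RCLike.re ⟪x, π (φ n * f * φ n) x⟫_ℂ) ∨
    (∀ x, RCLike.re ⟪x, π (φ n * f * φ n) x⟫_ℂ ≤ c * ‖π (φ n) x‖ ^ 2) := by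
  have hP := hφ.isStarProjection_map π n
  have hφn : φ n * φ n * φ n = φ n := by rw [hφ.mul_self, hφ.mul_self]
  obtain ⟨hl, hr⟩ := hφ.map_corner π n f
  set P := π (φ n) with hPdef
  set T := π (φ n * f * φ n) with hTdef
  have hPP : P * P = P := hP.isIdempotentElem
  have hTs : IsSelfAdjoint T := by
    change star (π (φ n * f * φ n)) = _
    rw [← map_star, star_mul, star_mul, hφ.star_eq, hf, ← mul_assoc]
  set S := T - (c : ℂ) • P with hS
  have hSs : IsSelfAdjoint S := by
    refine hTs.sub ?_
    change star ((c : ℂ) • P) = _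
    rw [star_smul, hP.isSelfAdjoint.star_eq, Complex.star_def, Complex.conj_ofReal]
  have hcomm : ∀ g, Commute S (π (φ n * g * φ n)) := fun g => by
    obtain ⟨hl', hr'⟩ := hφ.map_corner π n g
    refine Commute.sub_left ?_ (Commute.smul_left ?_ _)
    · change π _ * π _ = π _ * π _
      rw [← map_mul, ← map_mul, hφ.corner_comm]
    · change π (φ n) * _ = _ * π (φ n)
      rw [hl', hr']
  have hquad : ∀ x, RCLike.re ⟪x, T x⟫_ℂ = c * ‖P x‖ ^ 2 + RCLike.re ⟪P x, S (P x)⟫_ℂ := by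
    intro x
    have h1 : ∀ y, ⟪P x, y⟫_ℂ = ⟪x, P y⟫_ℂ := fun y => by
      rw [← ContinuousLinearMap.adjoint_inner_right, ← ContinuousLinearMap.star_eq_adjoint,
        hP.isSelfAdjoint.star_eq]
    have h2 : P (S (P x)) = S x := by
      have : P * S * P = S := by
        rw [hS, mul_sub, sub_mul, hl, hr, mul_smul_comm, smul_mul_assoc, hPP, hPP]
      exact congrArg (fun U : H →L[ℂ] H => U x) this
    have h3 : T x = (c : ℂ) • P x + S x := by
      rw [hS]
      simp
    have h4 : ⟪x, P x⟫_ℂ = ((‖P x‖ ^ 2 : ℝ) : ℂ) := by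
      have h5 := h1 (P x)
      have h6 : P (P x) = P x := congrArg (fun U : H →L[ℂ] H => U x) hPP
      rw [h6] at h5
      rw [← h5, inner_self_eq_norm_sq_to_K]
      push_cast
      rfl
    rw [h1, h2, h3, inner_add_right, inner_smul_right, h4, map_add, ← Complex.ofReal_mul]
    rfl
  have hpos : ∀ U : H →L[ℂ] H, 0 ≤ U → ∀ x, 0 ≤ RCLike.re ⟪P x, U (P x)⟫_ℂ := fun U hU x =>
    ((ContinuousLinearMap.nonneg_iff_isPositive U).1 hU).re_inner_nonneg_right _
  have hSpm : ∀ x, S (P x) = S⁺ (P x) - S⁻ (P x) := fun x => by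
    conv_lhs => rw [← CFC.posPart_sub_negPart S hSs]
    rfl
  rcases hφ.eq_zero_or_eq_zero hπ n (S := S⁻) (T := S⁺) (CFC.posPart_mul_negPart S)
    (fun g => (hcomm g).cfcₙ_real _) (fun g => (hcomm g).cfcₙ_real _) with h | h
  · left
    intro x
    have h0 : S⁻ (P x) = 0 := congrArg (fun U : H →L[ℂ] H => U x) h
    rw [hquad, hSpm, h0, sub_zero]
    exact le_add_of_nonneg_right (hpos _ (CFC.posPart_nonneg S) x)
  · right
    intro x
    have h0 : S⁺ (P x) = 0 := congrArg (fun U : H →L[ℂ] H => U x) h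
    rw [hquad, hSpm, h0, zero_sub, inner_neg_right, map_neg]
    have := hpos _ (CFC.negPart_nonneg S) x
    linarith

/-- By the dichotomy no real number can lie strictly between two values of the Rayleigh quotient of
the corner element on the range of P, so the quotient is a constant c. An operator on a complex
space is determined by its quadratic form. -/
lemma IsCornerSystem.exists_eq_smul_of_star_eq (hφ : IsCornerSystem φ)
    (hπ : IsIrreducibleRep π) (n : I) {f : R} (hf : star f = f) :
    ∃ c : ℂ, π (φ n * f * φ n) = c • π (φ n) := by
  have hP := hφ.isStarProjection_map π n
  obtain ⟨hl, hr⟩ := hφ.map_corner π n f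
  have hdich := hφ.rayleigh_dichotomy hπ n hf
  have hTs : star (π (φ n * f * φ n)) = π (φ n * f * φ n) := by
    rw [← map_star, star_mul, star_mul, hφ.star_eq, hf, ← mul_assoc]
  set P := π (φ n) with hPdef
  set T := π (φ n * f * φ n) with hTdef
  by_cases hP0 : P = 0
  · exact ⟨0, by rw [zero_smul, ← hr, hP0, mul_zero]⟩
  obtain ⟨x₀, hx₀⟩ : ∃ x, P x ≠ 0 := by
    by_contra! h
    exact hP0 (ContinuousLinearMap.ext h)
  have hn₀ : 0 < ‖P x₀‖ ^ 2 := by positivity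
  set r : H → ℝ := fun x => RCLike.re ⟪x, T x⟫_ℂ with hrdef
  set c : ℝ := r x₀ / ‖P x₀‖ ^ 2 with hc
  have hc' : r x₀ = c * ‖P x₀‖ ^ 2 := by rw [hc]; field_simp
  have hkey : ∀ x, r x = c * ‖P x‖ ^ 2 := by
    intro x
    by_cases hx : P x = 0
    · have h1 : T x = 0 := by
        rw [← hr]
        change T (P x) = 0
        rw [hx, map_zero]
      simp only [hrdef]
      rw [hx, h1, inner_zero_right, norm_zero]
      simp
    have hn : 0 < ‖P x‖ ^ 2 := by positivity
    set d : ℝ := r x / ‖P x‖ ^ 2 with hd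
    have hd' : r x = d * ‖P x‖ ^ 2 := by rw [hd]; field_simp
    rw [hd']
    congr 1
    by_contra hne
    -- The midpoint of two different values contradicts both alternatives.
    rcases hdich ((c + d) / 2) with h | h
    · have h1 := h x₀
      have h2 := h x
      change _ ≤ r x₀ at h1
      change _ ≤ r x at h2
      rw [hc'] at h1
      rw [hd'] at h2
      have h3 := le_of_mul_le_mul_right h1 hn₀
      have h4 := le_of_mul_le_mul_right h2 hn
      exact hne (by linarith)
    · have h1 := h x₀
      have h2 := h x
      change r x₀ ≤ _ at h1
      change r x ≤ _ at h2
      rw [hc'] at h1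
      rw [hd'] at h2
      have h3 := le_of_mul_le_mul_right h1 hn₀
      have h4 := le_of_mul_le_mul_right h2 hn
      exact hne (by linarith)
  refine ⟨c, ?_⟩
  have hself : ∀ x, ⟪T x - (c : ℂ) • P x, x⟫_ℂ = 0 := by
    intro x
    have hreal : ∀ U : H →L[ℂ] H, star U = U → ⟪U x, x⟫_ℂ = (RCLike.re ⟪x, U x⟫_ℂ : ℝ) := by
      intro U hU
      have h1 : ⟪U x, x⟫_ℂ = ⟪x, U x⟫_ℂ := by
        rw [← ContinuousLinearMap.adjoint_inner_right, ← ContinuousLinearMap.star_eq_adjoint, hU]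
      have h2 := inner_conj_symm (𝕜 := ℂ) x (U x)
      rw [h1] at h2 ⊢
      exact (Complex.conj_eq_iff_re.1 h2).symm
    have h1 : RCLike.re ⟪x, P x⟫_ℂ = ‖P x‖ ^ 2 := by
      have h2 : P (P x) = P x := congrArg (fun U : H →L[ℂ] H => U x) hP.isIdempotentElem
      conv_lhs => rw [← h2]
      rw [← ContinuousLinearMap.adjoint_inner_left, ← ContinuousLinearMap.star_eq_adjoint,
        hP.isSelfAdjoint.star_eq, inner_self_eq_norm_sq]
    rw [inner_sub_left, inner_smul_left, hreal T hTs, hreal P hP.isSelfAdjoint.star_eq, h1]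
    have h3 := hkey x
    simp only [hrdef] at h3
    rw [h3, Complex.conj_ofReal]
    push_cast
    ring
  have := (inner_map_self_eq_zero (T - (c : ℂ) • P).toLinearMap).1 hself
  rw [← sub_eq_zero]
  exact ContinuousLinearMap.coe_injective this

/-- Real and imaginary parts reduce this to the self-adjoint case. -/
lemma IsCornerSystem.exists_eq_smul [IsScalarTower ℂ R R] [SMulCommClass ℂ R R] [StarModule ℂ R]
    (hφ : IsCornerSystem φ) (hπ : IsIrreducibleRep π) (n : I) (f : R) :
    ∃ c : ℂ, π (φ n * f * φ n) = c • π (φ n) := by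
  have hf := realPart_add_I_smul_imaginaryPart f
  obtain ⟨c, hc⟩ := hφ.exists_eq_smul_of_star_eq hπ n (realPart f).2.star_eq
  obtain ⟨d, hd⟩ := hφ.exists_eq_smul_of_star_eq hπ n (imaginaryPart f).2.star_eq
  refine ⟨c + Complex.I * d, ?_⟩
  rw [← hf, mul_add, add_mul, mul_smul_comm, smul_mul_assoc, map_add, map_smul, hc, hd, smul_smul,
    add_smul]

/-- In an irreducible representation, the projections of a corner system have rank at most one. -/
lemma IsCornerSystem.exists_eq_inner_smul [IsScalarTower ℂ R R] [SMulCommClass ℂ R R]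
    [StarModule ℂ R] (hφ : IsCornerSystem φ) (hπ : IsIrreducibleRep π) (n : I) :
    ∃ ξ : H, ∀ x, π (φ n) x = ⟪ξ, x⟫_ℂ • ξ := by
  have hP := hφ.isStarProjection_map π n
  by_cases hP0 : π (φ n) = 0
  · exact ⟨0, fun x => by rw [hP0, smul_zero, zero_apply]⟩
  obtain ⟨x₀, hx₀⟩ : ∃ x, π (φ n) x ≠ 0 := by
    by_contra! h
    exact hP0 (ContinuousLinearMap.ext h)
  have hPP : ∀ x, π (φ n) (π (φ n) x) = π (φ n) x := fun x =>
    congrArg (fun U : H →L[ℂ] H => U x) hP.isIdempotentElem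
  set ξ : H := ((‖π (φ n) x₀‖⁻¹ : ℝ) : ℂ) • π (φ n) x₀ with hξ
  have hξP : π (φ n) ξ = ξ := by rw [hξ, map_smul, hPP]
  have hξn : ‖ξ‖ = 1 := by
    rw [hξ, norm_smul, Complex.norm_real, Real.norm_eq_abs, abs_of_nonneg (by positivity)]
    exact inv_mul_cancel₀ (norm_ne_zero_iff.2 hx₀)
  have hξ0 : ξ ≠ 0 := fun h => by rw [h, norm_zero] at hξn; exact zero_ne_one hξn
  have hd := hπ.dense_range (x := ξ) ⟨φ n, by rwa [hξP]⟩
  -- The vectors π(g)ξ are dense, and P sends each of them to a multiple of ξ because the corner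
  -- acts by scalars.
  have hspan : ∀ y, π (φ n) y ∈ Submodule.span ℂ {ξ} := by
    intro y
    have hcl : IsClosed {y | π (φ n) y ∈ Submodule.span ℂ {ξ}} :=
      (Submodule.closed_of_finiteDimensional (Submodule.span ℂ {ξ})).preimage
        (π (φ n)).continuous
    refine (closure_minimal ?_ hcl) (hd y)
    rintro _ ⟨g, rfl⟩
    obtain ⟨c, hc⟩ := hφ.exists_eq_smul hπ n g
    refine Submodule.mem_span_singleton.2 ⟨c, ?_⟩
    have h1 : π (φ n) (π g (π (φ n) ξ)) = c • π (φ n) ξ := by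
      rw [map_mul, map_mul] at hc
      exact congrArg (fun U : H →L[ℂ] H => U ξ) hc
    rw [hξP] at h1
    exact h1.symm
  refine ⟨ξ, fun y => ?_⟩
  obtain ⟨r, hr⟩ := Submodule.mem_span_singleton.1 (hspan y)
  have h1 : ⟪ξ, π (φ n) y⟫_ℂ = ⟪ξ, y⟫_ℂ := by
    rw [← ContinuousLinearMap.adjoint_inner_left, ← ContinuousLinearMap.star_eq_adjoint,
      hP.isSelfAdjoint.star_eq, hξP]
  have h2 : ⟪ξ, π (φ n) y⟫_ℂ = r := by
    rw [← hr, inner_smul_right, inner_self_eq_norm_sq_to_K, hξn]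
    simp
  rw [← h1, h2, hr]

/-- An element is a finite sum of the f * φ n, each of which acts with rank at most one. -/
lemma IsCornerSystem.isCompactOperator [IsScalarTower ℂ R R] [SMulCommClass ℂ R R]
    [StarModule ℂ R] (hφ : IsCornerSystem φ) (hπ : IsIrreducibleRep π) (f : R) :
    IsCompactOperator (π f) := by
  obtain ⟨F, hF⟩ := hφ.exists_sum f
  have h1 : ∀ n, π (f * φ n) ∈ compactOperator (RingHom.id ℂ) H H := by
    intro n
    obtain ⟨ξ, hξ⟩ := hφ.exists_eq_inner_smul hπ n
    rw [map_mul]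
    exact (isCompactOperator_of_eq_inner_smul hξ).clm_comp (π f)
  have h2 : π f ∈ compactOperator (RingHom.id ℂ) H H := by
    rw [← hF, map_sum]
    exact Submodule.sum_mem _ fun n _ => h1 n
  exact h2

end Corner

section Completion

variable {𝔄 : Type*} [NonUnitalCStarAlgebra 𝔄] {ι : R →⋆ₙₐ[ℂ] 𝔄}

lemma continuous_starAlgHom {B : Type*} [NonUnitalCStarAlgebra B] (π : 𝔄 →⋆ₙₐ[ℂ] B) :
    Continuous π :=
  AddMonoidHomClass.continuous_of_bound π 1 fun x => by
    rw [one_mul]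
    exact NonUnitalStarAlgHom.norm_apply_le π x

/-- Representations of a C*-algebra are continuous, so invariance of a closed subspace and vanishing
can be tested on a dense subalgebra. -/
lemma IsIrreducibleRep.comp_denseRange {π : 𝔄 →⋆ₙₐ[ℂ] (H →L[ℂ] H)} (hπ : IsIrreducibleRep π)
    (hι : DenseRange ι) : IsIrreducibleRep (π.comp ι) where
  ne_zero := by
    obtain ⟨x, hx⟩ := hπ.ne_zero
    by_contra! h
    refine hx ?_
    have h1 : (π : 𝔄 → (H →L[ℂ] H)) = fun _ => 0 :=
      hι.equalizer (continuous_starAlgHom π) continuous_const (funext h)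
    exact congrFun h1 x
  eq_bot_or_eq_top K hK hinv := by
    refine hπ.eq_bot_or_eq_top K hK fun x ξ hξ => ?_
    have hcl : IsClosed {x | π x ξ ∈ K} :=
      hK.preimage ((ContinuousLinearMap.apply ℂ H ξ).continuous.comp (continuous_starAlgHom π))
    refine (closure_minimal ?_ hcl) (hι x)
    rintro _ ⟨f, rfl⟩
    exact hinv f ξ hξ

lemma IsCornerSystem.isLiminal [IsScalarTower ℂ R R] [SMulCommClass ℂ R R] [StarModule ℂ R]
    {φ : I → R} (hφ : IsCornerSystem φ) (hι : DenseRange ι) : IsLiminal 𝔄 := by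
  intro H _ _ _ π hπ x
  -- Compact operators are norm closed, so it is enough to treat the image of the dense subalgebra.
  have hcl : IsClosed {x | IsCompactOperator (π x)} :=
    (isClosed_setOfPred_isCompactOperator (𝕜₁ := ℂ) (𝕜₂ := ℂ) (σ₁₂ := RingHom.id ℂ)
      (M₁ := H) (M₂ := H)).preimage (continuous_starAlgHom π)
  refine (closure_minimal ?_ hcl) (hι x)
  rintro _ ⟨f, rfl⟩
  exact hφ.isCompactOperator (hπ.comp_denseRange hι) f

end Completion

end Liminality

/-! ### The convolution algebra as a corner system. -/

section MainTheorem

variable (q : Set.Ioo (0 : ℝ) 1) (a : ℝ)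

lemma isCornerSystem_ccPhi : IsCornerSystem (ccPhi q a) where
  star_eq := star_ccPhi q a
  mul_eq := ccPhi_mul_ccPhi q a
  exists_sum f := by
    obtain ⟨F, hF⟩ := exists_eq_sum_mul_ccPhi q a f
    exact ⟨F, hF F subset_rfl⟩
  corner_comm := ccPhi_corner_comm q a
  span_dominated := span_dominated q a
  exists_state f hf := by
    obtain ⟨n, χ, h1, h2, h3, h4⟩ := exists_state q a hf
    exact ⟨n, ⟨χ, h1, h2, h3⟩, h4⟩

end MainTheorem

end QSL2

end

theorem mainTheorem4 (q : Set.Ioo (0 : ℝ) 1) (a : ℝ) :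
    -- the blocks of `𝓘` are one dimensional, with units `Φ_n`
    (∀ n : ℤ, ∃! p, QSL2.IsPhi q a n p ∧ QSL2.block q a n = Submodule.span ℂ {p}) ∧
    -- `C_c(SL_q(2, ℝ)_t)` consists of the finite sums of products `b ω`
    ((QSL2.Cc q a : Set (QSL2.Smash (QSL2.Oq q))) = Submodule.span ℂ (QSL2.ccGen q a)) ∧
    -- `‖·‖_u` is a well defined C*-norm
    (∀ f : QSL2.Cc q a, BddAbove (QSL2.irrepNorms f)) ∧
    QSL2.IsCStarNorm (QSL2.uNorm : QSL2.Cc q a → ℝ) ∧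
    -- the completion exists
    (∃ (𝔄 : Type) (_ : NonUnitalCStarAlgebra 𝔄) (ι : QSL2.Cc q a →⋆ₙₐ[ℂ] 𝔄),
      QSL2.IsCStarCompletion QSL2.uNorm ι) ∧
    -- the completion is liminal, and every `π(Φ_n)` is a projection of rank at most one
    (∀ (𝔄 : Type*) [NonUnitalCStarAlgebra 𝔄] (ι : QSL2.Cc q a →⋆ₙₐ[ℂ] 𝔄),
      QSL2.IsCStarCompletion QSL2.uNorm ι →
      QSL2.IsLiminal 𝔄 ∧
      ∀ (H : Type*) [NormedAddCommGroup H] [InnerProductSpace ℂ H] [CompleteSpace H]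
        (π : 𝔄 →⋆ₙₐ[ℂ] (H →L[ℂ] H)), QSL2.IsIrreducibleRep π →
        ∀ (n : ℤ) (p : QSL2.FullDual (QSL2.Oq q)) (hp : QSL2.IsPhi q a n p),
          IsStarProjection (π (ι (QSL2.phiElt q hp))) ∧
          (π (ι (QSL2.phiElt q hp)) : H →ₗ[ℂ] H).rank ≤ 1) := by
  have hφ := QSL2.isCornerSystem_ccPhi q a
  refine ⟨QSL2.existsUnique_isPhi q a, QSL2.coe_Cc q a, hφ.bddAbove_irrepNorms, hφ.isCStarNorm,
    hφ.exists_completion, fun 𝔄 _ ι hι => ⟨hφ.isLiminal hι.dense, ?_⟩⟩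
  intro H _ _ _ π hπ n p hp
  rw [QSL2.phiElt_eq hp]
  obtain ⟨ξ, hξ⟩ := hφ.exists_eq_inner_smul (hπ.comp_denseRange hι.dense) n
  exact ⟨hφ.isStarProjection_map (π.comp ι) n, QSL2.rank_le_one_of_eq_inner_smul hξ⟩
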